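/- For $n\ge 2$ consider pairs $(S_1,S_2)$ of nonempty disjoint subsets of $\{1,\dots,n\}$; these are the feasible solutions of the following three minimization problems, in which the cost of a pair is $\max\{x,y\}/\min\{x,y\}$ with * SSR (input: positive integers $a_1,\dots,a_n$): $x=\sum_{i\in S_1}a_i$, $y=\sum_{j\in S_2}a_j$; * Factor-$r$ SSR (input: positive integers $a_1,\dots,a_n$ and a real number $r\ge 1$): $x=r\sum_{i\in S_1}a_i$, $y=\sum_{j\in S_2}a_j$; * 2-Set SSR (input: pairs $(a_1,b_1),\dots,(a_n,b_n)$ of positive real numbers): $x=\sum_{i\in S_1}a_i$, $y=\sum_{j\in S_2}b_j$. A feasible pair is an $\alpha$-approximate solution if its cost is at most $\alpha$ times the cost of every feasible pair (so optimal means $1$-approximate). **Theorem.** 1. SSR and Factor-$r$ SSR admit fully polynomial time approximation schemes with running time $O(n^4/\varepsilon)$: for each of the two problems there are one algorithm and one constant $C$ such that for every instance with $n\ge2$ and every $\varepsilon\in(0,1)$, the algorithm, given $n$, $\varepsilon$ and the numbers of the instance, outputs a $(1+\varepsilon)$-approximate solution after at most $C\,n^4/\varepsilon$ steps. In particular $C$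 does not depend on the $a_i$ or on $r$. Here an algorithm is a program of a random access machine with word registers (natural numbers; $+$, $\cdot$, truncated $-$, comparison, indirect addressing) and real registers ($+,-,\cdot,/$, comparison, conversion from words, rounding down to a word), where every instruction is one step; throughout the computation every word is at most $C\,(n/\varepsilon)^C$, and, if $\varepsilon$ and the numbers of the instance are rational, every real register holds a rational number with at most $C\,L$ bits, where $L$ is the number of bits of the input. 2. A pair $(S_1,S_2)$ is feasible for SSR on $a_1,\dots,a_n$ if and only if it is feasible for 2-Set SSR on $(a_1,a_1),\dots,(a_n,a_n)$; it has the same cost in both problems, and for every real $\alpha$ it is an $\alpha$-approximate solution of the one if and only if it is one of the other. 3. A pair $(S_1,S_2)$ is feasible for Factor-$r$ SSR on $(a_1,\dots,a_n;r)$ if and only if $(S_2,S_1)$ is feasible for 2-Set SSR on $(a_1,ra_1),\dots,(a_n,ra_n)$; the two costs agree, and for every real $\alpha$ the pair $(S_1,S_2)$ is an $\alpha$-approximate solution of the one if and only if $(S_2,S_1)$ is one of the other. Statements 2 and 3 hold for every $n\ge0$. -/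

import Mathlib

/-! ### Subset sum ratio problems -/

namespace SubsetSumRatio

/-- The ratio `max {x, y} / min {x, y}`. It is only ever used for positive `x` and `y`. -/
noncomputable def maxMinRatio (x y : ℝ) : ℝ := max x y / min x y

/-- Pairs of nonempty disjoint sets of indices. -/
def NonemptyDisjoint {n : ℕ} (S₁ S₂ : Finset (Fin n)) : Prop :=
  S₁.Nonempty ∧ S₂.Nonempty ∧ Disjoint S₁ S₂

/-- A minimization problem over pairs of index sets. `data I` lists the numbers of which the
instance `I` consists, in the order in which an algorithm receives them. -/
structure RatioProblem where
  Inst : Type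
  size : Inst → ℕ
  data : Inst → List ℝ
  Feasible : (I : Inst) → Finset (Fin (size I)) → Finset (Fin (size I)) → Prop
  cost : (I : Inst) → Finset (Fin (size I)) → Finset (Fin (size I)) → ℝ

/-- `(S₁, S₂)` is an `α`-approximate solution of the instance `I`: it is feasible, and its cost is
at most `α` times the cost of every feasible solution, hence at most `α` times the minimum.
For `α = 1` this says that `(S₁, S₂)` is an optimal solution. -/
def RatioProblem.IsApprox (P : RatioProblem) (α : ℝ) (I : P.Inst)
    (S₁ S₂ : Finset (Fin (P.size I))) : Prop :=
  P.Feasible I S₁ S₂ ∧ ∀ T₁ T₂, P.Feasible I T₁ T₂ → P.cost I S₁ S₂ ≤ α * P.cost I T₁ T₂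

/-- Positive integers `a₁, …, aₙ`. -/
structure SSRInstance where
  n : ℕ
  a : Fin n → ℕ
  pos : ∀ i, 0 < a i

/-- Positive integers `a₁, …, aₙ` and a real number `r ≥ 1`. -/
structure FactorInstance where
  n : ℕ
  a : Fin n → ℕ
  pos : ∀ i, 0 < a i
  r : ℝ
  one_le_r : 1 ≤ r

/-- Pairs `(a₁, b₁), …, (aₙ, bₙ)` of positive real numbers. -/
structure TwoSetInstance where
  n : ℕ
  a : Fin n → ℝ
  b : Fin n → ℝ
  a_pos : ∀ i, 0 < a i
  b_pos : ∀ i, 0 < b i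

/-- The Subset Sum Ratio problem. -/
noncomputable abbrev SSR : RatioProblem where
  Inst := SSRInstance
  size I := I.n
  data I := List.ofFn fun i => (I.a i : ℝ)
  Feasible _ S₁ S₂ := NonemptyDisjoint S₁ S₂
  cost I S₁ S₂ := maxMinRatio (∑ i ∈ S₁, (I.a i : ℝ)) (∑ j ∈ S₂, (I.a j : ℝ))

/-- The Factor-`r` Subset Sum Ratio problem; `r` is a part of the input. -/
noncomputable abbrev FactorSSR : RatioProblem where
  Inst := FactorInstance
  size I := I.n
  data I := (List.ofFn fun i => (I.a i : ℝ)) ++ [I.r]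
  Feasible _ S₁ S₂ := NonemptyDisjoint S₁ S₂
  cost I S₁ S₂ := maxMinRatio (I.r * ∑ i ∈ S₁, (I.a i : ℝ)) (∑ j ∈ S₂, (I.a j : ℝ))

/-- The 2-Set Subset Sum Ratio problem. -/
noncomputable abbrev TwoSetSSR : RatioProblem where
  Inst := TwoSetInstance
  size I := I.n
  data I := List.ofFn I.a ++ List.ofFn I.b
  Feasible _ S₁ S₂ := NonemptyDisjoint S₁ S₂
  cost I S₁ S₂ := maxMinRatio (∑ i ∈ S₁, I.a i) (∑ j ∈ S₂, I.b j)

/-- The 2-Set instance `(a₁, a₁), …, (aₙ, aₙ)`. -/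
abbrev SSRInstance.toTwoSet (I : SSRInstance) : TwoSetInstance where
  n := I.n
  a i := (I.a i : ℝ)
  b i := (I.a i : ℝ)
  a_pos i := Nat.cast_pos.mpr (I.pos i)
  b_pos i := Nat.cast_pos.mpr (I.pos i)

/-- The 2-Set instance `(a₁, r a₁), …, (aₙ, r aₙ)`. -/
noncomputable abbrev FactorInstance.toTwoSet (I : FactorInstance) : TwoSetInstance where
  n := I.n
  a i := (I.a i : ℝ)
  b i := I.r * (I.a i : ℝ)
  a_pos i := Nat.cast_pos.mpr (I.pos i)
  b_pos i := mul_pos (lt_of_lt_of_le one_pos I.one_le_r) (Nat.cast_pos.mpr (I.pos i))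

/-! ### A random access machine with word registers and real registers

Word registers `W[0], W[1], …` hold natural numbers and serve for addressing, real registers
`R[0], R[1], …` hold real numbers. The input is a read-only array `X[0], X[1], …` of real numbers,
the output is an array `O[0], O[1], …` of natural numbers. Every instruction costs one step. -/

/-- The instructions. Numbers `i j k` are names of registers, `l` is a position in the program. -/
inductive Instr where
  /-- `W[i] := c` -/
  | wconst (i c : ℕ)
  /-- `W[i] := W[j] + W[k]` -/
  | wadd (i j k : ℕ)
  /-- `W[i] := max (W[j] - W[k]) 0` -/
  | wsub (i j k : ℕ)
  /-- `W[i] := W[j] * W[k]` -/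
  | wmul (i j k : ℕ)
  /-- `W[i] := W[W[j]]` -/
  | wload (i j : ℕ)
  /-- `W[W[i]] := W[j]` -/
  | wstore (i j : ℕ)
  /-- `R[i] := W[j]` -/
  | rcast (i j : ℕ)
  /-- `W[i] := ⌊R[j]⌋` (and `0` for negative `R[j]`) -/
  | rfloor (i j : ℕ)
  /-- `R[i] := R[j] + R[k]` -/
  | radd (i j k : ℕ)
  /-- `R[i] := R[j] - R[k]` -/
  | rsub (i j k : ℕ)
  /-- `R[i] := R[j] * R[k]` -/
  | rmul (i j k : ℕ)
  /-- `R[i] := R[j] / R[k]`; the machine crashes if `R[k] = 0` -/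
  | rdiv (i j k : ℕ)
  /-- `R[i] := R[W[j]]` -/
  | rload (i j : ℕ)
  /-- `R[W[i]] := R[j]` -/
  | rstore (i j : ℕ)
  /-- `R[i] := X[W[j]]` -/
  | input (i j : ℕ)
  /-- `O[W[i]] := W[j]` -/
  | output (i j : ℕ)
  /-- go to `l` -/
  | jump (l : ℕ)
  /-- if `W[i] < W[j]` go to `l` -/
  | wjump (i j l : ℕ)
  /-- if `R[i] < R[j]` go to `l` -/
  | rjump (i j l : ℕ)
  /-- stop -/
  | halt

/-- A configuration: program counter, word registers, real registers, output array. -/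
structure Config where
  pc : ℕ
  W : ℕ → ℕ
  R : ℕ → ℝ
  O : ℕ → ℕ

namespace Config

/-- Write `v` to the word register `i` and go on to the next instruction. -/
def setW (c : Config) (i v : ℕ) : Config :=
  { c with pc := c.pc + 1, W := Function.update c.W i v }

/-- Write `x` to the real register `i` and go on to the next instruction. -/
def setR (c : Config) (i : ℕ) (x : ℝ) : Config :=
  { c with pc := c.pc + 1, R := Function.update c.R i x }

/-- Write `v` to position `i` of the output and go on to the next instruction. -/
def setO (c : Config) (i v : ℕ) : Config :=
  { c with pc := c.pc + 1, O := Function.update c.O i v }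

end Config

/-- The effect of one instruction on input `X`; `none` if there is no next configuration. -/
noncomputable def Instr.exec (X : ℕ → ℝ) (c : Config) : Instr → Option Config
  | .wconst i v => some (c.setW i v)
  | .wadd i j k => some (c.setW i (c.W j + c.W k))
  | .wsub i j k => some (c.setW i (c.W j - c.W k))
  | .wmul i j k => some (c.setW i (c.W j * c.W k))
  | .wload i j => some (c.setW i (c.W (c.W j)))
  | .wstore i j => some (c.setW (c.W i) (c.W j))
  | .rcast i j => some (c.setR i (c.W j : ℝ))
  | .rfloor i j => some (c.setW i ⌊c.R j⌋₊)
  | .radd i j k => some (c.setR i (c.R j + c.R k))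
  | .rsub i j k => some (c.setR i (c.R j - c.R k))
  | .rmul i j k => some (c.setR i (c.R j * c.R k))
  | .rdiv i j k => if c.R k = 0 then none else some (c.setR i (c.R j / c.R k))
  | .rload i j => some (c.setR i (c.R (c.W j)))
  | .rstore i j => some (c.setR (c.W i) (c.R j))
  | .input i j => some (c.setR i (X (c.W j)))
  | .output i j => some (c.setO (c.W i) (c.W j))
  | .jump l => some { c with pc := l }
  | .wjump i j l => some { c with pc := if c.W i < c.W j then l else c.pc + 1 }
  | .rjump i j l => some { c with pc := if c.R i < c.R j then l else c.pc + 1 }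
  | .halt => none

/-- One step of the program `p` on input `X`. -/
noncomputable def step (p : List Instr) (X : ℕ → ℝ) (c : Config) : Option Config :=
  p[c.pc]?.bind (Instr.exec X c)

/-- The configuration after `t` steps, if the machine gets so far. -/
noncomputable def run (p : List Instr) (X : ℕ → ℝ) (c : Config) : ℕ → Option Config
  | 0 => some c
  | t + 1 => (run p X c t).bind (step p X)

/-- The machine starts at the first instruction, with the number `n` in `W[0]`, and with `0` in all
other registers and in the output array. -/
def initial (n : ℕ) : Config where
  pc := 0
  W := fun i => if i = 0 then n else 0
  R := fun _ => 0
  O := fun _ => 0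

/-- The input array `ε, x₁, x₂, …` (continued by zeros). -/
noncomputable def inputArray (ε : ℝ) (xs : List ℝ) (k : ℕ) : ℝ := (ε :: xs).getD k 0

/-- The set of those `i` for which the output array has the mark `v` at position `i`. -/
def marked (n : ℕ) (c : Config) (v : ℕ) : Finset (Fin n) :=
  Finset.univ.filter fun i => c.O i = v

/-- The number of bits of numerator and denominator of a rational number. -/
def bits (q : ℚ) : ℕ := q.num.natAbs.size + q.den.size

/-- `P` admits a fully polynomial time approximation scheme with running time `O(T(n, ε))`: there
are one program and one constant `C` such that for every instance with `n ≥ 2` (those which have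
feasible solutions) and every accuracy `ε ∈ (0, 1)` the program, with input `n`, `ε` and the
numbers of the instance, halts after at most `C * T(n, ε)` steps with the marks `1` and `2` in the
output array describing a `(1 + ε)`-approximate solution. The unit cost of an instruction is
justified by bounds on the registers, at any time of the computation: words have `O(log (n / ε))`
bits, and if the input is rational, then the real registers hold rational numbers whose bit length
is at most linear in that of the input. -/
def RatioProblem.AdmitsFPTAS (P : RatioProblem) (T : ℕ → ℝ → ℝ) : Prop :=
  ∃ (p : List Instr) (C : ℕ), ∀ (I : P.Inst) (ε : ℝ), 2 ≤ P.size I → 0 < ε → ε < 1 →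
    ∃ (t : ℕ) (c : Config),
      (t : ℝ) ≤ C * T (P.size I) ε ∧
      run p (inputArray ε (P.data I)) (initial (P.size I)) t = some c ∧
      p[c.pc]? = some Instr.halt ∧
      P.IsApprox (1 + ε) I (marked (P.size I) c 1) (marked (P.size I) c 2) ∧
      ∀ s ≤ t, ∀ d : Config,
        run p (inputArray ε (P.data I)) (initial (P.size I)) s = some d →
          (∀ k, (d.W k : ℝ) ≤ C * ((P.size I : ℝ) / ε) ^ C) ∧
          ∀ (e : ℚ) (xs : List ℚ), ε = (e : ℝ) → P.data I = xs.map (fun q => (q : ℝ)) →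
            ∀ k, ∃ q : ℚ, d.R k = (q : ℝ) ∧ bits q ≤ C * (bits e + (xs.map bits).sum)

end SubsetSumRatio

namespace SubsetSumRatio

/-! ### Structured programs and their weakest preconditions -/

/-! Call the inverse of the cost the score. It is `0` if a side is empty, so it can be maximized
over all markings of the items, and a positive score already implies nonempty sides. Fix a marking
of maximal score with sums x (left, factor r included) and y (right).

Suppose neither sum exceeds twice the other. Let a j be the largest item on the right and multiply
all weights by N / a j, where N is about 6n/ε. Then N ≤ y ≤ nN, hence N/2 ≤ x ≤ 2nN = U. Rounding
the weights down changes each sum by at most n, which is at most ε/3 times the smaller sum. For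
every difference of rounded sums the dynamic program keeps only the largest left sum. At the
difference of the optimum it finds a marking whose two rounded sums both exceed those of the optimum
by the same Δ ≥ 0. Adding a common number to both sums moves their ratio towards 1, so only the
rounding errors are lost (`invRatio_le_of_approx`, `exists_dpCandidate`).

If one sum is more than twice the other, exchange arguments determine the optimum
(`eq_singleCandidate`): the heavy side is one item j, and the light side is every other item whose
weight is at most that of j. Such candidates are exact.

The item j is unknown, so all n choices are tried (`score_le_of_candidates`). A round fills a table
of width 4nN + 1 with one row per item, and backtracks in O(n) steps from each entry of the last
row. This costs O(n²N) = O(n³/ε), and n rounds give O(n⁴/ε). SSR is the case r = 1 of the same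
program.

On the machine, the algorithm is a structured command whose weakest precondition records time and
register bounds; `Cmd.reach` transfers it to the compiled code. Real registers only hold products
and quotients of boundedly many of ε, r, words and subset sums, and heights add under these
operations. The reductions to the 2-Set problem are formal; the one from Factor-r SSR exchanges the
sides because the factor sits on the b-weights. -/

/-- The contents of the registers and of the output array. -/
structure Mem where
  W : ℕ → ℕ
  R : ℕ → ℝ
  O : ℕ → ℕ

namespace Mem

/-- The configuration with the given program counter. -/
def cfg (m : Mem) (pc : ℕ) : Config := ⟨pc, m.W, m.R, m.O⟩

/-- Write to a word register. -/
def setW (m : Mem) (i v : ℕ) : Mem := { m with W := Function.update m.W i v }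

/-- Write to a real register. -/
def setR (m : Mem) (i : ℕ) (x : ℝ) : Mem := { m with R := Function.update m.R i x }

/-- Write to the output array. -/
def setO (m : Mem) (i v : ℕ) : Mem := { m with O := Function.update m.O i v }

@[simp] lemma setW_W (m : Mem) (i v k : ℕ) :
    (m.setW i v).W k = if k = i then v else m.W k := by
  simp [setW, Function.update_apply]

@[simp] lemma setW_R (m : Mem) (i v : ℕ) : (m.setW i v).R = m.R := rfl

@[simp] lemma setW_O (m : Mem) (i v : ℕ) : (m.setW i v).O = m.O := rfl

@[simp] lemma setR_R (m : Mem) (i : ℕ) (x : ℝ) (k : ℕ) :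
    (m.setR i x).R k = if k = i then x else m.R k := by
  simp [setR, Function.update_apply]

@[simp] lemma setR_W (m : Mem) (i : ℕ) (x : ℝ) : (m.setR i x).W = m.W := rfl

@[simp] lemma setR_O (m : Mem) (i : ℕ) (x : ℝ) : (m.setR i x).O = m.O := rfl

@[simp] lemma setO_O (m : Mem) (i v k : ℕ) :
    (m.setO i v).O k = if k = i then v else m.O k := by
  simp [setO, Function.update_apply]

@[simp] lemma setO_W (m : Mem) (i v : ℕ) : (m.setO i v).W = m.W := rfl

@[simp] lemma setO_R (m : Mem) (i v : ℕ) : (m.setO i v).R = m.R := rfl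

/-- All words are at most `B`, and all reals satisfy `G`. -/
def Safe (B : ℕ) (G : ℝ → Prop) (m : Mem) : Prop := (∀ k, m.W k ≤ B) ∧ ∀ k, G (m.R k)

lemma Safe.setW {B : ℕ} {G : ℝ → Prop} {m : Mem} (h : m.Safe B G) {i v : ℕ} (hv : v ≤ B) :
    (m.setW i v).Safe B G := by
  refine ⟨fun k => ?_, h.2⟩
  rw [setW_W]
  split_ifs
  exacts [hv, h.1 k]

lemma Safe.setR {B : ℕ} {G : ℝ → Prop} {m : Mem} (h : m.Safe B G) {i : ℕ} {x : ℝ} (hx : G x) :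
    (m.setR i x).Safe B G := by
  refine ⟨h.1, fun k => ?_⟩
  rw [setR_R]
  split_ifs
  exacts [hx, h.2 k]

end Mem

/-- Structured programs. -/
inductive Cmd where
  | skip
  | op (i : Instr)
  | seq (c d : Cmd)
  /-- if `W[i] < W[j]` then `c` else `d` -/
  | ifW (i j : ℕ) (c d : Cmd)
  /-- if `R[i] < R[j]` then `c` else `d` -/
  | ifR (i j : ℕ) (c d : Cmd)
  /-- while `W[i] < W[j]` do `c` -/
  | whileW (i j : ℕ) (c : Cmd)

namespace Cmd

/-- A sequence of instructions, followed by a command. -/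
def ops : List Instr → Cmd → Cmd
  | [], c => c
  | i :: l, c => seq (op i) (ops l c)

/-- The number of instructions of the compiled command. -/
def size : Cmd → ℕ
  | skip => 0
  | op _ => 1
  | seq c d => c.size + d.size
  | ifW _ _ c d => d.size + c.size + 2
  | ifR _ _ c d => d.size + c.size + 2
  | whileW _ _ c => c.size + 3

/-- The instructions of a command that is placed at position `b` of the program. -/
def compile : Cmd → ℕ → List Instr
  | skip, _ => []
  | op i, _ => [i]
  | seq c d, b => c.compile b ++ d.compile (b + c.size)
  -- The branch for the failing test comes first and ends with a jump over the other one; this jump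
  -- is the extra step in `wp`.
  | ifW i j c d, b => [.wjump i j (b + 1 + d.size + 1)] ++ (d.compile (b + 1) ++
      ([.jump (b + 1 + d.size + 1 + c.size)] ++ c.compile (b + 1 + d.size + 1)))
  | ifR i j c d, b => [.rjump i j (b + 1 + d.size + 1)] ++ (d.compile (b + 1) ++
      ([.jump (b + 1 + d.size + 1 + c.size)] ++ c.compile (b + 1 + d.size + 1)))
  -- Test, exit jump, body, jump back: a round costs two steps besides its body, and so does leaving
  -- the loop.
  | whileW i j c, b => [.wjump i j (b + 1 + 1)] ++ ([.jump (b + 1 + 1 + c.size + 1)] ++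
      (c.compile (b + 1 + 1) ++ [.jump b]))

lemma length_compile (c : Cmd) (b : ℕ) : (c.compile b).length = c.size := by
  induction c generalizing b with
  | skip => rfl
  | op i => rfl
  | seq c d hc hd => simp [compile, size, hc, hd]
  | ifW i j c d hc hd => simp [compile, size, hc, hd]; ring
  | ifR i j c d hc hd => simp [compile, size, hc, hd]; ring
  | whileW i j c hc => simp [compile, size, hc]

/-- The weakest precondition of a single instruction. A condition on the written value is only
imposed where it does not follow from the bounds on the registers that are read. -/
def wpOp (X : ℕ → ℝ) (B : ℕ) (G : ℝ → Prop) (Q : Mem → Prop) (m : Mem) : Instr → Prop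
  | .wconst i v => v ≤ B ∧ Q (m.setW i v)
  | .wadd i j k => m.W j + m.W k ≤ B ∧ Q (m.setW i (m.W j + m.W k))
  | .wsub i j k => Q (m.setW i (m.W j - m.W k))
  | .wmul i j k => m.W j * m.W k ≤ B ∧ Q (m.setW i (m.W j * m.W k))
  | .wload i j => Q (m.setW i (m.W (m.W j)))
  | .wstore i j => Q (m.setW (m.W i) (m.W j))
  | .rcast i j => G (m.W j) ∧ Q (m.setR i (m.W j))
  | .rfloor i j => ⌊m.R j⌋₊ ≤ B ∧ Q (m.setW i ⌊m.R j⌋₊)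
  | .radd i j k => G (m.R j + m.R k) ∧ Q (m.setR i (m.R j + m.R k))
  | .rmul i j k => G (m.R j * m.R k) ∧ Q (m.setR i (m.R j * m.R k))
  | .rdiv i j k => m.R k ≠ 0 ∧ G (m.R j / m.R k) ∧ Q (m.setR i (m.R j / m.R k))
  | .input i j => G (X (m.W j)) ∧ Q (m.setR i (X (m.W j)))
  | .output i j => Q (m.setO (m.W i) (m.W j))
  -- Jumps and `halt` only arise from compilation, and the other instructions left out do not occur
  -- in the algorithm.
  | _ => False

/-- The weakest precondition of `k` rounds of a loop at most, given that of its body. -/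
def wpLoop (i j : ℕ) (w : (Mem → ℕ → Prop) → Mem → ℕ → Prop) (Q : Mem → ℕ → Prop) :
    ℕ → Mem → ℕ → Prop
  | 0 => fun _ _ => False
  | k + 1 => fun m t =>
      (m.W i < m.W j → w (fun m' t' => wpLoop i j w Q k m' (t' + 1)) m (t + 1)) ∧
      (¬ m.W i < m.W j → Q m (t + 2))

/-- The weakest precondition: `wp X B G c Q m t` says that `c`, started with memory `m` at time
`t`, ends with a memory `m'` at a time `t'` such that `Q m' t'`, all registers being safe. -/
def wp (X : ℕ → ℝ) (B : ℕ) (G : ℝ → Prop) : Cmd → (Mem → ℕ → Prop) → Mem → ℕ → Prop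
  | skip, Q => Q
  | op i, Q => fun m t => wpOp X B G (fun m' => Q m' (t + 1)) m i
  | seq c d, Q => wp X B G c (wp X B G d Q)
  | ifW i j c d, Q => fun m t => (m.W i < m.W j → wp X B G c Q m (t + 1)) ∧
      (¬ m.W i < m.W j → wp X B G d (fun m' t' => Q m' (t' + 1)) m (t + 1))
  | ifR i j c d, Q => fun m t => (m.R i < m.R j → wp X B G c Q m (t + 1)) ∧
      (¬ m.R i < m.R j → wp X B G d (fun m' t' => Q m' (t' + 1)) m (t + 1))
  | whileW i j c, Q => fun m t => ∃ k, wpLoop i j (wp X B G c) Q k m t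

variable {X : ℕ → ℝ} {B : ℕ} {G : ℝ → Prop}

lemma wpOp_mono {Q Q' : Mem → Prop} (h : ∀ m, Q m → Q' m) {m : Mem} {i : Instr}
    (hw : wpOp X B G Q m i) : wpOp X B G Q' m i := by
  cases i <;> simp only [wpOp] at hw ⊢ <;> first | exact h _ hw | exact ⟨hw.1, h _ hw.2⟩ | skip
  exact ⟨hw.1, hw.2.1, h _ hw.2.2⟩

lemma wpLoop_mono {i j : ℕ} {w : (Mem → ℕ → Prop) → Mem → ℕ → Prop}
    (hmono : ∀ Q Q' : Mem → ℕ → Prop, (∀ m t, Q m t → Q' m t) → ∀ m t, w Q m t → w Q' m t)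
    {Q Q' : Mem → ℕ → Prop} (h : ∀ m t, Q m t → Q' m t) (k : ℕ) (m : Mem) (t : ℕ)
    (hw : wpLoop i j w Q k m t) : wpLoop i j w Q' k m t := by
  induction k generalizing m t with
  | zero => exact hw
  | succ k ih =>
    exact ⟨fun hc => hmono _ _ (fun m' t' => ih m' (t' + 1)) _ _ (hw.1 hc),
      fun hc => h _ _ (hw.2 hc)⟩

lemma wp_mono {c : Cmd} {Q Q' : Mem → ℕ → Prop} (h : ∀ m t, Q m t → Q' m t) {m : Mem} {t : ℕ}
    (hw : wp X B G c Q m t) : wp X B G c Q' m t := by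
  induction c generalizing Q Q' m t with
  | skip => exact h _ _ hw
  | op i => exact wpOp_mono (fun m => h m _) hw
  | seq c d hc hd => exact hc (fun _ _ => hd h) hw
  | ifW i j c d hc hd =>
    exact ⟨fun hb => hc h (hw.1 hb), fun hb => hd (fun _ _ => h _ _) (hw.2 hb)⟩
  | ifR i j c d hc hd =>
    exact ⟨fun hb => hc h (hw.1 hb), fun hb => hd (fun _ _ => h _ _) (hw.2 hb)⟩
  | whileW i j c hc =>
    obtain ⟨k, hk⟩ := hw
    exact ⟨k, wpLoop_mono (w := wp X B G c) (fun Q Q' hQ m t => hc hQ) h k m t hk⟩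

/-- The invariant rule for loops with a known number of rounds. -/
lemma wp_whileW (Inv : ℕ → Mem → Prop) (N T : ℕ) {i j : ℕ} {c : Cmd}
    (hlt : ∀ k < N, ∀ m, Inv k m → m.W i < m.W j ∧
      ∀ t, wp X B G c (fun m' t' => Inv (k + 1) m' ∧ t' ≤ t + T) m t)
    (hend : ∀ m, Inv N m → ¬ m.W i < m.W j) {m : Mem} (h0 : Inv 0 m) (t : ℕ) :
    wp X B G (whileW i j c) (fun m' t' => Inv N m' ∧ t' ≤ t + (N * (T + 2) + 2)) m t := by
  -- Here `r` is the number of remaining rounds. The fuel is `r + 1` because the final, failing test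
  -- also consumes one unit.
  suffices H : ∀ r k, k + r = N → ∀ m, Inv k m → ∀ t, wpLoop i j (wp X B G c)
      (fun m' t' => Inv N m' ∧ t' ≤ t + (r * (T + 2) + 2)) (r + 1) m t from
    ⟨N + 1, H N 0 (zero_add N) m h0 t⟩
  intro r
  induction r with
  | zero =>
    rintro k rfl m hm t
    exact ⟨fun hc => absurd hc (hend m hm), fun _ => ⟨hm, by omega⟩⟩
  | succ r ih =>
    intro k hk m hm t
    obtain ⟨hc, hb⟩ := hlt k (by omega) m hm
    refine ⟨fun _ => wp_mono (fun m' t' h' => ?_) (hb (t + 1)), fun h => absurd hc h⟩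
    refine wpLoop_mono (w := wp X B G c) (fun Q Q' hQ m t => wp_mono hQ)
      (fun m'' t'' h'' => ⟨h''.1, ?_⟩) _ _ _
      (ih (k + 1) (by omega) m' h'.1 (t' + 1))
    have := h'.2
    have := h''.2
    rw [Nat.succ_mul]
    omega

end Cmd

/-! ### Correctness of the compilation -/

/-- The machine runs from `c` to `c'` in `t` steps, all registers being safe. -/
def Reach (p : List Instr) (X : ℕ → ℝ) (B : ℕ) (G : ℝ → Prop) (c : Config) (t : ℕ) (c' : Config) :
    Prop :=
  run p X c t = some c' ∧ ∀ s ≤ t, ∀ d, run p X c s = some d → (∀ k, d.W k ≤ B) ∧ ∀ k, G (d.R k)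

section Reach

variable {p : List Instr} {X : ℕ → ℝ} {B : ℕ} {G : ℝ → Prop}

lemma run_add (c : Config) (t u : ℕ) :
    run p X c (t + u) = (run p X c t).bind fun d => run p X d u := by
  induction u with
  | zero => simp [run]
  | succ u ih => rw [← add_assoc, run, ih, Option.bind_assoc]; rfl

lemma Reach.refl {m : Mem} (hm : m.Safe B G) (b : ℕ) : Reach p X B G (m.cfg b) 0 (m.cfg b) := by
  refine ⟨rfl, fun s hs d hd => ?_⟩
  obtain rfl : s = 0 := by omega
  obtain rfl : m.cfg b = d := by simpa [run] using hd
  exact hm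

lemma Reach.trans {c c' c'' : Config} {t u : ℕ} (h : Reach p X B G c t c')
    (h' : Reach p X B G c' u c'') : Reach p X B G c (t + u) c'' := by
  refine ⟨by rw [run_add, h.1]; exact h'.1, fun s hs d hd => ?_⟩
  rcases le_total s t with hst | hst
  · exact h.2 s hst d hd
  · obtain ⟨v, rfl⟩ := Nat.exists_eq_add_of_le hst
    rw [run_add, h.1] at hd
    exact h'.2 v (by omega) d hd

lemma Reach.step {m m' : Mem} {b b' : ℕ} (hm : m.Safe B G) (hm' : m'.Safe B G) {i : Instr}
    (hi : p[b]? = some i) (he : i.exec X (m.cfg b) = some (m'.cfg b')) :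
    Reach p X B G (m.cfg b) 1 (m'.cfg b') := by
  have h1 : run p X (m.cfg b) 1 = some (m'.cfg b') := by
    change (some (m.cfg b)).bind (fun c => p[c.pc]?.bind (Instr.exec X c)) = _
    simp only [Option.bind_some]
    rw [show (m.cfg b).pc = b from rfl, hi]
    exact he
  refine ⟨h1, fun s hs d hd => ?_⟩
  interval_cases s
  · exact (Reach.refl (p := p) (X := X) hm b).2 0 le_rfl d hd
  · rw [h1] at hd
    obtain rfl := Option.some.inj hd
    exact hm'

/-- The list `l` stands at position `b` of the program `p`. -/
def Placed (p : List Instr) (b : ℕ) (l : List Instr) : Prop :=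
  ∃ pre post, p = pre ++ (l ++ post) ∧ pre.length = b

lemma Placed.left {b : ℕ} {l l' : List Instr} (h : Placed p b (l ++ l')) : Placed p b l := by
  obtain ⟨pre, post, rfl, hb⟩ := h
  exact ⟨pre, l' ++ post, by simp, hb⟩

lemma Placed.right {b : ℕ} {l l' : List Instr} (h : Placed p b (l ++ l')) {k : ℕ}
    (hk : l.length = k) : Placed p (b + k) l' := by
  obtain ⟨pre, post, rfl, hb⟩ := h
  exact ⟨pre ++ l, post, by simp, by simp [hb, hk]⟩

lemma Placed.get {b : ℕ} {i : Instr} (h : Placed p b [i]) : p[b]? = some i := by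
  obtain ⟨pre, post, rfl, rfl⟩ := h
  simp

lemma Cmd.reach_op {i : Instr} {Q : Mem → Prop} {m : Mem} {b : ℕ} (hi : p[b]? = some i)
    (hm : m.Safe B G) (hw : Cmd.wpOp X B G Q m i) :
    ∃ m', Reach p X B G (m.cfg b) 1 (m'.cfg (b + 1)) ∧ m'.Safe B G ∧ Q m' := by
  have key : ∀ m' : Mem, m'.Safe B G → i.exec X (m.cfg b) = some (m'.cfg (b + 1)) → Q m' →
      ∃ m', Reach p X B G (m.cfg b) 1 (m'.cfg (b + 1)) ∧ m'.Safe B G ∧ Q m' :=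
    fun m' h1 h2 h3 => ⟨m', Reach.step hm h1 hi h2, h1, h3⟩
  cases i <;> simp only [Cmd.wpOp] at hw
  case wconst => exact key _ (hm.setW hw.1) rfl hw.2
  case wadd => exact key _ (hm.setW hw.1) rfl hw.2
  case wsub => exact key _ (hm.setW ((Nat.sub_le _ _).trans (hm.1 _))) rfl hw
  case wmul => exact key _ (hm.setW hw.1) rfl hw.2
  case wload => exact key _ (hm.setW (hm.1 _)) rfl hw
  case wstore => exact key _ (hm.setW (hm.1 _)) rfl hw
  case rcast => exact key _ (hm.setR hw.1) rfl hw.2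
  case rfloor => exact key _ (hm.setW hw.1) rfl hw.2
  case radd => exact key _ (hm.setR hw.1) rfl hw.2
  case rmul => exact key _ (hm.setR hw.1) rfl hw.2
  case rdiv => exact key _ (hm.setR hw.2.1) (if_neg hw.1) hw.2.2
  case input => exact key _ (hm.setR hw.1) rfl hw.2
  case output => exact key (m.setO _ _) hm rfl hw

/-- The compiled command does what the weakest precondition promises. -/
theorem Cmd.reach {c : Cmd} {Q : Mem → ℕ → Prop} {m : Mem} {t b : ℕ}
    (hp : Placed p b (c.compile b)) (hm : m.Safe B G) (hw : Cmd.wp X B G c Q m t) :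
    ∃ u m', Reach p X B G (m.cfg b) u (m'.cfg (b + c.size)) ∧ m'.Safe B G ∧ Q m' (t + u) := by
  induction c generalizing Q m t b with
  | skip => exact ⟨0, m, Reach.refl hm b, hm, hw⟩
  | op i =>
    obtain ⟨m', h1, h2, h3⟩ := Cmd.reach_op (Q := fun m' => Q m' (t + 1)) hp.get hm hw
    exact ⟨1, m', h1, h2, h3⟩
  | seq c d hc hd =>
    obtain ⟨u, m', h1, h2, h3⟩ := hc hp.left hm hw
    obtain ⟨u', m'', h1', h2', h3'⟩ := hd (hp.right (c.length_compile b)) h2 h3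
    refine ⟨u + u', m'', ?_, h2', by rwa [← add_assoc]⟩
    simp only [Cmd.size, ← add_assoc]
    exact h1.trans h1'
  | ifW i j c d hc hd =>
    have hd' := hp.right (k := 1) rfl
    have hj := hd'.right (d.length_compile _)
    have hc' := hj.right (k := 1) rfl
    by_cases hb : m.W i < m.W j
    · obtain ⟨u, m', h1, h2, h3⟩ := hc hc' hm (hw.1 hb)
      refine ⟨1 + u, m', (Reach.step hm hm hp.left.get (b' := b + 1 + d.size + 1)
        (by simp [Instr.exec, Mem.cfg, hb])).trans ?_, h2, by rwa [← add_assoc]⟩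
      convert h1 using 2
      simp only [Cmd.size]; ring
    · obtain ⟨u, m', h1, h2, h3⟩ := hd hd'.left hm (hw.2 hb)
      refine ⟨1 + u + 1, m', ((Reach.step hm hm hp.left.get (b' := b + 1)
        (by simp [Instr.exec, Mem.cfg, hb])).trans h1).trans ?_, h2, by
          rwa [← add_assoc, ← add_assoc]⟩
      refine Reach.step h2 h2 hj.left.get ?_
      simp only [Instr.exec, Mem.cfg, Cmd.size]
      congr 2; ring
  | ifR i j c d hc hd =>
    have hd' := hp.right (k := 1) rfl
    have hj := hd'.right (d.length_compile _)
    have hc' := hj.right (k := 1) rfl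
    by_cases hb : m.R i < m.R j
    · obtain ⟨u, m', h1, h2, h3⟩ := hc hc' hm (hw.1 hb)
      refine ⟨1 + u, m', (Reach.step hm hm hp.left.get (b' := b + 1 + d.size + 1)
        (by simp [Instr.exec, Mem.cfg, hb])).trans ?_, h2, by rwa [← add_assoc]⟩
      convert h1 using 2
      simp only [Cmd.size]; ring
    · obtain ⟨u, m', h1, h2, h3⟩ := hd hd'.left hm (hw.2 hb)
      refine ⟨1 + u + 1, m', ((Reach.step hm hm hp.left.get (b' := b + 1)
        (by simp [Instr.exec, Mem.cfg, hb])).trans h1).trans ?_, h2, by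
          rwa [← add_assoc, ← add_assoc]⟩
      refine Reach.step h2 h2 hj.left.get ?_
      simp only [Instr.exec, Mem.cfg, Cmd.size]
      congr 2; ring
  | whileW i j c hc =>
    have hj := hp.right (k := 1) rfl
    have hc' := hj.right (k := 1) rfl
    have hb := hc'.right (c.length_compile _)
    obtain ⟨k, hk⟩ := hw
    -- The outer induction hypothesis treats the body; the rounds need a second induction on the
    -- fuel.
    induction k generalizing m t with
    | zero => exact hk.elim
    | succ k ih =>
      by_cases hcond : m.W i < m.W j
      · obtain ⟨u, m', h1, h2, h3⟩ := hc hc'.left hm (hk.1 hcond)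
        obtain ⟨u', m'', h1', h2', h3'⟩ := ih h2 h3
        refine ⟨1 + u + 1 + u', m'', (((Reach.step hm hm hp.left.get (b' := b + 1 + 1)
          (by simp [Instr.exec, Mem.cfg, hcond])).trans h1).trans
          (Reach.step h2 h2 hb.get (b' := b) (by simp [Instr.exec, Mem.cfg]))).trans h1', h2', ?_⟩
        rwa [show t + (1 + u + 1 + u') = t + 1 + u + 1 + u' by ring]
      · refine ⟨1 + 1, m, (Reach.step hm hm hp.left.get (b' := b + 1)
          (by simp [Instr.exec, Mem.cfg, hcond])).trans ?_, hm, hk.2 hcond⟩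
        refine Reach.step hm hm hj.left.get ?_
        simp only [Instr.exec, Mem.cfg, Cmd.size]
        congr 2; ring

end Reach

/-! ### Marks and scores -/

/-- The sum of the `w i` with `i < k` and mark `v`. -/
def markSum {M : Type*} [AddCommMonoid M] (w : ℕ → M) (m : ℕ → ℕ) (v k : ℕ) : M :=
  ∑ i ∈ Finset.range k, if m i = v then w i else 0

lemma markSum_succ {M : Type*} [AddCommMonoid M] (w : ℕ → M) (m : ℕ → ℕ) (v k : ℕ) :
    markSum w m v (k + 1) = markSum w m v k + if m k = v then w k else 0 :=
  Finset.sum_range_succ _ _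

lemma markSum_congr {M : Type*} [AddCommMonoid M] (w : ℕ → M) {m m' : ℕ → ℕ} {v k : ℕ}
    (h : ∀ i < k, m i = v ↔ m' i = v) : markSum w m v k = markSum w m' v k :=
  Finset.sum_congr rfl fun i hi => by simp only [h i (Finset.mem_range.1 hi)]

lemma cast_markSum (a : ℕ → ℕ) (m : ℕ → ℕ) (v k : ℕ) :
    ((markSum a m v k : ℕ) : ℝ) = markSum (fun i => (a i : ℝ)) m v k := by
  simp [markSum]

lemma mul_markSum (c : ℝ) (w : ℕ → ℝ) (m : ℕ → ℕ) (v k : ℕ) :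
    c * markSum w m v k = markSum (fun i => c * w i) m v k := by
  simp [markSum, Finset.mul_sum]

lemma le_markSum {w : ℕ → ℝ} {k : ℕ} (hw : ∀ i < k, 0 ≤ w i) {m : ℕ → ℕ} {v i : ℕ}
    (hi : i < k) (hm : m i = v) : w i ≤ markSum w m v k := by
  have := Finset.single_le_sum (f := fun i => if m i = v then w i else 0)
    (fun j hj => by split_ifs; exacts [hw j (Finset.mem_range.1 hj), le_rfl])
    (Finset.mem_range.2 hi)
  rwa [if_pos hm] at this

lemma markSum_mono {w : ℕ → ℕ} {m : ℕ → ℕ} {v k k' : ℕ} (h : k ≤ k') :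
    markSum w m v k ≤ markSum w m v k' :=
  Finset.sum_le_sum_of_subset (Finset.range_mono h)

lemma markSum_update {w : ℕ → ℝ} {m : ℕ → ℕ} {v k i u : ℕ} (hi : i < k) :
    markSum w (Function.update m i u) v k + (if m i = v then w i else 0) =
      markSum w m v k + if u = v then w i else 0 := by
  unfold markSum
  rw [← Finset.add_sum_erase _ _ (Finset.mem_range.2 hi),
    ← Finset.add_sum_erase (Finset.range k) (fun i => if m i = v then w i else 0)
      (Finset.mem_range.2 hi)]
  have : ∑ x ∈ (Finset.range k).erase i, (if Function.update m i u x = v then w x else 0) =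
      ∑ x ∈ (Finset.range k).erase i, if m x = v then w x else 0 :=
    Finset.sum_congr rfl fun x hx => by
      rw [Function.update_of_ne (Finset.ne_of_mem_erase hx)]
  rw [this, Function.update_self]
  ring

/-! ### Ratios and their stability under a common shift -/

/-- The inverse of `maxMinRatio`; it is `0` if `x = 0` or `y = 0`. -/
noncomputable def invRatio (x y : ℝ) : ℝ := min x y / max x y

lemma invRatio_comm (x y : ℝ) : invRatio x y = invRatio y x := by
  rw [invRatio, invRatio, min_comm, max_comm]

lemma invRatio_nonneg {x y : ℝ} (hx : 0 ≤ x) (hy : 0 ≤ y) : 0 ≤ invRatio x y :=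
  div_nonneg (le_min hx hy) (hx.trans (le_max_left _ _))

lemma invRatio_of_le {x y : ℝ} (h : x ≤ y) : invRatio x y = x / y := by
  rw [invRatio, min_eq_left h, max_eq_right h]

lemma invRatio_mul {c : ℝ} (hc : 0 < c) (x y : ℝ) : invRatio (c * x) (c * y) = invRatio x y := by
  rw [invRatio, ← mul_min_of_nonneg _ _ hc.le, ← mul_max_of_nonneg _ _ hc.le,
    mul_div_mul_left _ _ hc.ne', invRatio]

lemma invRatio_pos {x y : ℝ} (hx : 0 < x) (hy : 0 < y) : 0 < invRatio x y :=
  div_pos (lt_min hx hy) (hx.trans_le (le_max_left _ _))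

lemma pos_of_invRatio_pos {x y : ℝ} (hx : 0 ≤ x) (hy : 0 ≤ y) (h : 0 < invRatio x y) :
    0 < x ∧ 0 < y := by
  rcases (div_pos_iff.1 h) with h | h
  · exact lt_min_iff.1 h.1
  · exact absurd (le_min hx hy) (not_le.2 h.1)

lemma maxMinRatio_eq_inv (x y : ℝ) : maxMinRatio x y = (invRatio x y)⁻¹ := by
  rw [maxMinRatio, invRatio, inv_div]

/-- Adding the same number to both sums, up to small errors, does not spoil the ratio. -/
lemma invRatio_le_of_approx {x y x' y' e h ε : ℝ} (hx : 0 < x) (hy : 0 < y) (he : 0 ≤ e)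
    (hh : 0 ≤ h) (hε : 0 < ε) (hε' : ε < 1) (hex : 3 * e ≤ ε * x) (hey : 3 * e ≤ ε * y)
    (hx1 : x + h - e ≤ x') (hx2 : x' ≤ x + h + e)
    (hy1 : y + h - e ≤ y') (hy2 : y' ≤ y + h + e) :
    0 < x' ∧ 0 < y' ∧ invRatio x y ≤ (1 + ε) * invRatio x' y' := by
  -- With μ = min and M = max of x, y it suffices that μ(M + h + e) ≤ (1 + ε)(μ + h - e)M. The terms
  -- with h only help because μ ≤ M, and those with e amount to at most 3eM ≤ εμM because ε < 1. The
  -- order of x' and y' plays no role here, so `key` serves both cases below.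
  have key : ∀ x y x' y' : ℝ, 0 < x → 0 < y → 3 * e ≤ ε * x → 3 * e ≤ ε * y → 0 < y' →
      x + h - e ≤ x' → y' ≤ y + h + e → invRatio x y ≤ (1 + ε) * (x' / y') := by
    intro x y x' y' hx hy hex hey hy' hx1 hy2
    have hμ : 0 < min x y := lt_min hx hy
    have hM : 0 < max x y := hx.trans_le (le_max_left _ _)
    have hμM : min x y ≤ max x y := min_le_max
    have heμ : 3 * e ≤ ε * min x y := by
      rcases min_choice x y with h | h <;> rw [h] <;> assumption
    rw [invRatio, ← mul_div_assoc, div_le_div_iff₀ hM hy']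
    have h1 : min x y * y' ≤ min x y * (max x y + h + e) :=
      mul_le_mul_of_nonneg_left (by linarith [le_max_right x y]) hμ.le
    have h2 : (1 + ε) * (min x y + h - e) * max x y ≤ (1 + ε) * x' * max x y := by
      gcongr
      linarith [min_le_left x y]
    have h3 : 3 * e * max x y ≤ ε * min x y * max x y := mul_le_mul_of_nonneg_right heμ hM.le
    have h4 : min x y * h ≤ max x y * h := mul_le_mul_of_nonneg_right hμM hh
    have h5 : min x y * e ≤ max x y * e := mul_le_mul_of_nonneg_right hμM he
    have h6 : ε * e * max x y ≤ 1 * e * max x y := by gcongr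
    have h7 : 0 ≤ ε * h * max x y := by positivity
    nlinarith
  have hx' : 0 < x' := by nlinarith
  have hy' : 0 < y' := by nlinarith
  refine ⟨hx', hy', ?_⟩
  rcases le_total x' y' with hle | hle
  · rw [invRatio_of_le hle]
    exact key x y x' y' hx hy hex hey hy' hx1 hy2
  · rw [invRatio_comm x y, invRatio_comm x' y', invRatio_of_le hle]
    exact key y x y' x' hy hx hey hex hx' hy1 hx2

/-! ### The dynamic program -/

/-- The best way to treat an item of scaled weights `l` and `w`, if `f` is the table for the
previous items: the new entry at `d`, the mark of the item, and the previous position. -/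
def move (f : ℕ → ℕ) (D l w d : ℕ) : ℕ × ℕ × ℕ :=
  let s := if l ≤ d ∧ 0 < f (d - l) ∧ f d < f (d - l) + l then (f (d - l) + l, 1, d - l)
    else (f d, 0, d)
  -- An unreachable entry `0` never wins this comparison. On the left a separate positivity test is
  -- needed, since `f (d - l) + l` may be positive although `f (d - l) = 0`.
  if d + w < D ∧ s.1 < f (d + w) then (f (d + w), 2, d + w) else s

/-- `table U l w i d` is one more than the largest sum `x` of numbers `l` that occurs together with
a disjoint sum `y` of numbers `w` among the first `i` items such that `U + x - y = d`; it is `0`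
if there is none. The differences of initial segments are required to stay within `[-U, U]`. -/
def table (U : ℕ) (l w : ℕ → ℕ) : ℕ → ℕ → ℕ
  | 0 => fun d => if d = U then 1 else 0
  | i + 1 => fun d => (move (table U l w i) (2 * U + 1) (l i) (w i) d).1

/-- The marks that belong to an entry of the table. -/
def trace (U : ℕ) (l w : ℕ → ℕ) : ℕ → ℕ → ℕ → ℕ
  | 0 => fun _ _ => 0
  | i + 1 => fun d k =>
      if k = i then (move (table U l w i) (2 * U + 1) (l i) (w i) d).2.1
      else trace U l w i (move (table U l w i) (2 * U + 1) (l i) (w i) d).2.2 k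

lemma move_cases (f : ℕ → ℕ) (D l w d : ℕ) :
    (move f D l w d = (f d, 0, d)) ∨
    (l ≤ d ∧ 0 < f (d - l) ∧ move f D l w d = (f (d - l) + l, 1, d - l)) ∨
    (d + w < D ∧ 0 < f (d + w) ∧ move f D l w d = (f (d + w), 2, d + w)) := by
  unfold move
  dsimp only
  split_ifs with h1 h2 h2
  · exact Or.inr (Or.inr ⟨h2.1, by omega, rfl⟩)
  · exact Or.inr (Or.inl ⟨h1.1, h1.2.1, rfl⟩)
  · exact Or.inr (Or.inr ⟨h2.1, by omega, rfl⟩)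
  · exact Or.inl rfl

lemma le_move_self (f : ℕ → ℕ) (D l w d : ℕ) : f d ≤ (move f D l w d).1 := by
  unfold move
  dsimp only
  split_ifs with h1 h2 h2 <;> simp only at * <;> omega

lemma le_move_left (f : ℕ → ℕ) (D w : ℕ) {l d : ℕ} (h : l ≤ d) (h0 : 0 < f (d - l)) :
    f (d - l) + l ≤ (move f D l w d).1 := by
  unfold move
  dsimp only
  split_ifs with h1 h2 h2 <;> simp only at * <;> omega

lemma le_move_right (f : ℕ → ℕ) (l : ℕ) {D w d : ℕ} (h : d + w < D) :
    f (d + w) ≤ (move f D l w d).1 := by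
  unfold move
  dsimp only
  split_ifs with h1 h2 h2 <;> simp only at * <;> omega

lemma move_pos_lt (f : ℕ → ℕ) {D l w d : ℕ} (hd : d < D) : (move f D l w d).2.2 < D := by
  rcases move_cases f D l w d with h | ⟨h1, -, h⟩ | ⟨h1, -, h⟩ <;> rw [h] <;> simp only <;> omega

lemma move_mark_le (f : ℕ → ℕ) (D l w d : ℕ) : (move f D l w d).2.1 ≤ 2 := by
  rcases move_cases f D l w d with h | ⟨h1, -, h⟩ | ⟨h1, -, h⟩ <;> rw [h] <;> simp only <;> omega

/-- A left move needs `l ≤ d ≤ 2 * U`, so each item adds at most `2 * U`. This keeps the entries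
within a word. -/
lemma table_le (U : ℕ) (l w : ℕ → ℕ) (i : ℕ) {d : ℕ} (hd : d < 2 * U + 1) :
    table U l w i d ≤ i * (2 * U) + 1 := by
  induction i generalizing d with
  | zero => simp only [table]; split_ifs <;> omega
  | succ i ih =>
    simp only [table, Nat.succ_mul i]
    rcases move_cases (table U l w i) (2 * U + 1) (l i) (w i) d with h | ⟨h1, -, h⟩ | ⟨h1, -, h⟩ <;>
      rw [h]
    · have := ih hd; simp only; omega
    · have := ih (d := d - l i) (by omega); simp only; omega
    · have := ih h1; simp only; omega

/-- The sums of initial segments are bounded by the final ones, hence by `U`. So the differences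
along the marking never leave the table, and the recursion takes this marking into account. The
truncated subtraction is exact for the same reason. -/
lemma le_table {U : ℕ} {l w : ℕ → ℕ} {m : ℕ → ℕ} {k : ℕ} (hl : markSum l m 1 k ≤ U)
    (hw : markSum w m 2 k ≤ U) :
    markSum l m 1 k + 1 ≤ table U l w k (U + markSum l m 1 k - markSum w m 2 k) := by
  induction k with
  | zero => simp [markSum, table]
  | succ k ih =>
    rw [markSum_succ] at hl hw ⊢
    rw [markSum_succ]
    have ih := ih (by omega) (by omega)
    simp only [table]
    by_cases h1 : m k = 1
    · simp only [h1, if_true, show (1 : ℕ) ≠ 2 by omega, if_false, add_zero] at hl hw ⊢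
      have e : U + (markSum l m 1 k + l k) - markSum w m 2 k - l k =
        U + markSum l m 1 k - markSum w m 2 k := by omega
      have := le_move_left (table U l w k) (2 * U + 1) (w k) (l := l k)
        (d := U + (markSum l m 1 k + l k) - markSum w m 2 k) (by omega) (by rw [e]; omega)
      rw [e] at this
      omega
    · by_cases h2 : m k = 2
      · simp only [h2, if_true, show (2 : ℕ) ≠ 1 by omega, if_false, add_zero] at hl hw ⊢
        have e : U + markSum l m 1 k - (markSum w m 2 k + w k) + w k =
          U + markSum l m 1 k - markSum w m 2 k := by omega
        have := le_move_right (table U l w k) (l k) (D := 2 * U + 1) (w := w k)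
          (d := U + markSum l m 1 k - (markSum w m 2 k + w k)) (by omega)
        rw [e] at this
        omega
      · simp only [h1, h2, if_false, add_zero] at hl hw ⊢
        exact ih.trans (le_move_self _ _ _ _ _)

/-- Backtracking realizes exactly the recorded difference and left sum. A weight of `2 * U + 1` or
more satisfies neither `l ≤ d` nor `d + w < 2 * U + 1`, so items with the out-of-range value of
`scaled` are never selected; the last two claims record this for the rounding estimate. -/
lemma trace_spec {U : ℕ} {l w : ℕ → ℕ} {k d : ℕ} (hd : d < 2 * U + 1)
    (ht : 0 < table U l w k d) :
    U + markSum l (trace U l w k d) 1 k = d + markSum w (trace U l w k d) 2 k ∧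
    markSum l (trace U l w k d) 1 k + 1 = table U l w k d ∧
    (∀ i < k, trace U l w k d i = 1 → l i < 2 * U + 1) ∧
    (∀ i < k, trace U l w k d i = 2 → w i < 2 * U + 1) := by
  induction k generalizing d with
  | zero =>
    simp only [table] at ht ⊢
    split_ifs at ht ⊢ with h
    · simp [markSum, h]
    · omega
  | succ k ih =>
    set mv := move (table U l w k) (2 * U + 1) (l k) (w k) d with hmv
    have hpos : mv.2.2 < 2 * U + 1 := move_pos_lt _ hd
    have htab : table U l w (k + 1) d = mv.1 := rfl
    have hself : trace U l w (k + 1) d k = mv.2.1 := by simp [trace, hmv]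
    have hlt : ∀ i < k, trace U l w (k + 1) d i = trace U l w k mv.2.2 i := fun i hi => by
      simp only [trace]
      rw [if_neg (by omega)]
    have hs : ∀ (u : ℕ → ℕ) (v : ℕ), markSum u (trace U l w (k + 1) d) v (k + 1) =
        markSum u (trace U l w k mv.2.2) v k + if mv.2.1 = v then u k else 0 := fun u v => by
      rw [markSum_succ, hself, markSum_congr u (m' := trace U l w k mv.2.2)]
      intro i hi
      rw [hlt i hi]
    have hquant : ∀ (u : ℕ → ℕ) (v : ℕ), (mv.2.1 = v → u k < 2 * U + 1) →
        (∀ i < k, trace U l w k mv.2.2 i = v → u i < 2 * U + 1) →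
        ∀ i < k + 1, trace U l w (k + 1) d i = v → u i < 2 * U + 1 := by
      intro u v h1 h2 i hi hv
      rcases Nat.lt_succ_iff_lt_or_eq.1 hi with h | rfl
      · exact h2 i h (by rwa [← hlt i h])
      · exact h1 (by rwa [← hself])
    have htpos : 0 < table U l w k mv.2.2 := by
      rw [htab] at ht
      rcases move_cases (table U l w k) (2 * U + 1) (l k) (w k) d with
        h | ⟨h1, h0, h⟩ | ⟨h1, h0, h⟩ <;>
        rw [← hmv] at h <;> rw [h] at ht ⊢ <;> assumption
    obtain ⟨i1, i2, i3, i4⟩ := ih hpos htpos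
    rw [hs, hs, htab]
    refine ⟨?_, ?_, hquant l 1 ?_ i3, hquant w 2 ?_ i4⟩ <;>
    rcases move_cases (table U l w k) (2 * U + 1) (l k) (w k) d with
        h | ⟨h1, h0, h⟩ | ⟨h1, h0, h⟩ <;>
        rw [← hmv] at h <;> simp only [h] at i1 i2 ⊢ <;> simp <;> omega

/-! ### Scaling -/

/-- `x` rounded down, or a number which is out of range for the table. -/
noncomputable def scaled (U : ℕ) (x : ℝ) : ℕ := if (U : ℝ) < x then 2 * U + 1 else ⌊x⌋₊

lemma scaled_le (U : ℕ) (x : ℝ) : scaled U x ≤ 2 * U + 1 := by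
  unfold scaled
  split_ifs with h
  · exact le_rfl
  · have := Nat.floor_le_of_le (not_lt.1 h)
    omega

/-- Each selected item loses less than `1` by rounding. The hypothesis `h` excludes the out-of-range
value, which stands in for weights too large for a word and says nothing about their size. -/
lemma markSum_scaled {U n v : ℕ} {w : ℕ → ℝ} {m : ℕ → ℕ} (hw : ∀ i < n, 0 ≤ w i)
    (h : ∀ i < n, m i = v → scaled U (w i) < 2 * U + 1) :
    ((markSum (fun i => scaled U (w i)) m v n : ℕ) : ℝ) ≤ markSum w m v n ∧
    markSum w m v n ≤ ((markSum (fun i => scaled U (w i)) m v n : ℕ) : ℝ) + n := by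
  induction n with
  | zero => simp [markSum]
  | succ n ih =>
    obtain ⟨h1, h2⟩ := ih (fun i hi => hw i (by omega)) (fun i hi => h i (by omega))
    simp only [markSum_succ]
    by_cases hv : m n = v
    · have h3 := h n (by omega) hv
      have h4 : scaled U (w n) = ⌊w n⌋₊ := by
        unfold scaled at h3 ⊢
        split_ifs at h3 ⊢ with h5
        · omega
        · rfl
      have h5 := Nat.floor_le (hw n (by omega))
      have h6 := Nat.lt_floor_add_one (w n)
      simp only [hv, if_true, h4]
      push_cast
      constructor <;> linarith
    · simp only [hv, if_false]
      push_cast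
      constructor <;> linarith

/-- The score of the marks, the inverse of the cost. -/
noncomputable def score (a : ℕ → ℕ) (r : ℝ) (n : ℕ) (m : ℕ → ℕ) : ℝ :=
  invRatio (r * (markSum a m 1 n : ℕ)) ((markSum a m 2 n : ℕ) : ℝ)

lemma score_congr (a : ℕ → ℕ) (r : ℝ) {n : ℕ} {m m' : ℕ → ℕ}
    (h1 : ∀ i < n, m i = 1 ↔ m' i = 1) (h2 : ∀ i < n, m i = 2 ↔ m' i = 2) :
    score a r n m = score a r n m' := by
  rw [score, score, markSum_congr a h1, markSum_congr a h2]

lemma score_nonneg (a : ℕ → ℕ) {r : ℝ} (hr : 0 ≤ r) (n : ℕ) (m : ℕ → ℕ) : 0 ≤ score a r n m :=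
  invRatio_nonneg (mul_nonneg hr (Nat.cast_nonneg _)) (Nat.cast_nonneg _)

/-- The candidate of the dynamic program for the scale `a j` and the final difference `d - U`. -/
noncomputable def dpCandidate (a : ℕ → ℕ) (r : ℝ) (n N j d : ℕ) : ℕ → ℕ :=
  trace (2 * n * N) (fun i => scaled (2 * n * N) (a i * (r * (N / a j : ℝ))))
    (fun i => scaled (2 * n * N) (a i * (N / a j : ℝ))) n d

/-- The candidate that has only `j` on the side `v'`, against everything on the side `v` that is
not larger. -/
noncomputable def singleCandidate (p : ℕ → ℝ) (t : ℝ) (v v' j : ℕ) : ℕ → ℕ :=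
  fun i => if i = j then v' else if t < p i then 0 else v

lemma exists_dpCandidate {a : ℕ → ℕ} {n : ℕ} (ha : ∀ i < n, 0 < a i) {r : ℝ} (hr : 1 ≤ r)
    {ε : ℝ} (hε : 0 < ε) (hε' : ε < 1) {N : ℕ} (hN : 6 * (n : ℝ) ≤ ε * N) {m : ℕ → ℕ} {j : ℕ}
    (hj : j < n) (hmj : m j = 2) (hmax : ∀ i < n, m i = 2 → a i ≤ a j)
    (hxy : r * (markSum a m 1 n : ℕ) ≤ 2 * (markSum a m 2 n : ℕ))
    (hyx : ((markSum a m 2 n : ℕ) : ℝ) ≤ 2 * (r * (markSum a m 1 n : ℕ))) :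
    ∃ d < 2 * (2 * n * N) + 1, score a r n m ≤ (1 + ε) * score a r n (dpCandidate a r n N j d) := by
  have hM : (0 : ℝ) < a j := by exact_mod_cast ha j hj
  have hn : (1 : ℝ) ≤ n := by exact_mod_cast (show 1 ≤ n by omega)
  have hNpos : (0 : ℝ) < N := by nlinarith
  set κ : ℝ := N / a j with hκ
  have hκpos : 0 < κ := div_pos hNpos hM
  set U := 2 * n * N with hU
  set l : ℕ → ℕ := fun i => scaled U (a i * (r * κ)) with hl
  set w : ℕ → ℕ := fun i => scaled U (a i * κ) with hw
  have hMκ : a j * κ = N := by rw [hκ]; field_simp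
  set x : (ℕ → ℕ) → ℝ := fun m => markSum (fun i => (a i : ℝ) * (r * κ)) m 1 n with hx
  set y : (ℕ → ℕ) → ℝ := fun m => markSum (fun i => (a i : ℝ) * κ) m 2 n with hy
  have hxm : ∀ m, κ * (r * (markSum a m 1 n : ℕ)) = x m := fun m => by
    rw [cast_markSum, ← mul_assoc, mul_markSum, hx]
    simp only [mul_comm]
  have hym : ∀ m, κ * (markSum a m 2 n : ℕ) = y m := fun m => by
    rw [cast_markSum, mul_markSum, hy]
    simp only [mul_comm]
  have hsc : ∀ m, score a r n m = invRatio (x m) (y m) := fun m => by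
    rw [score, ← invRatio_mul hκpos, hxm, hym]
  have hl0 : ∀ i < n, (0 : ℝ) ≤ a i * (r * κ) := fun i _ => by positivity
  have hw0 : ∀ i < n, (0 : ℝ) ≤ a i * κ := fun i _ => by positivity
  have hxy' : x m ≤ 2 * y m := by
    rw [← hxm, ← hym]; nlinarith
  have hyx' : y m ≤ 2 * x m := by
    rw [← hxm, ← hym]; nlinarith
  have hyN : (N : ℝ) ≤ y m := by
    rw [← hMκ]
    exact le_markSum (w := fun i => (a i : ℝ) * κ) hw0 hj hmj
  have hyn : y m ≤ n * N := by
    have : y m ≤ ∑ i ∈ Finset.range n, (N : ℝ) := by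
      refine Finset.sum_le_sum fun i hi => ?_
      split_ifs with h
      · rw [← hMκ]
        have : (a i : ℝ) ≤ a j := by exact_mod_cast hmax i (Finset.mem_range.1 hi) h
        exact mul_le_mul_of_nonneg_right this hκpos.le
      · positivity
    simpa using this
  have hUr : (U : ℝ) = 2 * n * N := by rw [hU]; push_cast; ring
  have hxU : x m ≤ U := by rw [hUr]; nlinarith
  have hyU : y m ≤ U := by rw [hUr]; nlinarith
  have hfit : ∀ {z : ℝ}, z ≤ U → scaled U z < 2 * U + 1 := fun {z} hz => by
    rw [scaled, if_neg (not_lt.2 hz)]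
    have := Nat.floor_le_of_le hz
    omega
  obtain ⟨hx1, hx2⟩ := markSum_scaled (U := U) (v := 1) (m := m) hl0 fun i hi hv =>
    hfit ((le_markSum hl0 hi hv).trans hxU)
  obtain ⟨hy1, hy2⟩ := markSum_scaled (U := U) (v := 2) (m := m) hw0 fun i hi hv =>
    hfit ((le_markSum hw0 hi hv).trans hyU)
  change ((markSum l m 1 n : ℕ) : ℝ) ≤ x m at hx1
  change x m ≤ ((markSum l m 1 n : ℕ) : ℝ) + n at hx2
  change ((markSum w m 2 n : ℕ) : ℝ) ≤ y m at hy1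
  change y m ≤ ((markSum w m 2 n : ℕ) : ℝ) + n at hy2
  have hxU' : markSum l m 1 n ≤ U := by exact_mod_cast hx1.trans hxU
  have hyU' : markSum w m 2 n ≤ U := by exact_mod_cast hy1.trans hyU
  set d := U + markSum l m 1 n - markSum w m 2 n with hd
  have hdlt : d < 2 * U + 1 := by omega
  have ht := le_table hxU' hyU'
  rw [← hd] at ht
  obtain ⟨t1, t2, t3, t4⟩ := trace_spec hdlt (lt_of_lt_of_le (Nat.succ_pos _) ht)
  have hT : dpCandidate a r n N j d = trace U l w n d := rfl
  set m' := trace U l w n d with hm'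
  obtain ⟨hx3, hx4⟩ := markSum_scaled (U := U) (v := 1) (m := m') hl0 t3
  obtain ⟨hy3, hy4⟩ := markSum_scaled (U := U) (v := 2) (m := m') hw0 t4
  change ((markSum l m' 1 n : ℕ) : ℝ) ≤ x m' at hx3
  change x m' ≤ ((markSum l m' 1 n : ℕ) : ℝ) + n at hx4
  change ((markSum w m' 2 n : ℕ) : ℝ) ≤ y m' at hy3
  change y m' ≤ ((markSum w m' 2 n : ℕ) : ℝ) + n at hy4
  -- The table entry at `d` is at least the left sum of `m` plus one, and the difference is the
  -- same, so both rounded sums grow by the same `Δ`.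
  obtain ⟨Δ, hΔ⟩ := Nat.exists_eq_add_of_le (show markSum l m 1 n ≤ markSum l m' 1 n by omega)
  have hΔ' : markSum w m' 2 n = markSum w m 2 n + Δ := by omega
  rw [hΔ] at hx3 hx4
  rw [hΔ'] at hy3 hy4
  push_cast at hx3 hx4 hy3 hy4
  refine ⟨d, hdlt, ?_⟩
  rw [hT, hsc, hsc]
  -- The error `n` is admissible because x ≥ y/2 ≥ N/2 and 6n ≤ εN give 3n ≤ εx, and likewise for y.
  exact (invRatio_le_of_approx (e := n) (h := Δ) (by linarith) (by linarith) (by linarith)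
    (Nat.cast_nonneg _) hε hε' (by nlinarith) (by nlinarith) (by linarith) (by linarith)
    (by linarith) (by linarith)).2.2

/-! ### Solutions with a bad ratio -/

/-- Exchange arguments: any other marking with a ratio below 1/2 can be improved. Only membership in
the two sides is compared, because `m` may carry arbitrary further marks. -/
lemma eq_singleCandidate {n : ℕ} {p q : ℕ → ℝ} (hp : ∀ i < n, 0 < p i) (hq : ∀ i < n, 0 < q i)
    {v v' : ℕ} (hv : v ≠ v') (hv0 : v ≠ 0) (hv0' : v' ≠ 0) {m : ℕ → ℕ}
    (hopt : ∀ m', invRatio (markSum p m' v n) (markSum q m' v' n) ≤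
      invRatio (markSum p m v n) (markSum q m v' n))
    (hx : 0 < markSum p m v n) (hxy : 2 * markSum p m v n < markSum q m v' n) :
    ∃ j < n, ∀ i < n, (m i = v ↔ singleCandidate p (q j) v v' j i = v) ∧
      (m i = v' ↔ singleCandidate p (q j) v v' j i = v') := by
  set x := markSum p m v n with hxdef
  set y := markSum q m v' n with hydef
  have hp0 : ∀ i < n, 0 ≤ p i := fun i hi => (hp i hi).le
  have hq0 : ∀ i < n, 0 ≤ q i := fun i hi => (hq i hi).le
  have hy : 0 < y := by linarith
  have hxy' : invRatio x y = x / y := invRatio_of_le (by linarith)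
  have hhalf : x / y < 1 / 2 := by rw [div_lt_div_iff₀ hy two_pos]; linarith
  rw [hxy'] at hopt
  -- An item of at most half the weight of the heavy side could be dropped: y - q i ≥ y/2 > x, so
  -- the light side stays lighter and the ratio improves.
  have hsmall : ∀ i < n, m i = v' → y < 2 * q i := by
    intro i hi hmi
    by_contra! hle
    have h1 := markSum_update (w := p) (m := m) (v := v) (u := 0) hi
    have h2 := markSum_update (w := q) (m := m) (v := v') (u := 0) hi
    rw [if_neg (by rw [hmi]; exact hv.symm), if_neg hv0.symm] at h1
    rw [if_pos hmi, if_neg hv0'.symm] at h2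
    have h3 := hopt (Function.update m i 0)
    rw [show markSum p (Function.update m i 0) v n = x by linarith,
      show markSum q (Function.update m i 0) v' n = y - q i by linarith,
      invRatio_of_le (by linarith)] at h3
    have := hq i hi
    rw [div_le_div_iff₀ (by linarith) hy] at h3
    nlinarith
  have hex : ∃ j < n, m j = v' := by
    by_contra! h
    have : y = 0 := Finset.sum_eq_zero fun i hi => if_neg (h i (Finset.mem_range.1 hi))
    linarith
  obtain ⟨j, hj, hmj⟩ := hex
  -- Two items that each weigh more than y/2 would together exceed y.
  have huniq : ∀ i < n, m i = v' → i = j := by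
    intro i hi hmi
    by_contra hij
    have h1 := markSum_update (w := q) (m := m) (v := v') (u := 0) hi
    rw [if_pos hmi, if_neg hv0'.symm] at h1
    have h2 := le_markSum hq0 (m := Function.update m i 0) (v := v') hj
      (by rw [Function.update_of_ne (Ne.symm hij), hmj])
    have := hsmall i hi hmi
    have := hsmall j hj hmj
    linarith
  have hyj : y = q j := by
    have h1 := markSum_update (w := q) (m := m) (v := v') (u := 0) hj
    rw [if_pos hmj, if_neg hv0'.symm] at h1
    have h2 : markSum q (Function.update m j 0) v' n = 0 := by
      refine Finset.sum_eq_zero fun i hi => if_neg ?_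
      intro h
      by_cases hij : i = j
      · subst hij
        rw [Function.update_self] at h
        exact hv0' h.symm
      · rw [Function.update_of_ne hij] at h
        exact hij (huniq i (Finset.mem_range.1 hi) h)
    linarith
  refine ⟨j, hj, fun i hi => ?_⟩
  by_cases hij : i = j
  · subst hij
    simp [singleCandidate, hmj]
  have hmi : m i ≠ v' := fun h => hij (huniq i hi h)
  have hpi := hp i hi
  by_cases hmv : m i = v
  · have := le_markSum hp0 hi hmv
    have hlt : ¬ q j < p i := by rw [← hyj]; linarith
    simp [singleCandidate, hij, hlt, hmv]
  · by_cases hlt : q j < p i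
    · simp [singleCandidate, hij, hlt, hmv, hmi, hv0.symm, hv0'.symm]
    · exfalso
      rw [← hyj, not_lt] at hlt
      -- If item i still fits, adding it improves the ratio. Otherwise p i > y - x > y/2, and i
      -- alone against j has a ratio above 1/2.
      by_cases hfit : x + p i ≤ y
      · have h1 := markSum_update (w := p) (m := m) (v := v) (u := v) hi
        have h2 := markSum_update (w := q) (m := m) (v := v') (u := v) hi
        rw [if_neg hmv, if_pos rfl] at h1
        rw [if_neg hmi, if_neg hv] at h2
        have h3 := hopt (Function.update m i v)
        rw [show markSum p (Function.update m i v) v n = x + p i by linarith,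
          show markSum q (Function.update m i v) v' n = y by linarith,
          invRatio_of_le hfit] at h3
        rw [div_le_div_iff₀ hy hy] at h3
        nlinarith
      · have h3 := hopt (fun k => if k = i then v else if k = j then v' else 0)
        have h1 : markSum p (fun k => if k = i then v else if k = j then v' else 0) v n = p i := by
          rw [markSum, Finset.sum_eq_single_of_mem i (Finset.mem_range.2 hi)]
          · simp
          · intro k _ hk
            rw [if_neg]
            simp only [if_neg hk]
            split_ifs
            exacts [hv.symm, hv0.symm]
        have h2 : markSum q (fun k => if k = i then v else if k = j then v' else 0) v' n = q j := by
          rw [markSum, Finset.sum_eq_single_of_mem j (Finset.mem_range.2 hj)]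
          · simp [Ne.symm hij]
          · intro k _ hk
            rw [if_neg]
            simp only [if_neg hk]
            split_ifs
            exacts [hv, hv0'.symm]
        rw [h1, h2, ← hyj, invRatio_of_le hlt] at h3
        have : 1 / 2 < p i / y := by rw [div_lt_div_iff₀ two_pos hy]; linarith
        linarith

/-- The score only depends on which of the first `n` marks are `1` or `2`, so finitely many markings
have to be compared. -/
lemma exists_max_score (a : ℕ → ℕ) (r : ℝ) (n : ℕ) :
    ∃ m, ∀ m', score a r n m' ≤ score a r n m := by
  obtain ⟨f, hf⟩ := Finite.exists_max (fun f : Fin n → Fin 3 =>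
    score a r n (fun i => if h : i < n then f ⟨i, h⟩ else 0))
  refine ⟨_, fun m' => le_trans (le_of_eq ?_)
    (hf fun i => if m' i = 1 then 1 else if m' i = 2 then 2 else 0)⟩
  refine score_congr a r (fun i hi => ?_) (fun i hi => ?_) <;> simp only [hi, dif_pos] <;>
    split_ifs <;> simp_all

/-- One of the candidates is good. -/
theorem score_le_of_candidates {a : ℕ → ℕ} {n : ℕ} (hn : 0 < n) (ha : ∀ i < n, 0 < a i) {r : ℝ}
    (hr : 1 ≤ r) {ε : ℝ} (hε : 0 < ε) (hε' : ε < 1) {N : ℕ} (hN : 6 * (n : ℝ) ≤ ε * N) {b : ℝ}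
    (h1 : ∀ j < n, score a r n (singleCandidate (fun i => r * a i) (a j) 1 2 j) ≤ b)
    (h2 : ∀ j < n, score a r n (singleCandidate (fun i => a i) (r * a j) 2 1 j) ≤ b)
    (h3 : ∀ j < n, ∀ d < 2 * (2 * n * N) + 1, score a r n (dpCandidate a r n N j d) ≤ b)
    (m' : ℕ → ℕ) : score a r n m' ≤ (1 + ε) * b := by
  obtain ⟨m, hm⟩ := exists_max_score a r n
  refine (hm m').trans ?_
  have hr0 : 0 < r := by linarith
  have hb : 0 ≤ b := (score_nonneg a hr0.le n _).trans (h1 0 hn)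
  have hle : ∀ {s : ℝ}, s ≤ b → s ≤ (1 + ε) * b := fun {s} hs => by nlinarith
  rcases (score_nonneg a hr0.le n m).eq_or_lt with h0 | h0
  · rw [← h0]; positivity
  have hp1 : ∀ i < n, (0 : ℝ) < r * a i := fun i hi => by
    have : (0 : ℝ) < a i := by exact_mod_cast ha i hi
    positivity
  have hp2 : ∀ i < n, (0 : ℝ) < a i := fun i hi => by exact_mod_cast ha i hi
  have hsc : ∀ m, score a r n m =
      invRatio (markSum (fun i => r * (a i : ℝ)) m 1 n) (markSum (fun i => (a i : ℝ)) m 2 n) :=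
    fun m => by rw [score, cast_markSum, cast_markSum, mul_markSum]
  obtain ⟨hx, hy⟩ := pos_of_invRatio_pos (mul_nonneg hr0.le (Nat.cast_nonneg _))
    (Nat.cast_nonneg _) h0
  have hx' : r * (markSum a m 1 n : ℕ) = markSum (fun i => r * (a i : ℝ)) m 1 n := by
    rw [cast_markSum, mul_markSum]
  have hy' : ((markSum a m 2 n : ℕ) : ℝ) = markSum (fun i => (a i : ℝ)) m 2 n :=
    cast_markSum _ _ _ _
  by_cases hxy : r * (markSum a m 1 n : ℕ) ≤ 2 * (markSum a m 2 n : ℕ)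
  · by_cases hyx : ((markSum a m 2 n : ℕ) : ℝ) ≤ 2 * (r * (markSum a m 1 n : ℕ))
    · have hne : ((Finset.range n).filter fun i => m i = 2).Nonempty := by
        by_contra hemp
        rw [Finset.not_nonempty_iff_eq_empty, Finset.filter_eq_empty_iff] at hemp
        have : markSum a m 2 n = 0 := Finset.sum_eq_zero fun i hi => if_neg (hemp hi)
        rw [this] at hy
        simp at hy
      obtain ⟨j, hj, hmax⟩ := Finset.exists_max_image _ a hne
      rw [Finset.mem_filter, Finset.mem_range] at hj
      obtain ⟨d, hd, hd'⟩ := exists_dpCandidate ha hr hε hε' hN hj.1 hj.2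
        (fun i hi hmi => hmax i (Finset.mem_filter.2 ⟨Finset.mem_range.2 hi, hmi⟩)) hxy hyx
      refine hd'.trans ?_
      have := h3 j hj.1 d hd
      gcongr
    · obtain ⟨j, hj, hjm⟩ := eq_singleCandidate hp1 hp2 (v := 1) (v' := 2) (by omega) (by omega)
        (by omega) (m := m) (fun m' => by rw [← hsc, ← hsc]; exact hm m') (by rwa [← hx'])
        (by rw [← hx', ← hy']; linarith)
      refine hle (le_trans (le_of_eq ?_) (h1 j hj))
      exact score_congr a r (fun i hi => (hjm i hi).1) (fun i hi => (hjm i hi).2)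
  -- The left side is the heavy one: the same lemma with marks and weights exchanged.
  · obtain ⟨j, hj, hjm⟩ := eq_singleCandidate hp2 hp1 (v := 2) (v' := 1) (by omega) (by omega)
      (by omega) (m := m) (fun m' => by
        rw [invRatio_comm, ← hsc, invRatio_comm, ← hsc]; exact hm m') (by rwa [← hy'])
      (by rw [← hx', ← hy']; linarith)
    refine hle (le_trans (le_of_eq ?_) (h2 j hj))
    exact score_congr a r (fun i hi => (hjm i hi).2) (fun i hi => (hjm i hi).1)

open Cmd

/-! ### The program

Word registers: `0` holds `n`, `1`, `2`, `3` the constants `1`, `0`, `2`, `4` the scale `N`, `5` and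
`6` the numbers `U` and `2 * U + 1`, `7` the index `j` of the current round, `18` and `19` the
addresses of the marks and of the table. Real registers: `0` and `1` hold the constants `0` and `1`,
`2` holds `r`, `3` holds `U`, `4` to `7` hold `a j`, `N / a j`, `r * (N / a j)` and `r * a j`, and
`8` holds the score of the output. -/

/-- `W[14]` becomes the scaled value of `R[10] * R[c]`. -/
def scaleCmd (c : ℕ) : Cmd :=
  .seq (.op (.rmul 11 10 c)) (.ifR 3 11 (.op (.wadd 14 6 2)) (.op (.rfloor 14 11)))

/-- Item `W[8]` goes to the left side, if this is better than the current move. -/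
def leftCmd : Cmd :=
  .ifW 9 14 .skip (.seq (.op (.wsub 15 13 14)) (.seq (.op (.wload 16 15))
    (.ifW 2 16 (.seq (.op (.wadd 16 16 14)) (.ifW 10 16
      -- Since `W[2] = 0`, adding it copies a register; `R[0] = 0` plays this role for reals.
      (.seq (.op (.wadd 10 16 2)) (.seq (.op (.wconst 11 1)) (.op (.wsub 12 9 14))))
        .skip)) .skip)))

/-- Item `W[8]` goes to the right side, if this is better than the current move. -/
def rightCmd : Cmd :=
  .seq (.op (.wadd 15 9 14)) (.ifW 15 6 (.seq (.op (.wadd 16 13 14)) (.seq (.op (.wload 16 16))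
    (.ifW 10 16 (.seq (.op (.wadd 10 16 2)) (.seq (.op (.wconst 11 2)) (.op (.wadd 12 15 2))))
      .skip))) .skip)

/-- The best move for item `W[8]` at position `W[9]`. -/
def moveCmd : Cmd :=
  ops [.wmul 13 8 6, .wadd 13 13 9, .wadd 13 13 19, .wload 10 13, .wconst 11 0, .wadd 12 9 2,
    .wadd 14 8 1, .input 10 14]
    (.seq (scaleCmd 6) (.seq leftCmd (.seq (scaleCmd 5) rightCmd)))

/-- Row `0` of the table. -/
def initCmd : Cmd :=
  .seq (.op (.wconst 9 0)) (.seq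
    (.whileW 9 6 (ops [.wadd 13 19 9, .wstore 13 2] (.op (.wadd 9 9 1))))
    (.seq (.op (.wadd 13 19 5)) (.op (.wstore 13 1))))

/-- The table. -/
def fillCmd : Cmd :=
  .seq initCmd (.seq (.op (.wconst 8 0)) (.whileW 8 0 (.seq (.op (.wconst 9 0)) (.seq
    (.whileW 9 6 (.seq moveCmd (ops [.wadd 13 13 6, .wstore 13 10] (.op (.wadd 9 9 1)))))
    (.op (.wadd 8 8 1))))))

/-- The marks that belong to position `W[24]` of the last row of the table. -/
def traceCmd : Cmd :=
  ops [.wadd 9 24 2, .wadd 8 0 2] (.whileW 2 8 (.seq (.op (.wsub 8 8 1)) (.seq moveCmd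
    (ops [.wadd 13 18 8, .wstore 13 11] (.op (.wadd 9 12 2))))))

/-- The sums of the two sides. -/
def sumCmd : Cmd :=
  ops [.wconst 20 0, .radd 12 0 0, .radd 13 0 0] (.whileW 20 0
    (ops [.wadd 21 20 1, .input 14 21, .wadd 21 18 20, .wload 21 21]
      (.seq (.ifW 21 1 .skip (.ifW 21 3 (.op (.radd 12 12 14)) (.op (.radd 13 13 14))))
        (.op (.wadd 20 20 1)))))

/-- Copy the marks to the output. -/
def copyCmd : Cmd :=
  .seq (.op (.wconst 20 0)) (.whileW 20 0
    (ops [.wadd 21 18 20, .wload 21 21, .output 20 21] (.op (.wadd 20 20 1))))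

/-- Compare the score of the marks with that of the output. -/
def evalCmd : Cmd :=
  -- After the test that the left sum is positive, the divisor is positive in either order. A
  -- candidate with empty left side has score `0` and could not win anyway.
  .seq sumCmd (.seq (.op (.rmul 12 2 12)) (.ifR 0 12
    (.seq (.ifR 12 13 (.op (.rdiv 14 12 13)) (.op (.rdiv 14 13 12)))
      (.ifR 8 14 (.seq (.op (.radd 8 14 0)) copyCmd) .skip)) .skip))

/-- The marks of `singleCandidate`. -/
def singleCmd (c th v v' : ℕ) : Cmd :=
  .seq (.op (.wconst 8 0)) (.seq (.whileW 8 0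
    (ops [.wadd 13 8 1, .input 10 13, .rmul 10 c 10, .wadd 13 18 8]
      (.seq (.ifR th 10 (.op (.wstore 13 2)) (.op (.wstore 13 v))) (.op (.wadd 8 8 1)))))
    (.seq (.op (.wadd 13 18 7)) (.op (.wstore 13 v'))))

/-- All candidates of the round `j`. -/
def roundCmd : Cmd :=
  ops [.wadd 13 7 1, .input 4 13, .rmul 7 2 4, .rcast 10 4, .rdiv 5 10 4, .rmul 6 2 5]
    (.seq (singleCmd 2 4 1 3) (.seq evalCmd (.seq (singleCmd 1 7 3 1) (.seq evalCmd
      (.seq fillCmd (.seq (.op (.wconst 24 0)) (.seq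
        (.whileW 24 6 (.seq traceCmd (.seq evalCmd (.op (.wadd 24 24 1)))))
        (.op (.wadd 7 7 1)))))))))

/-- The constants. -/
def setupCmd : Cmd :=
  ops [.wconst 1 1, .wconst 3 2, .wconst 18 40, .wadd 19 18 0, .input 9 2, .wadd 13 0 1,
    .input 2 13, .rcast 1 1]
    -- The number read after the a i is r, or `0` past the end of an SSR input; a value below `1` is
    -- replaced by `1`.
    (.seq (.ifR 2 1 (.op (.radd 2 1 0)) .skip)
      (ops [.wconst 13 6, .wmul 13 13 0, .rcast 10 13, .rdiv 10 10 9, .rfloor 4 10, .wadd 4 4 1,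
        .wmul 5 0 4, .wmul 5 3 5, .wmul 6 3 5, .wadd 6 6 1] (.op (.rcast 3 5))))

/-- The whole algorithm. -/
def mainCmd : Cmd := .seq setupCmd (.whileW 7 0 roundCmd)

/-! ### Verification -/

/-- An input, the parameters that the algorithm derives from it, and bounds for the registers. -/
structure Setting where
  n : ℕ
  N : ℕ
  a : ℕ → ℕ
  r : ℝ
  X : ℕ → ℝ
  B : ℕ
  G : ℝ → Prop
  n_pos : 0 < n
  a_pos : ∀ i < n, 0 < a i
  one_le_r : 1 ≤ r
  X_succ : ∀ i < n, X (i + 1) = a i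
  -- The table has n + 1 rows of width 4nN + 1; the additional rows leave room for sums such as a
  -- table entry plus a weight.
  le_B : 100 + 10 * n + (n + 4) * (4 * n * N + 1) ≤ B
  -- Bounds on bit lengths are not closed under arithmetic, so `G` is required precisely for the
  -- kinds of values that the program computes.
  G_nat : ∀ k ≤ B, G k
  G_sum : ∀ s ≤ ∑ i ∈ Finset.range n, a i, G s
  G_mul_sum : ∀ s ≤ ∑ i ∈ Finset.range n, a i, G (r * s)
  G_div_sum : ∀ s ≤ ∑ i ∈ Finset.range n, a i, ∀ s' ≤ ∑ i ∈ Finset.range n, a i, G (r * s / s')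
  G_sum_div : ∀ s ≤ ∑ i ∈ Finset.range n, a i, ∀ s' ≤ ∑ i ∈ Finset.range n, a i, G (s' / (r * s))
  G_scale : ∀ j < n, G (N / a j)
  G_mul_scale : ∀ j < n, G (r * (N / a j))
  G_scaled : ∀ i < n, ∀ j < n, G (a i * (N / a j))
  G_mul_scaled : ∀ i < n, ∀ j < n, G (a i * (r * (N / a j)))

namespace Setting

variable (S : Setting)

/-- The range of the scaled differences. -/
def U : ℕ := 2 * S.n * S.N

/-- The width of the table. -/
def D : ℕ := 2 * S.U + 1

/-- The scaled weights on the left side. -/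
noncomputable def l (j i : ℕ) : ℕ := scaled S.U (S.a i * (S.r * (S.N / S.a j : ℝ)))

/-- The scaled weights on the right side. -/
noncomputable def w (j i : ℕ) : ℕ := scaled S.U (S.a i * (S.N / S.a j : ℝ))

/-- The address of an entry of the table. -/
def addr (i d : ℕ) : ℕ := i * S.D + d + (40 + S.n)

/-- The weakest precondition in the given setting. -/
def wp : Cmd → (Mem → ℕ → Prop) → Mem → ℕ → Prop := Cmd.wp S.X S.B S.G

/-- The constants are in their registers. -/
structure Env (m : Mem) : Prop where
  W0 : m.W 0 = S.n
  W1 : m.W 1 = 1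
  W2 : m.W 2 = 0
  W3 : m.W 3 = 2
  W4 : m.W 4 = S.N
  W5 : m.W 5 = S.U
  W6 : m.W 6 = S.D
  W18 : m.W 18 = 40
  W19 : m.W 19 = 40 + S.n
  R0 : m.R 0 = 0
  R1 : m.R 1 = 1
  R2 : m.R 2 = S.r
  R3 : m.R 3 = S.U

/-- The constants of the round `j` are in their registers. -/
structure EnvJ (j : ℕ) (m : Mem) : Prop extends S.Env m where
  lt : j < S.n
  W7 : m.W 7 = j
  R4 : m.R 4 = S.a j
  R5 : m.R 5 = S.N / S.a j
  R6 : m.R 6 = S.r * (S.N / S.a j)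
  R7 : m.R 7 = S.r * S.a j

variable {S}

lemma Env.congr {m m' : Mem} (h : S.Env m) (hW : ∀ k < 7, m'.W k = m.W k) (h18 : m'.W 18 = m.W 18)
    (h19 : m'.W 19 = m.W 19) (hR : ∀ k < 4, m'.R k = m.R k) : S.Env m' := by
  obtain ⟨h0, h1, h2, h3, h4, h5, h6, h7, h8, r0, r1, r2, r3⟩ := h
  constructor <;> first | rw [hW _ (by omega)] | rw [h18] | rw [h19] | rw [hR _ (by omega)]
  all_goals assumption

lemma EnvJ.congr {j : ℕ} {m m' : Mem} (h : S.EnvJ j m) (hW : ∀ k < 8, m'.W k = m.W k)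
    (h18 : m'.W 18 = m.W 18) (h19 : m'.W 19 = m.W 19) (hR : ∀ k < 8, m'.R k = m.R k) :
    S.EnvJ j m' where
  toEnv := h.toEnv.congr (fun k hk => hW k (by omega)) h18 h19 (fun k hk => hR k (by omega))
  lt := h.lt
  W7 := by rw [hW _ (by omega), h.W7]
  R4 := by rw [hR _ (by omega), h.R4]
  R5 := by rw [hR _ (by omega), h.R5]
  R6 := by rw [hR _ (by omega), h.R6]
  R7 := by rw [hR _ (by omega), h.R7]

lemma le_B' : 100 + 10 * S.n + (S.n + 4) * S.D ≤ S.B := by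
  have := S.le_B
  rw [D, U]
  convert this using 3
  ring

lemma D_pos : 0 < S.D := Nat.succ_pos _

lemma addr_lt {i d : ℕ} (hi : i ≤ S.n) (hd : d < 2 * S.D) : S.addr i d + 50 ≤ S.B := by
  have := S.le_B'
  have : i * S.D ≤ S.n * S.D := Nat.mul_le_mul_right _ hi
  rw [addr]
  nlinarith

lemma wp_seq {c d : Cmd} {P Q : Mem → ℕ → Prop} {m : Mem} {t : ℕ} (h : S.wp c P m t)
    (h' : ∀ m' t', P m' t' → S.wp d Q m' t') : S.wp (.seq c d) Q m t :=
  wp_mono (c := c) h' h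

lemma wp_mono {c : Cmd} {P Q : Mem → ℕ → Prop} {m : Mem} {t : ℕ} (h : S.wp c P m t)
    (h' : ∀ m' t', P m' t' → Q m' t') : S.wp c Q m t :=
  Cmd.wp_mono h' h

/-- All registers except some words in `[lo, hi)` and some reals in `[lo', hi')` are unchanged. -/
def Frame (lo hi lo' hi' : ℕ) (m m' : Mem) : Prop :=
  (∀ k, k < lo ∨ hi ≤ k → m'.W k = m.W k) ∧ (∀ k, k < lo' ∨ hi' ≤ k → m'.R k = m.R k)

/-! ### Computing one transition of the dynamic program -/

lemma wp_scaleCmd {c i : ℕ} {x : ℝ} {m : Mem} (hE : S.Env m)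
    (hc : m.R c = x) (hi : m.R 10 = S.a i) (hG : S.G (S.a i * x)) (t : ℕ) :
    S.wp (scaleCmd c) (fun m' t' => m'.W 14 = scaled S.U (S.a i * x) ∧
      (∀ k, k ≠ 14 → m'.W k = m.W k) ∧ (∀ k, k ≠ 11 → m'.R k = m.R k) ∧ m'.O = m.O ∧
      t' ≤ t + 4) m t := by
  have hB := S.le_B'
  have hD : S.D ≤ S.B := by nlinarith
  simp only [wp, scaleCmd, Cmd.wp, wpOp, Mem.setR_W, Mem.setR_R, hc, hi, hE.W6, hE.W2, hE.R3,
    Mem.setW_W, Mem.setW_R, Mem.setW_O, Mem.setR_O]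
  refine ⟨hG, fun h => ⟨by omega, ?_⟩, fun h => ⟨?_, ?_⟩⟩
  · simp only [if_true] at h
    simp at h
    simp +contextual [scaled, h, D]
  · simp at h ⊢
    have := Nat.floor_le_of_le h
    simp only [D] at hD
    omega
  · simp at h
    simp +contextual [scaled, not_lt.2 h]


/-- This is the inner `if` of `move`. By `hA` the entry at `A - l` has address at least 40 when `l ≤
d`, so writing to the scratch registers does not change it. -/
lemma wp_leftCmd {f : ℕ → ℕ} {A d l : ℕ} {m : Mem} (h2 : m.W 2 = 0) (h9 : m.W 9 = d)
    (h10 : m.W 10 = f d) (h11 : m.W 11 = 0) (h12 : m.W 12 = d) (h13 : m.W 13 = A)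
    (h14 : m.W 14 = l) (hf : l ≤ d → m.W (A - l) = f (d - l)) (hA : 40 + d ≤ A)
    (hB : l ≤ d → f (d - l) + l ≤ S.B) (t : ℕ) :
    S.wp leftCmd (fun m' t' => (m'.W 10, m'.W 11, m'.W 12) =
      (if l ≤ d ∧ 0 < f (d - l) ∧ f d < f (d - l) + l then (f (d - l) + l, 1, d - l)
        else (f d, 0, d)) ∧
      (∀ k, k < 10 ∨ k = 13 ∨ 17 ≤ k → m'.W k = m.W k) ∧ m'.R = m.R ∧ m'.O = m.O ∧
      t' ≤ t + 12) m t := by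
  have hB1 := S.le_B'
  generalize hs : (if l ≤ d ∧ 0 < f (d - l) ∧ f d < f (d - l) + l then (f (d - l) + l, 1, d - l)
        else (f d, 0, d)) = s
  simp only [wp, leftCmd, Cmd.wp, wpOp, h9, h14, Mem.setW_W, Mem.setW_R, Mem.setW_O]
  refine ⟨fun h => ?_, fun h => ?_⟩
  · rw [if_neg (by omega)] at hs
    exact ⟨by rw [h10, h11, h12, hs], fun _ _ => trivial, trivial, trivial, by omega⟩
  · have hr : m.W (A - l) = f (d - l) := hf (by omega)
    have hb := hB (by omega)
    have e1 : ¬ A - l = 15 := by omega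
    simp [h13, h2, h10, h11, h12, hr, e1]
    refine ⟨fun h0 => ⟨hb, fun h1 => ⟨hb, by omega, ?_, ?_⟩, fun h1 => ⟨?_, ?_⟩⟩,
      fun h0 => ⟨?_, ?_⟩⟩
    · rw [← hs, if_pos ⟨by omega, h0, h1⟩]
    · intro k hk; simp [show k ≠ 12 by omega, show k ≠ 11 by omega, show k ≠ 10 by omega,
        show k ≠ 16 by omega, show k ≠ 15 by omega]
    · rw [← hs, if_neg (by omega)]
    · intro k hk; simp [show k ≠ 16 by omega, show k ≠ 15 by omega]
    · rw [← hs, if_neg (by omega)]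
    · intro k hk; simp [show k ≠ 16 by omega, show k ≠ 15 by omega]

/-- This is the outer `if` of `move`, applied to the result `s` of the left attempt. The bound `hw`
also covers the out-of-range weight, which fails the test against the width. -/
lemma wp_rightCmd {f : ℕ → ℕ} {A d w : ℕ} {s : ℕ × ℕ × ℕ} {m : Mem} (h2 : m.W 2 = 0)
    (h6 : m.W 6 = S.D) (h9 : m.W 9 = d) (hs : (m.W 10, m.W 11, m.W 12) = s) (h13 : m.W 13 = A)
    (h14 : m.W 14 = w) (hw : w ≤ S.D)
    (hf : d + w < S.D → m.W (A + w) = f (d + w)) (hA : 40 + d ≤ A) (hAB : A + S.D ≤ S.B)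
    (hB : d + w < S.D → f (d + w) ≤ S.B) (t : ℕ) :
    S.wp rightCmd (fun m' t' => (m'.W 10, m'.W 11, m'.W 12) =
      (if d + w < S.D ∧ s.1 < f (d + w) then (f (d + w), 2, d + w) else s) ∧
      (∀ k, k < 10 ∨ k = 13 ∨ 17 ≤ k → m'.W k = m.W k) ∧ m'.R = m.R ∧ m'.O = m.O ∧
      t' ≤ t + 12) m t := by
  have hB1 := S.le_B'
  have hD : S.D + S.D ≤ S.B := by nlinarith
  obtain ⟨s1, s2, s3⟩ := s
  obtain ⟨h10, h11, h12⟩ : m.W 10 = s1 ∧ m.W 11 = s2 ∧ m.W 12 = s3 := by simpa using hs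
  generalize hs' : (if d + w < S.D ∧ s1 < f (d + w) then (f (d + w), 2, d + w)
    else (s1, s2, s3)) = s'
  simp [wp, rightCmd, Cmd.wp, wpOp, h9, h14, h6, h13]
  refine ⟨by omega, fun h => ⟨by omega, ?_⟩, fun h => ⟨?_, ?_⟩⟩
  · have hr : m.W (A + w) = f (d + w) := hf (by omega)
    have hb := hB (by omega)
    have e1 : ¬ A + w = 15 := by omega
    have e2 : ¬ A + w = 16 := by omega
    simp [h2, h10, h11, h12, hr, e1, e2]
    refine ⟨fun h1 => ⟨hb, by omega, by omega, ?_, ?_⟩, fun h1 => ⟨?_, ?_⟩⟩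
    · rw [← hs', if_pos ⟨h, h1⟩]
    · intro k hk; simp [show k ≠ 12 by omega, show k ≠ 11 by omega, show k ≠ 10 by omega,
        show k ≠ 16 by omega, show k ≠ 15 by omega]
    · rw [← hs', if_neg (by omega)]
    · intro k hk; simp [show k ≠ 16 by omega, show k ≠ 15 by omega]
  · rw [← hs', if_neg (by omega), h10, h11, h12]
  · intro k hk; simp [show k ≠ 15 by omega]

/-- The table entries of row `i` fit into a word, together with a weight. -/
lemma table_add_le {i d x j : ℕ} (hi : i ≤ S.n) (hd : d < S.D) (hx : x ≤ S.D) :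
    table S.U (S.l j) (S.w j) i d + x ≤ S.B := by
  have h1 := table_le S.U (S.l j) (S.w j) i hd
  have h2 := S.le_B'
  have h3 : i * (2 * S.U) ≤ S.n * S.D := Nat.mul_le_mul hi (by rw [D]; omega)
  nlinarith

lemma wp_moveCmd {i j d : ℕ} {m : Mem} (hE : S.EnvJ j m) (hi : i < S.n) (hd : d < S.D)
    (h8 : m.W 8 = i) (h9 : m.W 9 = d)
    (hf : ∀ e < S.D, m.W (S.addr i e) = table S.U (S.l j) (S.w j) i e) (t : ℕ) :
    S.wp moveCmd (fun m' t' => (m'.W 10, m'.W 11, m'.W 12) =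
      move (table S.U (S.l j) (S.w j) i) S.D (S.l j i) (S.w j i) d ∧ m'.W 13 = S.addr i d ∧
      Frame 10 17 10 12 m m' ∧ m'.O = m.O ∧ t' ≤ t + 40) m t := by
  set f := table S.U (S.l j) (S.w j) i with hfdef
  have hB := S.le_B'
  have hA := S.addr_lt (i := i) (d := d) hi.le (by omega)
  have hAD := S.addr_lt (i := i) (d := d + S.D) hi.le (by omega)
  have hl : S.l j i ≤ S.D := scaled_le _ _
  have hw : S.w j i ≤ S.D := scaled_le _ _
  have hdB := table_add_le (S := S) (j := j) hi.le hd (Nat.zero_le _)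
  have hAdef : S.addr i d = i * S.D + d + (40 + S.n) := rfl
  have hne : ∀ k, k < 40 → S.addr i d ≠ k := fun k hk => by omega
  have hai : S.a i ≤ ∑ i ∈ Finset.range S.n, S.a i :=
    Finset.single_le_sum (f := S.a) (fun _ _ => Nat.zero_le _) (Finset.mem_range.2 hi)
  have start : S.wp (ops [.wmul 13 8 6, .wadd 13 13 9, .wadd 13 13 19, .wload 10 13,
      .wconst 11 0, .wadd 12 9 2, .wadd 14 8 1, .input 10 14] .skip)
      (fun m' t' => m'.W 10 = f d ∧ m'.W 11 = 0 ∧ m'.W 12 = d ∧ m'.W 13 = S.addr i d ∧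
        m'.R 10 = S.a i ∧ (∀ k, k < 10 ∨ 15 ≤ k → m'.W k = m.W k) ∧
        (∀ k, k ≠ 10 → m'.R k = m.R k) ∧ m'.O = m.O ∧ t' = t + 8) m t := by
    simp [ops, wp, Cmd.wp, wpOp, h8, h9, hE.W6, hE.W19, hE.W2, hE.W1, ← hAdef, hne, hf d hd,
      S.X_succ i hi, S.G_sum _ hai]
    refine ⟨by omega, by omega, by omega, by omega, by omega, ?_, ?_⟩
    · intro k hk; simp [show k ≠ 10 by omega, show k ≠ 11 by omega, show k ≠ 12 by omega,
        show k ≠ 13 by omega, show k ≠ 14 by omega]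
    · intro k hk; simp [hk]
  -- By definition of `ops`, cutting the list with `.skip` and composing with the rest gives the
  -- same weakest precondition as the whole command; so `hmain` closes the goal definitionally.
  have hmain := wp_seq (S := S) (c := ops [.wmul 13 8 6, .wadd 13 13 9, .wadd 13 13 19,
    .wload 10 13, .wconst 11 0, .wadd 12 9 2, .wadd 14 8 1, .input 10 14] .skip)
    (d := .seq (scaleCmd 6) (.seq leftCmd (.seq (scaleCmd 5) rightCmd)))
    (Q := fun m' t' => (m'.W 10, m'.W 11, m'.W 12) =
      move f S.D (S.l j i) (S.w j i) d ∧ m'.W 13 = S.addr i d ∧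
      Frame 10 17 10 12 m m' ∧ m'.O = m.O ∧ t' ≤ t + 40) start ?_
  · exact hmain
  rintro m1 t1 ⟨a10, a11, a12, a13, aR, aW, aR', aO, rfl⟩
  have hE1 : S.EnvJ j m1 := hE.congr (fun k hk => aW k (by omega)) (aW _ (by omega))
    (aW _ (by omega)) (fun k hk => aR' k (by omega))
  refine wp_seq (wp_scaleCmd hE1.toEnv hE1.R6 aR (S.G_mul_scaled i hi j hE.lt) _) ?_
  rintro m2 t2 ⟨b14, bW, bR, bO, bt⟩
  refine wp_seq (wp_leftCmd (f := f) (A := S.addr i d) (d := d) (l := S.l j i)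
    (by rw [bW _ (by omega), hE1.W2]) (by rw [bW _ (by omega), aW _ (by omega), h9])
    (by rw [bW _ (by omega), a10]) (by rw [bW _ (by omega), a11]) (by rw [bW _ (by omega), a12])
    (by rw [bW _ (by omega), a13]) b14 (fun hle => ?_) (by omega)
    (fun hle => table_add_le hi.le (by omega) (by omega)) _) ?_
  · rw [bW _ (by omega), aW _ (by omega), ← hf _ (by omega)]
    congr 1
    rw [addr, addr]
    omega
  rintro m3 t3 ⟨cs, cW, cR, cO, ct⟩
  have hE3 : S.EnvJ j m3 := hE1.congr (fun k hk => by rw [cW k (by omega), bW k (by omega)])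
    (by rw [cW _ (by omega), bW _ (by omega)]) (by rw [cW _ (by omega), bW _ (by omega)])
    (fun k hk => by rw [cR, bR k (by omega)])
  refine wp_seq (wp_scaleCmd hE3.toEnv hE3.R5 (by rw [cR, bR _ (by omega), aR])
    (S.G_scaled i hi j hE.lt) _) ?_
  rintro m4 t4 ⟨d14, dW, dR, dO, dt⟩
  refine wp_mono (wp_rightCmd (f := f) (A := S.addr i d) (d := d) (w := S.w j i)
    (by rw [dW _ (by omega), hE3.W2]) (by rw [dW _ (by omega), hE3.W6])
    (by rw [dW _ (by omega), cW _ (by omega), bW _ (by omega), aW _ (by omega), h9])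
    (by rw [dW _ (by omega), dW _ (by omega), dW _ (by omega), cs])
    (by rw [dW _ (by omega), cW _ (by omega), bW _ (by omega), a13]) d14 hw
    (fun hlt => ?_) (by omega) (by simp only [addr] at hAD ⊢; omega)
    (fun hlt => table_add_le hi.le hlt (Nat.zero_le _)) _) ?_
  · rw [dW _ (by omega), cW _ (by omega), bW _ (by omega), aW _ (by omega), ← hf _ hlt]
    congr 1
    rw [addr, addr]
    omega
  rintro m5 t5 ⟨es, eW, eR, eO, et⟩
  refine ⟨es, ?_, ⟨fun k hk => ?_, fun k hk => ?_⟩, ?_, by omega⟩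
  · rw [eW _ (by omega), dW _ (by omega), cW _ (by omega), bW _ (by omega), a13]
  · rw [eW _ (by omega), dW _ (by omega), cW _ (by omega), bW _ (by omega), aW _ (by omega)]
  · rw [eR, dR _ (by omega), cR, bR _ (by omega), aR' _ (by omega)]
  · rw [eO, dO, cO, bO, aO]

lemma wp_while (Inv : ℕ → Mem → Prop) (N T : ℕ) {i j : ℕ} {c : Cmd} {m : Mem} {t : ℕ}
    (h0 : Inv 0 m)
    (hlt : ∀ k < N, ∀ m, Inv k m → m.W i < m.W j ∧
      ∀ t, S.wp c (fun m' t' => Inv (k + 1) m' ∧ t' ≤ t + T) m t)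
    (hend : ∀ m, Inv N m → ¬ m.W i < m.W j) :
    S.wp (.whileW i j c) (fun m' t' => Inv N m' ∧ t' ≤ t + (N * (T + 2) + 2)) m t :=
  wp_whileW Inv N T hlt hend h0 t

lemma addr_lt_addr {i i' d d' : ℕ} (h : i < i') (hd : d < S.D) : S.addr i d < S.addr i' d' := by
  have : (i + 1) * S.D ≤ i' * S.D := Nat.mul_le_mul_right _ h
  rw [addr, addr]
  rw [Nat.succ_mul] at this
  omega

lemma addr_ge (i d : ℕ) : 40 + S.n ≤ S.addr i d := Nat.le_add_left _ _

/-! ### Filling the table and backtracking -/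

/-- What does not change while the table is filled. -/
def FillFrame (S : Setting) (m m' : Mem) : Prop :=
  (∀ k, k < 8 ∨ (18 ≤ k ∧ k < 40 + S.n) → m'.W k = m.W k) ∧
  (∀ k, k < 10 ∨ 12 ≤ k → m'.R k = m.R k) ∧ m'.O = m.O

lemma EnvJ.of_fillFrame {j : ℕ} {m m' : Mem} (h : S.EnvJ j m) (hf : S.FillFrame m m') :
    S.EnvJ j m' :=
  h.congr (fun k hk => hf.1 k (by omega)) (hf.1 _ (by omega)) (hf.1 _ (by omega))
    (fun k hk => hf.2.1 k (by omega))

lemma wp_initCmd {j : ℕ} {m : Mem} (hE : S.EnvJ j m) (t : ℕ) :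
    S.wp initCmd (fun m' t' => S.FillFrame m m' ∧
      (∀ d < S.D, m'.W (S.addr 0 d) = if d = S.U then 1 else 0) ∧ t' ≤ t + (5 * S.D + 5)) m t := by
  have hB := S.addr_lt (i := 0) (d := S.D) (Nat.zero_le _) (by have := S.D_pos; omega)
  have haddr : ∀ d, S.addr 0 d = 40 + S.n + d := fun d => by rw [addr]; ring
  rw [haddr] at hB
  have hUD : S.U < S.D := by rw [D]; omega
  refine wp_seq (P := fun m' t' => S.FillFrame m m' ∧ m'.W 9 = 0 ∧ t' = t + 1) ?_ ?_
  · simp [wp, Cmd.wp, wpOp, FillFrame]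
    intro k hk
    simp [show k ≠ 9 by omega]
  rintro m1 t1 ⟨a1, a2, rfl⟩
  refine wp_seq (wp_while (fun k m' => S.FillFrame m m' ∧ m'.W 9 = k ∧
    ∀ d < k, m'.W (S.addr 0 d) = 0) S.D 3 ⟨a1, a2, fun d hd => absurd hd (Nat.not_lt_zero _)⟩
    (fun k hk m2 h2 => ?_) (fun m2 h2 => ?_)) ?_
  · obtain ⟨b1, b2, b3⟩ := h2
    have hE2 := hE.of_fillFrame b1
    refine ⟨by rw [b2, hE2.W6]; exact hk, fun t2 => ?_⟩
    have e : ∀ x, x < 40 → x ≠ 40 + S.n + k := fun x hx => by omega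
    simp [wp, ops, Cmd.wp, wpOp, hE2.W19, b2, hE2.W2, e, hE2.W1]
    refine ⟨by omega, by omega, ⟨fun x hx => ?_, b1.2⟩, fun d hd => ?_⟩
    · simp [show x ≠ 9 by omega, show x ≠ 40 + S.n + k by omega, show x ≠ 13 by omega, b1.1 x hx]
    · rw [haddr]
      rcases Nat.lt_or_eq_of_le hd with h | rfl
      · rw [if_neg (by omega), if_neg (by omega), if_neg (by omega), ← haddr, b3 d h]
      · rw [if_neg (by omega), if_pos rfl]
  · rw [h2.2.1, (hE.of_fillFrame h2.1).W6]
    omega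
  rintro m3 t3 ⟨⟨c1, c2, c3⟩, c4⟩
  have hE3 := hE.of_fillFrame c1
  have e : ∀ x, x < 40 → x ≠ 40 + S.n + S.U := fun x hx => by omega
  simp [wp, Cmd.wp, wpOp, hE3.W19, hE3.W5, hE3.W1]
  refine ⟨by omega, ⟨fun x hx => ?_, c1.2⟩, fun d hd => ?_, by omega⟩
  · simp [show x ≠ 40 + S.n + S.U by omega, show x ≠ 13 by omega, c1.1 x hx]
  · by_cases h : d = S.U
    · simp [h, haddr]
    · rw [if_neg (by rw [haddr]; omega), if_neg (by rw [haddr]; omega), if_neg h, c3 d hd]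

/-- The table for the round `j` is in the memory. -/
def HasTable (S : Setting) (j k : ℕ) (m : Mem) : Prop :=
  ∀ i ≤ k, ∀ d < S.D, m.W (S.addr i d) = table S.U (S.l j) (S.w j) i d

/-- Row `i + 1` is computed from row `i` at constant cost per entry. Lower order terms are absorbed
using `1 ≤ n` and `1 ≤ D`. -/
lemma wp_fillCmd {j : ℕ} {m : Mem} (hE : S.EnvJ j m) (t : ℕ) :
    S.wp fillCmd (fun m' t' => S.FillFrame m m' ∧ S.HasTable j S.n m' ∧
      t' ≤ t + 70 * (S.n * S.D)) m t := by
  have hn := S.n_pos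
  have hD := S.D_pos
  refine wp_seq (wp_initCmd hE t) ?_
  rintro m1 t1 ⟨a1, a2, a3⟩
  refine wp_seq (P := fun m' t' => S.FillFrame m m' ∧ S.HasTable j 0 m' ∧ m'.W 8 = 0 ∧
    t' = t1 + 1) ?_ ?_
  · simp [wp, Cmd.wp, wpOp, HasTable]
    refine ⟨⟨fun k hk => ?_, a1.2⟩, fun d hd => ?_⟩
    · simp [show k ≠ 8 by omega, a1.1 k hk]
    · have := S.addr_ge 0 d
      simp [show S.addr 0 d ≠ 8 by omega, a2 d hd, table]
  rintro m2 t2 ⟨b1, b2, b3, rfl⟩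
  refine wp_mono (wp_while (fun k m' => S.FillFrame m m' ∧ S.HasTable j k m' ∧ m'.W 8 = k)
    S.n (S.D * 45 + 4) ⟨b1, b2, b3⟩ (fun i hi m3 h3 => ?_) (fun m3 h3 => ?_)) ?_
  · obtain ⟨c1, c2, c3⟩ := h3
    have hE3 := hE.of_fillFrame c1
    refine ⟨by rw [c3, hE3.W0]; exact hi, fun t3 => ?_⟩
    refine wp_seq (P := fun m' t' => S.FillFrame m m' ∧ S.HasTable j i m' ∧ m'.W 8 = i ∧
      m'.W 9 = 0 ∧ t' = t3 + 1) ?_ ?_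
    · simp [wp, Cmd.wp, wpOp]
      refine ⟨⟨fun k hk => ?_, c1.2⟩, fun i' hi' d hd => ?_, c3⟩
      · simp [show k ≠ 9 by omega, c1.1 k hk]
      · have := S.addr_ge i' d
        simp [show S.addr i' d ≠ 9 by omega, c2 i' hi' d hd]
    rintro m4 t4 ⟨d1, d2, d3, d4, rfl⟩
    refine wp_seq (wp_while (fun k m' => S.FillFrame m m' ∧ S.HasTable j i m' ∧ m'.W 8 = i ∧
      m'.W 9 = k ∧ ∀ d < k, m'.W (S.addr (i + 1) d) = table S.U (S.l j) (S.w j) (i + 1) d)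
      S.D 43 ⟨d1, d2, d3, d4, fun d hd => absurd hd (Nat.not_lt_zero _)⟩
      (fun d hd m5 h5 => ?_) (fun m5 h5 => ?_)) ?_
    · obtain ⟨e1, e2, e3, e4, e5⟩ := h5
      have hE5 := hE.of_fillFrame e1
      refine ⟨by rw [e4, hE5.W6]; exact hd, fun t5 => ?_⟩
      refine wp_seq (wp_moveCmd hE5 hi hd e3 e4 (e2 i le_rfl) t5) ?_
      rintro m6 t6 ⟨f1, f2, ⟨f3, f3'⟩, f4, f5⟩
      have hA : S.addr (i + 1) d = S.addr i d + S.D := by rw [addr, addr]; ring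
      have hAB := S.addr_lt (i := i + 1) (d := d) hi (by omega)
      have hA0 := S.addr_ge i d
      have f10 : m6.W 10 = table S.U (S.l j) (S.w j) (i + 1) d := congrArg Prod.fst f1
      have g6 : m6.W 6 = S.D := by rw [f3 _ (by omega), hE5.W6]
      have g1 : m6.W 1 = 1 := by rw [f3 _ (by omega), hE5.W1]
      have g9 : m6.W 9 = d := by rw [f3 _ (by omega), e4]
      have g8 : m6.W 8 = i := by rw [f3 _ (by omega), e3]
      have e : ∀ x, x < 40 → x ≠ S.addr (i + 1) d := fun x hx => by omega
      simp [wp, ops, Cmd.wp, wpOp, f2, g6, ← hA, e, g1, g9, g8]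
      refine ⟨by omega, by omega, ⟨⟨fun x hx => ?_, fun x hx => ?_, f4.trans e1.2.2⟩,
        fun i' hi' d' hd' => ?_, fun d' hd' => ?_⟩, by omega⟩
      · simp [show x ≠ 9 by omega, show x ≠ S.addr (i + 1) d by omega, show x ≠ 13 by omega]
        rw [f3 x (by omega), e1.1 x hx]
      · simp only [Mem.setW_R]
        rw [f3' x (by omega), e1.2.1 x hx]
      -- Writing into row `i + 1` leaves the earlier rows intact, as addresses increase with the
      -- row.
      · have h1 := S.addr_ge i' d'
        have h2 := S.addr_lt_addr (d' := d) (show i' < i + 1 by omega) hd'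
        simp [show S.addr i' d' ≠ 9 by omega, show S.addr i' d' ≠ S.addr (i + 1) d by omega,
          show S.addr i' d' ≠ 13 by omega]
        rw [f3 _ (by omega), e2 i' hi' d' hd']
      · have h1 := S.addr_ge (i + 1) d'
        rw [if_neg (by omega)]
        split_ifs with h2 h3
        · rw [f10]
          rw [addr, addr] at h2
          rw [show d' = d by omega]
        · omega
        · have : d' ≠ d := fun h => h2 (by rw [h])
          rw [f3 _ (by omega), e5 d' (by omega)]
    · rw [h5.2.2.2.1, (hE.of_fillFrame h5.1).W6]
      omega
    rintro m7 t7 ⟨⟨e1, e2, e3, e4, e5⟩, e6⟩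
    have hE7 := hE.of_fillFrame e1
    have hAB := S.addr_lt (i := i + 1) (d := 0) hi (by omega)
    simp [wp, Cmd.wp, wpOp, e3, hE7.W1]
    refine ⟨?_, ⟨⟨fun x hx => ?_, e1.2⟩, fun i' hi' d' hd' => ?_⟩, by omega⟩
    · have := S.le_B'; omega
    · simp [show x ≠ 8 by omega, e1.1 x hx]
    · have h1 := S.addr_ge i' d'
      simp only [Mem.setW_W, show S.addr i' d' ≠ 8 by omega, if_false]
      rcases Nat.le_succ_iff.1 hi' with h | rfl
      · exact e2 i' h d' hd'
      · exact e5 d' hd'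
  · rw [h3.2.2, (hE.of_fillFrame h3.1).W0]
    omega
  · rintro m3 t3 ⟨⟨c1, c2, c3⟩, c4⟩
    refine ⟨c1, c2, ?_⟩
    have : 1 ≤ S.n := hn
    have h1 : S.D ≤ S.n * S.D := Nat.le_mul_of_pos_left _ hn
    have h2 : S.n ≤ S.n * S.D := Nat.le_mul_of_pos_right _ hD
    have h3 : S.n * (S.D * 45 + 4 + 2) = 45 * (S.n * S.D) + 6 * S.n := by ring
    omega

/-- No back pointers are stored: `moveCmd` is run again on the stored rows, and its mark and
previous position are used. -/
lemma wp_traceCmd {j d : ℕ} {m : Mem} (hE : S.EnvJ j m) (hT : S.HasTable j S.n m) (hd : d < S.D)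
    (h24 : m.W 24 = d) (t : ℕ) :
    S.wp traceCmd (fun m' t' => (∀ i < S.n, m'.W (40 + i) = dpCandidate S.a S.r S.n S.N j d i) ∧
      (∀ k, k < 8 ∨ (18 ≤ k ∧ k < 40) ∨ 40 + S.n ≤ k → m'.W k = m.W k) ∧
      (∀ k, k < 10 ∨ 12 ≤ k → m'.R k = m.R k) ∧ m'.O = m.O ∧ t' ≤ t + 50 * S.n) m t := by
  have hn := S.n_pos
  have hB := S.le_B'
  set T := trace S.U (S.l j) (S.w j) with hTdef
  have hcand : dpCandidate S.a S.r S.n S.N j d = T S.n d := rfl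
  rw [hcand]
  have hDB : S.D ≤ S.B := by nlinarith
  have start : S.wp (ops [.wadd 9 24 2, .wadd 8 0 2] .skip) (fun m' t' => m'.W 9 = d ∧
      m'.W 8 = S.n ∧ (∀ k, k ≠ 8 → k ≠ 9 → m'.W k = m.W k) ∧ m'.R = m.R ∧ m'.O = m.O ∧
      t' = t + 2) m t := by
    simp [wp, ops, Cmd.wp, wpOp, h24, hE.W2, hE.W0]
    refine ⟨by omega, by omega, fun k h1 h2 => ?_⟩
    simp [h1, h2]
  have hmain := wp_seq (S := S) (Q := fun m' t' => (∀ i < S.n, m'.W (40 + i) = T S.n d i) ∧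
      (∀ k, k < 8 ∨ (18 ≤ k ∧ k < 40) ∨ 40 + S.n ≤ k → m'.W k = m.W k) ∧
      (∀ k, k < 10 ∨ 12 ≤ k → m'.R k = m.R k) ∧ m'.O = m.O ∧ t' ≤ t + 50 * S.n)
    (d := .whileW 2 8 (.seq (.op (.wsub 8 8 1)) (.seq moveCmd
    (ops [.wadd 13 18 8, .wstore 13 11] (.op (.wadd 9 12 2)))))) start ?_
  · exact hmain
  rintro m1 t1 ⟨a1, a2, a3, a4, a5, rfl⟩
  -- After `k` rounds the marks of the last `k` items are written, and the trace from the current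
  -- position agrees with the full trace on the remaining items.
  refine wp_mono (wp_while (fun k m' => m'.W 8 = S.n - k ∧ m'.W 9 < S.D ∧
      (∀ i < S.n - k, T (S.n - k) (m'.W 9) i = T S.n d i) ∧
      (∀ i < S.n, S.n - k ≤ i → m'.W (40 + i) = T S.n d i) ∧
      (∀ k, k < 8 ∨ (18 ≤ k ∧ k < 40) ∨ 40 + S.n ≤ k → m'.W k = m.W k) ∧
      (∀ k, k < 10 ∨ 12 ≤ k → m'.R k = m.R k) ∧ m'.O = m.O) S.n 44
    ⟨by rw [a2, Nat.sub_zero], by omega, fun i _ => by rw [a1, Nat.sub_zero],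
      fun i h1 h2 => by omega, fun k hk => a3 k (by omega) (by omega), fun k _ => by rw [a4], a5⟩
    (fun k hk m2 h2 => ?_) (fun m2 h2 => ?_)) ?_
  · obtain ⟨b1, b2, b3, b4, b5, b6, b7⟩ := h2
    have hE2 : S.EnvJ j m2 := hE.congr (fun k hk => b5 k (by omega)) (b5 _ (by omega))
      (b5 _ (by omega)) (fun k hk => b6 k (by omega))
    refine ⟨by rw [hE2.W2, b1]; omega, fun t2 => ?_⟩
    obtain ⟨i, hi⟩ : ∃ i, S.n - k = i + 1 := ⟨S.n - k - 1, by omega⟩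
    have hi' : S.n - (k + 1) = i := by omega
    rw [hi] at b1 b3 b4
    rw [hi']
    set e := m2.W 9 with he
    refine wp_seq (P := fun m' t' => m'.W 8 = i ∧ (∀ k, k ≠ 8 → m'.W k = m2.W k) ∧
      m'.R = m2.R ∧ m'.O = m2.O ∧ t' = t2 + 1) ?_ ?_
    · simp +contextual [wp, Cmd.wp, wpOp, b1, hE2.W1]
    rintro m3 t3 ⟨c1, c2, c3, c4, rfl⟩
    have hE3 : S.EnvJ j m3 := hE2.congr (fun k hk => c2 k (by omega)) (c2 _ (by omega))
      (c2 _ (by omega)) (fun k hk => by rw [c3])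
    refine wp_seq (wp_moveCmd (i := i) (d := e) hE3 (by omega) b2 c1 (c2 _ (by omega))
      (fun x hx => ?_) _) ?_
    · have := S.addr_ge i x
      rw [c2 _ (by omega), b5 _ (by omega), hT i (by omega) x hx]
    rintro m4 t4 ⟨d1, d2, ⟨d3, d3'⟩, d4, d5⟩
    set mv := move (table S.U (S.l j) (S.w j) i) S.D (S.l j i) (S.w j i) e with hmv
    have h11 : m4.W 11 = mv.2.1 := congrArg (fun p => p.2.1) d1
    have h12 : m4.W 12 = mv.2.2 := congrArg (fun p => p.2.2) d1
    have hlt : mv.2.2 < S.D := move_pos_lt _ b2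
    have g18 : m4.W 18 = 40 := by rw [d3 _ (by omega), hE3.W18]
    have g8 : m4.W 8 = i := by rw [d3 _ (by omega), c1]
    have g2 : m4.W 2 = 0 := by rw [d3 _ (by omega), hE3.W2]
    have hself : T (i + 1) e i = mv.2.1 := by
      simp only [hTdef, trace, if_true]
      rfl
    have hother : ∀ x < i, T (i + 1) e x = T i mv.2.2 x := fun x hx => by
      simp only [hTdef, trace]
      rw [if_neg (by omega)]
      rfl
    have hne : ∀ x, x < 40 → x ≠ 40 + i := fun x hx => by omega
    simp [wp, ops, Cmd.wp, wpOp, g18, g8, g2, h11, h12, hne]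
    refine ⟨by omega, by omega, ⟨hlt, fun x hx => ?_, fun x hx hx' => ?_, fun x hx => ?_,
      fun x hx => ?_, ?_⟩, by omega⟩
    · rw [← hother x hx, b3 x (by omega)]
    · rw [if_neg (by omega)]
      split_ifs with h1 h2
      · rw [h1, ← hself, b3 i (by omega)]
      · omega
      · rw [d3 _ (by omega), c2 _ (by omega), b4 x hx (by omega)]
    · rw [if_neg (by omega), if_neg (by omega), if_neg (by omega), d3 _ (by omega),
        c2 _ (by omega), b5 x hx]
    · rw [d3' _ (by omega), c3, b6 x hx]
    · rw [d4, c4, b7]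
  · obtain ⟨b1, b2, b3, b4, b5, b6, b7⟩ := h2
    rw [b1]
    omega
  · rintro m2 t2 ⟨⟨b1, b2, b3, b4, b5, b6, b7⟩, b8⟩
    exact ⟨fun i hi => b4 i hi (by omega), b5, b6, b7, by omega⟩

/-! ### Evaluating and generating candidates -/

lemma markSum_le (m : ℕ → ℕ) (v : ℕ) {k : ℕ} (hk : k ≤ S.n) :
    markSum S.a m v k ≤ ∑ i ∈ Finset.range S.n, S.a i :=
  (markSum_mono hk).trans (Finset.sum_le_sum fun i _ => by
    split_ifs; exacts [le_rfl, Nat.zero_le _])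

lemma le_sum {i : ℕ} (hi : i < S.n) : S.a i ≤ ∑ i ∈ Finset.range S.n, S.a i :=
  Finset.single_le_sum (f := S.a) (fun _ _ => Nat.zero_le _) (Finset.mem_range.2 hi)

/-- The memory contains the marks `mk`. -/
def HasMarks (S : Setting) (mk : ℕ → ℕ) (m : Mem) : Prop := ∀ i < S.n, m.W (40 + i) = mk i

/-- What does not change during an evaluation. -/
def EvalFrame (m m' : Mem) : Prop :=
  (∀ k, k ≠ 20 → k ≠ 21 → m'.W k = m.W k) ∧
  (∀ k, k < 8 ∨ (9 ≤ k ∧ k < 12) ∨ 15 ≤ k → m'.R k = m.R k)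

lemma EvalFrame.trans {m m' m'' : Mem} (h : EvalFrame m m') (h' : EvalFrame m' m'') :
    EvalFrame m m'' :=
  ⟨fun k h1 h2 => (h'.1 k h1 h2).trans (h.1 k h1 h2), fun k hk => (h'.2 k hk).trans (h.2 k hk)⟩

lemma Env.of_evalFrame {m m' : Mem} (h : S.Env m) (hf : EvalFrame m m') : S.Env m' :=
  h.congr (fun k hk => hf.1 k (by omega) (by omega)) (hf.1 _ (by omega) (by omega))
    (hf.1 _ (by omega) (by omega)) (fun k hk => hf.2 k (by omega))

lemma HasMarks.of_evalFrame {mk : ℕ → ℕ} {m m' : Mem} (h : S.HasMarks mk m)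
    (hf : EvalFrame m m') : S.HasMarks mk m' :=
  fun i hi => by rw [hf.1 _ (by omega) (by omega), h i hi]

lemma wp_sumCmd {mk : ℕ → ℕ} {m : Mem} (hE : S.Env m) (hM : S.HasMarks mk m)
    (hmk : ∀ i < S.n, mk i ≤ 2) (t : ℕ) :
    S.wp sumCmd (fun m' t' => m'.R 12 = (markSum S.a mk 1 S.n : ℕ) ∧
      m'.R 13 = (markSum S.a mk 2 S.n : ℕ) ∧ EvalFrame m m' ∧ m'.R 8 = m.R 8 ∧ m'.O = m.O ∧
      t' ≤ t + (S.n * 12 + 5)) m t := by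
  have hB := S.le_B'
  have start : S.wp (ops [.wconst 20 0, .radd 12 0 0, .radd 13 0 0] .skip) (fun m' t' =>
      m'.W 20 = 0 ∧ m'.R 12 = 0 ∧ m'.R 13 = 0 ∧ EvalFrame m m' ∧ m'.R 8 = m.R 8 ∧ m'.O = m.O ∧
      t' = t + 3) m t := by
    have := S.G_nat 0 (Nat.zero_le _)
    rw [Nat.cast_zero] at this
    simp [wp, ops, Cmd.wp, wpOp, hE.R0, this]
    refine ⟨fun k h1 h2 => by simp [h1], fun k hk => ?_⟩
    simp [show k ≠ 12 by omega, show k ≠ 13 by omega]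
  have hmain := wp_seq (S := S) (Q := fun m' t' => m'.R 12 = (markSum S.a mk 1 S.n : ℕ) ∧
      m'.R 13 = (markSum S.a mk 2 S.n : ℕ) ∧ EvalFrame m m' ∧ m'.R 8 = m.R 8 ∧ m'.O = m.O ∧
      t' ≤ t + (S.n * 12 + 5))
    (d := .whileW 20 0 (ops [.wadd 21 20 1, .input 14 21, .wadd 21 18 20, .wload 21 21]
      (.seq (.ifW 21 1 .skip (.ifW 21 3 (.op (.radd 12 12 14)) (.op (.radd 13 13 14))))
        (.op (.wadd 20 20 1))))) start ?_
  · exact hmain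
  rintro m1 t1 ⟨a1, a2, a3, a4, a5, a6, rfl⟩
  refine wp_mono (wp_while (fun k m' => m'.W 20 = k ∧ m'.R 12 = (markSum S.a mk 1 k : ℕ) ∧
      m'.R 13 = (markSum S.a mk 2 k : ℕ) ∧ EvalFrame m m' ∧ m'.R 8 = m.R 8 ∧ m'.O = m.O) S.n 10
      ⟨a1, by simpa [markSum] using a2, by simpa [markSum] using a3, a4, a5, a6⟩
      (fun k hk m2 h2 => ?_) (fun m2 h2 => ?_)) ?_
  · obtain ⟨b1, b2, b3, b4, b5, b6⟩ := h2
    have hE2 := hE.of_evalFrame b4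
    have hM2 := hM.of_evalFrame b4
    refine ⟨by rw [b1, hE2.W0]; exact hk, fun t2 => ?_⟩
    have first : S.wp (ops [.wadd 21 20 1, .input 14 21, .wadd 21 18 20, .wload 21 21] .skip)
        (fun m' t' => m'.W 21 = mk k ∧ m'.R 14 = S.a k ∧ (∀ k, k ≠ 21 → m'.W k = m2.W k) ∧
        (∀ k, k ≠ 14 → m'.R k = m2.R k) ∧ m'.O = m2.O ∧ t' = t2 + 4) m2 t2 := by
      simp +contextual [wp, ops, Cmd.wp, wpOp, b1, hE2.W1, hE2.W18, S.X_succ k hk,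
        show 40 + k ≠ 21 by omega, hM2 k hk, S.G_sum _ (S.le_sum hk)]
      omega
    have hbody := wp_seq (S := S) (Q := fun m' t' => (m'.W 20 = k + 1 ∧
      m'.R 12 = (markSum S.a mk 1 (k + 1) : ℕ) ∧ m'.R 13 = (markSum S.a mk 2 (k + 1) : ℕ) ∧
      EvalFrame m m' ∧ m'.R 8 = m.R 8 ∧ m'.O = m.O) ∧ t' ≤ t2 + 10)
      (d := .seq (.ifW 21 1 .skip (.ifW 21 3 (.op (.radd 12 12 14)) (.op (.radd 13 13 14))))
        (.op (.wadd 20 20 1))) first ?_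
    · exact hbody
    rintro m3 t3 ⟨c1, c2, c3, c4, c5, rfl⟩
    have hk2 := hmk k hk
    have e12 : m3.R 12 = (markSum S.a mk 1 k : ℕ) := by rw [c4 _ (by omega), b2]
    have e13 : m3.R 13 = (markSum S.a mk 2 k : ℕ) := by rw [c4 _ (by omega), b3]
    have e8 : m3.R 8 = m.R 8 := by rw [c4 _ (by omega), b5]
    have e20 : m3.W 20 = k := by rw [c3 _ (by omega), b1]
    have e1 : m3.W 1 = 1 := by rw [c3 _ (by omega), hE2.W1]
    have e3 : m3.W 3 = 2 := by rw [c3 _ (by omega), hE2.W3]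
    have eF : EvalFrame m m3 := b4.trans ⟨fun k _ h2 => c3 k h2, fun k hk => c4 k (by omega)⟩
    have eF' : ∀ m', (∀ k, k ≠ 20 → m'.W k = m3.W k) →
        (∀ k, k ≠ 12 → k ≠ 13 → m'.R k = m3.R k) → EvalFrame m m' := fun m' h1 h2 =>
      eF.trans ⟨fun k h _ => h1 k h, fun k hk => h2 k (by omega) (by omega)⟩
    refine wp_seq (P := fun m' t' => m'.R 12 = (markSum S.a mk 1 (k + 1) : ℕ) ∧
      m'.R 13 = (markSum S.a mk 2 (k + 1) : ℕ) ∧ m'.W = m3.W ∧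
      (∀ k, k ≠ 12 → k ≠ 13 → m'.R k = m3.R k) ∧ m'.O = m3.O ∧ t' ≤ t2 + 9) ?_ ?_
    · have g1 := S.G_sum _ (S.markSum_le mk 1 (k := k + 1) hk)
      have g2 := S.G_sum _ (S.markSum_le mk 2 (k := k + 1) hk)
      rw [markSum_succ] at g1 g2 ⊢
      rw [markSum_succ]
      simp [wp, Cmd.wp, wpOp, c1, c2, e1, e3, e12, e13]
      refine ⟨fun h => ?_, fun h => ⟨fun h' => ?_, fun h' => ?_⟩⟩
      · simp [h]
      · have h1 : mk k = 1 := by omega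
        simp only [h1, if_true] at g1 ⊢
        push_cast at g1
        simp +contextual [g1]
      · have h1 : mk k = 2 := by omega
        simp only [h1, if_true] at g2 ⊢
        push_cast at g2
        simp +contextual [g2]
    rintro m4 t4 ⟨d1, d2, d3, d4, d5, d6⟩
    simp [wp, Cmd.wp, wpOp, d1, d2, d3, e20, e1, d4, d5, c5, b6, e8]
    refine ⟨by omega, eF' _ ?_ ?_, by omega⟩
    · intro x hx; simp [hx, d3]
    · intro x h1 h2; simpa using d4 x h1 h2
  · rw [h2.1, (hE.of_evalFrame h2.2.2.2.1).W0]
    omega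
  · rintro m2 t2 ⟨⟨b1, b2, b3, b4, b5, b6⟩, b7⟩
    exact ⟨b2, b3, b4, b5, b6, by omega⟩

lemma wp_copyCmd {mk : ℕ → ℕ} {m : Mem} (hE : S.Env m) (hM : S.HasMarks mk m) (t : ℕ) :
    S.wp copyCmd (fun m' t' => (∀ i < S.n, m'.O i = mk i) ∧
      (∀ k, k ≠ 20 → k ≠ 21 → m'.W k = m.W k) ∧ m'.R = m.R ∧ t' ≤ t + (S.n * 6 + 3)) m t := by
  have hB := S.le_B'
  refine wp_seq (P := fun m' t' => m'.W 20 = 0 ∧ (∀ k, k ≠ 20 → m'.W k = m.W k) ∧ m'.R = m.R ∧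
    t' = t + 1) ?_ ?_
  · simp +contextual [wp, Cmd.wp, wpOp]
  rintro m1 t1 ⟨a1, a2, a3, rfl⟩
  refine wp_mono (wp_while (fun k m' => m'.W 20 = k ∧ (∀ i < k, m'.O i = mk i) ∧
    (∀ k, k ≠ 20 → k ≠ 21 → m'.W k = m.W k) ∧ m'.R = m.R) S.n 4
    ⟨a1, fun i hi => absurd hi (Nat.not_lt_zero _), fun k h1 h2 => a2 k h1, a3⟩
    (fun k hk m2 h2 => ?_) (fun m2 h2 => ?_)) ?_
  · obtain ⟨b1, b2, b3, b4⟩ := h2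
    refine ⟨by rw [b1, b3 0 (by omega) (by omega), hE.W0]; exact hk, fun t2 => ?_⟩
    have e18 : m2.W 18 = 40 := by rw [b3 _ (by omega) (by omega), hE.W18]
    have e1 : m2.W 1 = 1 := by rw [b3 _ (by omega) (by omega), hE.W1]
    have ek : m2.W (40 + k) = mk k := by rw [b3 _ (by omega) (by omega), hM k hk]
    simp [wp, ops, Cmd.wp, wpOp, b1, e18, e1, show 40 + k ≠ 21 by omega, ek, b4]
    refine ⟨by omega, by omega, fun i hi => ?_, fun x h1 h2 => ?_⟩
    · split_ifs with h
      · rw [h]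
      · exact b2 i (by omega)
    · simp [h1, h2, b3]
  · rw [h2.1, h2.2.2.1 0 (by omega) (by omega), hE.W0]
    omega
  · rintro m2 t2 ⟨⟨b1, b2, b3, b4⟩, b5⟩
    exact ⟨b2, b3, b4, by omega⟩

/-- The real register `8` holds the score of the output. -/
def Best (S : Setting) (m : Mem) : Prop := m.R 8 = score S.a S.r S.n m.O

/-- `Best` ties register `8` to the actual output, and the register never decreases. Hence the final
output is at least as good as every candidate evaluated. -/
lemma wp_evalCmd {mk : ℕ → ℕ} {m : Mem} (hE : S.Env m) (hM : S.HasMarks mk m)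
    (hmk : ∀ i < S.n, mk i ≤ 2) (hb : S.Best m) (t : ℕ) :
    S.wp evalCmd (fun m' t' => EvalFrame m m' ∧ S.Best m' ∧ m.R 8 ≤ m'.R 8 ∧
      score S.a S.r S.n mk ≤ m'.R 8 ∧ t' ≤ t + (S.n * 18 + 20)) m t := by
  have hr0 : (0 : ℝ) < S.r := one_pos.trans_le S.one_le_r
  have h80 : 0 ≤ m.R 8 := by rw [hb]; exact score_nonneg _ hr0.le _ _
  refine wp_seq (wp_sumCmd hE hM hmk t) ?_
  rintro m1 t1 ⟨a1, a2, a3, a4, a5, a6⟩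
  have hE1 := hE.of_evalFrame a3
  set x := markSum S.a mk 1 S.n with hx
  set y := markSum S.a mk 2 S.n with hy
  have hxS := S.markSum_le mk 1 (le_refl S.n)
  have hyS := S.markSum_le mk 2 (le_refl S.n)
  have hsc : score S.a S.r S.n mk = invRatio (S.r * x) y := rfl
  refine wp_seq (P := fun m' t' => m'.R 12 = S.r * x ∧ (∀ k, k ≠ 12 → m'.R k = m1.R k) ∧
    m'.W = m1.W ∧ m'.O = m1.O ∧ t' = t1 + 1) ?_ ?_
  · simp +contextual [wp, Cmd.wp, wpOp, hE1.R2, a1]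
    exact S.G_mul_sum _ hxS
  rintro m2 t2 ⟨b1, b2, b3, b4, rfl⟩
  have b13 : m2.R 13 = y := by rw [b2 _ (by omega), a2]
  have b0 : m2.R 0 = 0 := by rw [b2 _ (by omega), hE1.R0]
  have b8 : m2.R 8 = m.R 8 := by rw [b2 _ (by omega), a4]
  have bF : EvalFrame m m2 := a3.trans ⟨fun k _ _ => by rw [b3], fun k hk => b2 k (by omega)⟩
  have bO : m2.O = m.O := by rw [b4, a5]
  have hx0 : 0 ≤ S.r * x := by positivity
  refine ⟨fun h => ?_, fun h => ?_⟩
  swap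
  · rw [b0, b1, not_lt] at h
    have h0 : S.r * x = 0 := le_antisymm h hx0
    have hs0 : score S.a S.r S.n mk = 0 := by
      rw [hsc, h0, invRatio_of_le (Nat.cast_nonneg _), zero_div]
    refine ⟨bF, ?_, b8.ge, ?_, by omega⟩
    · rw [Best, b8, bO]; exact hb
    · rw [hs0, b8]; exact h80
  rw [b0, b1] at h
  refine wp_seq (P := fun m' t' => m'.R 14 = score S.a S.r S.n mk ∧
    (∀ k, k ≠ 14 → m'.R k = m2.R k) ∧ m'.W = m2.W ∧ m'.O = m2.O ∧ t' ≤ t1 + 5) ?_ ?_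
  · have h1 := S.G_div_sum _ hxS _ hyS
    have h2 := S.G_sum_div _ hxS _ hyS
    rw [hsc]
    simp only [wp, Cmd.wp, wpOp, b1, b13]
    refine ⟨fun hlt => ⟨(h.trans hlt).ne', h1, ?_⟩, fun hlt => ⟨h.ne', h2, ?_⟩⟩
    · simp +contextual [invRatio_of_le hlt.le]
    · rw [invRatio_comm, invRatio_of_le (not_lt.1 hlt)]
      simp +contextual
  rintro m3 t3 ⟨c1, c2, c3, c4, c5⟩
  have cF : EvalFrame m m3 := bF.trans ⟨fun k _ _ => by rw [c3], fun k hk => c2 k (by omega)⟩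
  have hE3 := hE.of_evalFrame cF
  have c8 : m3.R 8 = m.R 8 := by rw [c2 _ (by omega), b8]
  refine ⟨fun hlt => ?_, fun hlt => ?_⟩
  swap
  · rw [c8, c1, not_lt] at hlt
    refine ⟨cF, ?_, c8.ge, by rw [c8]; exact hlt, by omega⟩
    rw [Best, c8, c4, bO]; exact hb
  rw [c8, c1] at hlt
  refine wp_seq (P := fun m' t' => m'.R 8 = score S.a S.r S.n mk ∧
    EvalFrame m m' ∧ t' ≤ t1 + 7) ?_ ?_
  · have hG : S.G (score S.a S.r S.n mk) := by
      rw [hsc]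
      rcases le_total (S.r * x) y with hle | hle
      · rw [invRatio_of_le hle]; exact S.G_div_sum _ hxS _ hyS
      · rw [invRatio_comm, invRatio_of_le hle]; exact S.G_sum_div _ hxS _ hyS
    simp [wp, Cmd.wp, wpOp, c1, hE3.R0, hG]
    refine ⟨cF.trans ⟨fun k _ _ => rfl, fun k hk => ?_⟩, by omega⟩
    simp [show k ≠ 8 by omega]
  rintro m4 t4 ⟨d1, d2, d3⟩
  refine wp_mono (wp_copyCmd (hE.of_evalFrame d2) (hM.of_evalFrame d2) _) ?_
  rintro m5 t5 ⟨e1, e2, e3, e4⟩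
  have e8 : m5.R 8 = score S.a S.r S.n mk := by rw [e3, d1]
  refine ⟨d2.trans ⟨e2, fun k _ => by rw [e3]⟩, ?_, by rw [e8]; exact hlt.le, e8.ge, by omega⟩
  rw [Best, e8]
  exact score_congr _ _ (fun i hi => by rw [e1 i hi]) (fun i hi => by rw [e1 i hi])

/-- Register `c` holds the factor of the light side (`r` or `1`), and `th` the weight of `j` on the
heavy side. The loop also marks `j` itself, which the last instruction overwrites. -/
lemma wp_singleCmd {c th rv rv' v v' j : ℕ} {x y : ℝ} {m : Mem} (hE : S.EnvJ j m) (hc : m.R c = x)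
    (hc8 : c < 8) (hy : m.R th = y) (hth : th < 8) (hv : m.W rv = v) (hrv : rv < 4)
    (hv' : m.W rv' = v') (hrv' : rv' < 4) (hG : ∀ i < S.n, S.G (x * S.a i)) (t : ℕ) :
    S.wp (singleCmd c th rv rv') (fun m' t' =>
      S.HasMarks (singleCandidate (fun i => x * S.a i) y v v' j) m' ∧
      (∀ k, k < 8 ∨ (18 ≤ k ∧ k < 40) ∨ 40 + S.n ≤ k → m'.W k = m.W k) ∧
      (∀ k, k ≠ 10 → m'.R k = m.R k) ∧ m'.O = m.O ∧ t' ≤ t + (S.n * 12 + 5)) m t := by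
  have hB := S.le_B'
  have hj := hE.lt
  refine wp_seq (P := fun m' t' => m'.W 8 = 0 ∧ (∀ k, k ≠ 8 → m'.W k = m.W k) ∧ m'.R = m.R ∧
    m'.O = m.O ∧ t' = t + 1) ?_ ?_
  · simp +contextual [wp, Cmd.wp, wpOp]
  rintro m1 t1 ⟨a1, a2, a3, a4, rfl⟩
  refine wp_seq (wp_while (fun k m' => m'.W 8 = k ∧
    (∀ i < k, m'.W (40 + i) = if y < x * S.a i then 0 else v) ∧
    (∀ k, k < 8 ∨ (18 ≤ k ∧ k < 40) ∨ 40 + S.n ≤ k → m'.W k = m.W k) ∧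
    (∀ k, k ≠ 10 → m'.R k = m.R k) ∧ m'.O = m.O) S.n 10
    ⟨a1, fun i hi => absurd hi (Nat.not_lt_zero _), fun k hk => a2 k (by omega),
      fun k hk => by rw [a3], a4⟩ (fun k hk m2 h2 => ?_) (fun m2 h2 => ?_)) ?_
  · obtain ⟨b1, b2, b3, b4, b5⟩ := h2
    have hE2 : S.EnvJ j m2 := hE.congr (fun k hk => b3 k (by omega)) (b3 _ (by omega))
      (b3 _ (by omega)) (fun k hk => b4 k (by omega))
    refine ⟨by rw [b1, hE2.W0]; exact hk, fun t2 => ?_⟩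
    have e1 : m2.R c = x := by rw [b4 c (by omega), hc]
    have first : S.wp (ops [.wadd 13 8 1, .input 10 13, .rmul 10 c 10, .wadd 13 18 8] .skip)
        (fun m' t' => m'.W 13 = 40 + k ∧ m'.R 10 = x * S.a k ∧ (∀ k, k ≠ 13 → m'.W k = m2.W k) ∧
        (∀ k, k ≠ 10 → m'.R k = m2.R k) ∧ m'.O = m2.O ∧ t' = t2 + 4) m2 t2 := by
      simp +contextual [wp, ops, Cmd.wp, wpOp, b1, hE2.W1, hE2.W18, S.X_succ k hk,
        S.G_sum _ (S.le_sum hk), show c ≠ 10 by omega, e1, hG k hk]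
      omega
    have hbody := wp_seq (S := S) (Q := fun m' t' => (m'.W 8 = k + 1 ∧
      (∀ i < k + 1, m'.W (40 + i) = if y < x * S.a i then 0 else v) ∧
      (∀ k, k < 8 ∨ (18 ≤ k ∧ k < 40) ∨ 40 + S.n ≤ k → m'.W k = m.W k) ∧
      (∀ k, k ≠ 10 → m'.R k = m.R k) ∧ m'.O = m.O) ∧ t' ≤ t2 + 10)
      (d := .seq (.ifR th 10 (.op (.wstore 13 2)) (.op (.wstore 13 rv))) (.op (.wadd 8 8 1)))
      first ?_
    · exact hbody
    rintro m3 t3 ⟨c1, c2, c3, c4, c5, rfl⟩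
    refine wp_seq (P := fun m' t' => m'.W (40 + k) = (if y < x * S.a k then 0 else v) ∧
      (∀ z, z ≠ 40 + k → m'.W z = m3.W z) ∧ m'.R = m3.R ∧ m'.O = m3.O ∧ t' ≤ t2 + 7) ?_ ?_
    · have f1 : m3.R th = y := by rw [c4 _ (by omega), b4 _ (by omega), hy]
      have f2 : m3.W rv = v := by rw [c3 _ (by omega), b3 _ (by omega), hv]
      have f3 : m3.W 2 = 0 := by rw [c3 _ (by omega), hE2.W2]
      simp only [wp, Cmd.wp, wpOp, f1, f2, f3, c1, c2]
      refine ⟨fun hlt => ?_, fun hlt => ?_⟩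
      · simp +contextual [hlt]
      · rw [if_neg hlt]
        simp +contextual
    rintro m4 t4 ⟨d1, d2, d3, d4, d5⟩
    have e8 : m4.W 8 = k := by rw [d2 _ (by omega), c3 _ (by omega), b1]
    have e1 : m4.W 1 = 1 := by rw [d2 _ (by omega), c3 _ (by omega), hE2.W1]
    simp [wp, Cmd.wp, wpOp, e8, e1, d3, d4]
    refine ⟨by omega, ⟨fun i hi => ?_, fun z hz => ?_, fun z hz => ?_, ?_⟩, by omega⟩
    · rw [if_neg (by omega)]
      rcases Nat.lt_or_eq_of_le hi with h | rfl
      · rw [d2 _ (by omega), c3 _ (by omega), b2 i (by omega)]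
      · exact d1
    · rw [if_neg (by omega), d2 _ (by omega), c3 _ (by omega), b3 z hz]
    · rw [c4 z hz, b4 z hz]
    · rw [c5, b5]
  · rw [h2.1, h2.2.2.1 0 (by omega), hE.W0]
    omega
  rintro m2 t2 ⟨⟨b1, b2, b3, b4, b5⟩, b6⟩
  have e18 : m2.W 18 = 40 := by rw [b3 _ (by omega), hE.W18]
  have e7 : m2.W 7 = j := by rw [b3 _ (by omega), hE.W7]
  have erv : m2.W rv' = v' := by rw [b3 _ (by omega), hv']
  simp [wp, Cmd.wp, wpOp, e18, e7, erv, show rv' ≠ 13 by omega, HasMarks]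
  refine ⟨by omega, fun i hi => ?_, fun z hz => ?_, b4, b5, by omega⟩
  · rw [singleCandidate]
    split_ifs with h1 h2 <;> simp_all <;> omega
  · rw [if_neg (by omega), if_neg (by omega), b3 z hz]

/-! ### The rounds and the whole algorithm -/

lemma EnvJ.of_evalFrame {j : ℕ} {m m' : Mem} (h : S.EnvJ j m) (hf : EvalFrame m m') :
    S.EnvJ j m' :=
  h.congr (fun k hk => hf.1 k (by omega) (by omega)) (hf.1 _ (by omega) (by omega))
    (hf.1 _ (by omega) (by omega)) (fun k hk => hf.2 k (by omega))

lemma singleCandidate_le {p : ℕ → ℝ} {y : ℝ} {v v' j : ℕ} (hv : v ≤ 2) (hv' : v' ≤ 2) (i : ℕ) :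
    singleCandidate p y v v' j i ≤ 2 := by
  unfold singleCandidate
  split_ifs <;> omega

lemma trace_le (U : ℕ) (l w : ℕ → ℕ) (k d i : ℕ) : trace U l w k d i ≤ 2 := by
  induction k generalizing d with
  | zero => exact Nat.zero_le _
  | succ k ih =>
    simp only [trace]
    split_ifs
    · exact move_mark_le _ _ _ _ _
    · exact ih _

/-- The number `b` is at least as large as the scores of the candidates of the round `j`. -/
structure Bounds (S : Setting) (j : ℕ) (b : ℝ) : Prop where
  left : score S.a S.r S.n (singleCandidate (fun i => S.r * S.a i) (S.a j) 1 2 j) ≤ b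
  right : score S.a S.r S.n (singleCandidate (fun i => S.a i) (S.r * S.a j) 2 1 j) ≤ b
  dp : ∀ d < S.D, score S.a S.r S.n (dpCandidate S.a S.r S.n S.N j d) ≤ b

lemma Bounds.mono {j : ℕ} {b b' : ℝ} (h : S.Bounds j b) (hb : b ≤ b') : S.Bounds j b' :=
  ⟨h.1.trans hb, h.2.trans hb, fun d hd => (h.3 d hd).trans hb⟩

/-- A single candidate is generated and evaluated. -/
lemma wp_single_eval {c th rv rv' v v' j : ℕ} {x y : ℝ} {m : Mem} (hE : S.EnvJ j m)
    (hb : S.Best m) (hc : m.R c = x) (hc8 : c < 8) (hy : m.R th = y) (hth : th < 8)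
    (hv : m.W rv = v) (hrv : rv < 4) (hv' : m.W rv' = v') (hrv' : rv' < 4) (hv2 : v ≤ 2)
    (hv2' : v' ≤ 2) (hG : ∀ i < S.n, S.G (x * S.a i)) {d : Cmd} {Q : Mem → ℕ → Prop} {t : ℕ}
    (h : ∀ m' t', S.EnvJ j m' → S.Best m' → m.R 8 ≤ m'.R 8 →
      score S.a S.r S.n (singleCandidate (fun i => x * S.a i) y v v' j) ≤ m'.R 8 →
      t' ≤ t + (S.n * 30 + 25) → S.wp d Q m' t') :
    S.wp (.seq (singleCmd c th rv rv') (.seq evalCmd d)) Q m t := by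
  refine wp_seq (wp_singleCmd hE hc hc8 hy hth hv hrv hv' hrv' hG t) ?_
  rintro m1 t1 ⟨a1, a2, a3, a4, a5⟩
  have hE1 : S.EnvJ j m1 := hE.congr (fun k hk => a2 k (by omega)) (a2 _ (by omega))
    (a2 _ (by omega)) (fun k hk => a3 k (by omega))
  have hb1 : S.Best m1 := by rw [Best, a3 _ (by omega), a4]; exact hb
  refine wp_seq (wp_evalCmd hE1.toEnv a1 (fun i _ => singleCandidate_le hv2 hv2' i) hb1 _) ?_
  rintro m2 t2 ⟨b1, b2, b3, b4, b5⟩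
  rw [a3 _ (by omega)] at b3
  exact h m2 t2 (hE1.of_evalFrame b1) b2 b3 b4 (by omega)

/-- All final differences are tried, as that of the optimum is unknown. An unreachable entry still
yields some marking; it is evaluated by its true score and does no harm. The table lies above the
marks and survives the loop. -/
lemma wp_dpLoop {j : ℕ} {m : Mem} (hE : S.EnvJ j m) (hT : S.HasTable j S.n m) (hb : S.Best m)
    (h24 : m.W 24 = 0) (t : ℕ) :
    S.wp (.whileW 24 6 (.seq traceCmd (.seq evalCmd (.op (.wadd 24 24 1))))) (fun m' t' =>
      S.EnvJ j m' ∧ S.Best m' ∧ m.R 8 ≤ m'.R 8 ∧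
      (∀ d < S.D, score S.a S.r S.n (dpCandidate S.a S.r S.n S.N j d) ≤ m'.R 8) ∧
      t' ≤ t + (S.D * (68 * S.n + 23) + 2)) m t := by
  refine wp_mono (wp_while (fun k m' => m'.W 24 = k ∧ S.EnvJ j m' ∧ S.HasTable j S.n m' ∧
      S.Best m' ∧ m.R 8 ≤ m'.R 8 ∧
      ∀ d < k, score S.a S.r S.n (dpCandidate S.a S.r S.n S.N j d) ≤ m'.R 8) S.D (68 * S.n + 21)
      ⟨h24, hE, hT, hb, le_rfl, fun d hd => absurd hd (Nat.not_lt_zero _)⟩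
      (fun k hk m1 h1 => ?_) (fun m1 h1 => ?_)) ?_
  · obtain ⟨a1, a2, a3, a4, a5, a6⟩ := h1
    refine ⟨by rw [a1, a2.W6]; exact hk, fun t1 => ?_⟩
    refine wp_seq (wp_traceCmd a2 a3 hk a1 t1) ?_
    rintro m2 t2 ⟨b1, b2, b3, b4, b5⟩
    have hE2 : S.EnvJ j m2 := a2.congr (fun k hk => b2 k (by omega)) (b2 _ (by omega))
      (b2 _ (by omega)) (fun k hk => b3 k (by omega))
    have hb2 : S.Best m2 := by rw [Best, b3 _ (by omega), b4]; exact a4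
    refine wp_seq (wp_evalCmd hE2.toEnv b1 (fun i _ => trace_le _ _ _ _ _ _) hb2 _) ?_
    rintro m3 t3 ⟨c1, c2, c3, c4, c5⟩
    rw [b3 _ (by omega)] at c3
    have hE3 := hE2.of_evalFrame c1
    have c24 : m3.W 24 = k := by rw [c1.1 _ (by omega) (by omega), b2 24 (by omega), a1]
    have hDB := S.addr_lt (i := 0) (d := S.D) (Nat.zero_le _) (by have := S.D_pos; omega)
    have h0 : S.addr 0 S.D = S.D + (40 + S.n) := by rw [addr]; ring
    simp only [wp, Cmd.wp, wpOp, c24, hE3.W1]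
    refine ⟨by omega, ⟨by simp, ?_, ?_, c2, a5.trans c3, fun d hd => ?_⟩, by omega⟩
    · exact hE3.congr (fun x hx => by simp [show x ≠ 24 by omega]) (by simp) (by simp)
        (fun x hx => by simp)
    · intro i hi d hd
      have := S.addr_ge i d
      simp only [Mem.setW_W, show S.addr i d ≠ 24 by omega, if_false]
      rw [c1.1 _ (by omega) (by omega), b2 _ (by omega), a3 i hi d hd]
    · rcases Nat.lt_succ_iff_lt_or_eq.1 hd with h | rfl
      · exact (a6 d h).trans c3
      · exact c4
  · rw [h1.1, h1.2.1.W6]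
    omega
  · rintro m1 t1 ⟨⟨a1, a2, a3, a4, a5, a6⟩, a7⟩
    exact ⟨a2, a4, a5, a6, a7⟩

lemma wp_roundCmd {j : ℕ} {m : Mem} (hE : S.Env m) (hj : j < S.n) (h7 : m.W 7 = j)
    (hb : S.Best m) (t : ℕ) :
    S.wp roundCmd (fun m' t' => S.Env m' ∧ m'.W 7 = j + 1 ∧ S.Best m' ∧ m.R 8 ≤ m'.R 8 ∧
      S.Bounds j (m'.R 8) ∧ t' ≤ t + 400 * (S.n * S.D)) m t := by
  have hB := S.le_B'
  have ha : (0 : ℝ) < S.a j := by exact_mod_cast S.a_pos j hj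
  have hNB : S.N ≤ S.B := by
    have := S.le_B
    have := Nat.le_mul_of_pos_left S.N S.n_pos
    nlinarith
  have start : S.wp (ops [.wadd 13 7 1, .input 4 13, .rmul 7 2 4, .rcast 10 4, .rdiv 5 10 4,
      .rmul 6 2 5] .skip) (fun m' t' => S.EnvJ j m' ∧ S.Best m' ∧ m'.R 8 = m.R 8 ∧ t' = t + 6)
      m t := by
    have g1 := S.G_mul_scale j hj
    have g2 := S.G_scale j hj
    have g3 := S.G_mul_sum _ (S.le_sum hj)
    simp [wp, ops, Cmd.wp, wpOp, h7, hE.W1, S.X_succ j hj, S.G_sum _ (S.le_sum hj), hE.R2, hE.W4,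
      ha.ne', g1, g2, g3, S.G_nat _ hNB, Best]
    refine ⟨by omega, ⟨hE.congr ?_ ?_ ?_ ?_, hj, ?_, ?_, ?_, ?_, ?_⟩, hb⟩
    · intro x hx; simp [show x ≠ 13 by omega]
    · simp
    · simp
    · intro x hx
      simp [show x ≠ 6 by omega, show x ≠ 5 by omega, show x ≠ 10 by omega, show x ≠ 7 by omega,
        show x ≠ 4 by omega]
    all_goals simp [h7]
  have hmain := wp_seq (S := S) (Q := fun m' t' => S.Env m' ∧ m'.W 7 = j + 1 ∧ S.Best m' ∧
      m.R 8 ≤ m'.R 8 ∧ S.Bounds j (m'.R 8) ∧ t' ≤ t + 400 * (S.n * S.D))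
    (d := .seq (singleCmd 2 4 1 3) (.seq evalCmd (.seq (singleCmd 1 7 3 1) (.seq evalCmd
      (.seq fillCmd (.seq (.op (.wconst 24 0)) (.seq
        (.whileW 24 6 (.seq traceCmd (.seq evalCmd (.op (.wadd 24 24 1)))))
        (.op (.wadd 7 7 1))))))))) start ?_
  · exact hmain
  rintro m1 t1 ⟨a1, a2, a3, rfl⟩
  refine wp_single_eval a1 a2 a1.R2 (by omega) a1.R4 (by omega) a1.W1 (by omega) a1.W3 (by omega)
    (by omega) le_rfl (fun i hi => S.G_mul_sum _ (S.le_sum hi)) ?_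
  intro m2 t2 b1 b2 b3 b4 b5
  refine wp_single_eval b1 b2 b1.R1 (by omega) b1.R7 (by omega) b1.W3 (by omega) b1.W1 (by omega)
    le_rfl (by omega) (fun i hi => by rw [one_mul]; exact S.G_sum _ (S.le_sum hi)) ?_
  intro m3 t3 c1 c2 c3 c4 c5
  simp only [one_mul] at c4
  refine wp_seq (wp_fillCmd c1 _) ?_
  rintro m4 t4 ⟨d1, d2, d3⟩
  have hE4 := c1.of_fillFrame d1
  have d8 : m4.R 8 = m3.R 8 := d1.2.1 _ (by omega)
  have hb4 : S.Best m4 := by rw [Best, d8, d1.2.2]; exact c2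
  refine wp_seq (P := fun m' t' => S.EnvJ j m' ∧ S.HasTable j S.n m' ∧ S.Best m' ∧ m'.W 24 = 0 ∧
    m'.R 8 = m4.R 8 ∧ t' = t4 + 1) ?_ ?_
  · simp only [wp, Cmd.wp, wpOp]
    refine ⟨by omega, hE4.congr ?_ ?_ ?_ ?_, ?_, hb4, ?_, rfl, trivial⟩
    · intro x hx; simp [show x ≠ 24 by omega]
    · simp
    · simp
    · simp
    · intro i hi d hd
      have := S.addr_ge i d
      simp only [Mem.setW_W, show S.addr i d ≠ 24 by omega, if_false]
      exact d2 i hi d hd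
    · simp
  rintro m5 t5 ⟨e1, e2, e3, e4, e5, rfl⟩
  refine wp_seq (wp_dpLoop e1 e2 e3 e4 _) ?_
  rintro m6 t6 ⟨f1, f2, f3, f4, f5⟩
  rw [e5, d8] at f3
  simp only [wp, Cmd.wp, wpOp, f1.W7, f1.W1]
  refine ⟨by omega, f1.toEnv.congr ?_ ?_ ?_ ?_, ?_, f2, ?_, ?_, ?_⟩
  · intro x hx; simp [show x ≠ 7 by omega]
  · simp
  · simp
  · simp
  · simp
  · simp only [Mem.setW_R]; linarith
  · simp only [Mem.setW_R]
    exact ⟨by linarith, by linarith, f4⟩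
  · have hn := S.n_pos
    have hD := S.D_pos
    have h1 : S.D ≤ S.n * S.D := Nat.le_mul_of_pos_left _ hn
    have h2 : S.n ≤ S.n * S.D := Nat.le_mul_of_pos_right _ hD
    have h3 : S.D * (68 * S.n + 23) = 68 * (S.n * S.D) + 23 * S.D := by ring
    omega

/-- The memory at the beginning. -/
def start (n : ℕ) : Mem := ⟨fun i => if i = 0 then n else 0, fun _ => 0, fun _ => 0⟩

lemma wp_setupCmd {ε : ℝ} (hε : 0 < ε) (hX0 : S.X 0 = ε)
    (hXr : S.X (S.n + 1) = S.r ∨ S.X (S.n + 1) = 0 ∧ S.r = 1)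
    (hN : S.N = ⌊6 * S.n / ε⌋₊ + 1) (hGε : S.G ε) (hGr : S.G S.r)
    (hGdiv : S.G (6 * S.n / ε)) (t : ℕ) :
    S.wp setupCmd (fun m' t' => S.Env m' ∧ m'.W 7 = 0 ∧ S.Best m' ∧ t' ≤ t + 25)
      (start S.n) t := by
  have hB := S.le_B'
  have hn := S.n_pos
  have hDU : S.D = 2 * S.U + 1 := rfl
  have hU : S.U = 2 * (S.n * S.N) := by rw [U, mul_assoc]
  have hDB : S.D ≤ S.B := by nlinarith
  have hNU : S.N ≤ S.n * S.N := Nat.le_mul_of_pos_left _ hn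
  have hG1 := S.G_nat 1 (by omega)
  have hG0 := S.G_nat 0 (by omega)
  have hG6 := S.G_nat (6 * S.n) (by omega)
  rw [Nat.cast_one] at hG1
  rw [Nat.cast_zero] at hG0
  have hGU := S.G_nat S.U (by omega)
  have first : S.wp (ops [.wconst 1 1, .wconst 3 2, .wconst 18 40, .wadd 19 18 0, .input 9 2,
      .wadd 13 0 1, .input 2 13, .rcast 1 1] (.ifR 2 1 (.op (.radd 2 1 0)) .skip))
      (fun m' t' => m'.W 0 = S.n ∧ m'.W 1 = 1 ∧ m'.W 2 = 0 ∧ m'.W 3 = 2 ∧ m'.W 7 = 0 ∧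
        m'.W 18 = 40 ∧ m'.W 19 = 40 + S.n ∧ m'.R 0 = 0 ∧ m'.R 1 = 1 ∧ m'.R 2 = S.r ∧
        m'.R 8 = 0 ∧ m'.R 9 = ε ∧ (∀ i, m'.O i = 0) ∧ t' ≤ t + 11) (start S.n) t := by
    have h1 := S.one_le_r
    rcases hXr with h | ⟨h, hr⟩
    · simp [wp, ops, Cmd.wp, wpOp, start, hX0, h, not_lt.2 h1, hG1, hGε, hGr]
      omega
    · simp [wp, ops, Cmd.wp, wpOp, start, hX0, h, hr, hG1, hGε, hG0]
      omega
  have hmain := wp_seq (S := S) (Q := fun m' t' => S.Env m' ∧ m'.W 7 = 0 ∧ S.Best m' ∧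
    t' ≤ t + 25) (d := ops [.wconst 13 6, .wmul 13 13 0, .rcast 10 13, .rdiv 10 10 9,
      .rfloor 4 10, .wadd 4 4 1, .wmul 5 0 4, .wmul 5 3 5, .wmul 6 3 5, .wadd 6 6 1]
      (.op (.rcast 3 5))) first ?_
  · exact hmain
  rintro m1 t1 ⟨w0, w1, w2, w3, w7, w18, w19, r0, r1, r2, r8, r9, o, ht⟩
  push_cast at hG6
  have hN' : ⌊6 * (S.n : ℝ) / ε⌋₊ + 1 = S.N := hN.symm
  simp [wp, ops, Cmd.wp, wpOp, w0, w1, w3, r9, hε.ne', hN', hG6, hGdiv, w7, ← hU, hGU, ← hDU]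
  refine ⟨by omega, by omega, by omega, by omega, by omega, by omega, by omega, by omega,
    ⟨?_, ?_, ?_, ?_, ?_, ?_, ?_, ?_, ?_, ?_, ?_, ?_, ?_⟩, ?_, by omega⟩
  all_goals try simp [w0, w1, w2, w3, w18, w19, r0, r1, r2]
  rw [Best]
  simp only [Mem.setR_R, Mem.setR_O, Mem.setW_R, Mem.setW_O]
  -- The blank output has empty sides, so its score is `0`, the initial value of register `8`.
  have : ∀ v, v ≠ 0 → markSum S.a m1.O v S.n = 0 := fun v hv =>
    Finset.sum_eq_zero fun i _ => if_neg (by rw [o i]; exact hv.symm)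
  simp [r8, score, this, invRatio]

theorem wp_mainCmd {ε : ℝ} (hε : 0 < ε) (hX0 : S.X 0 = ε)
    (hXr : S.X (S.n + 1) = S.r ∨ S.X (S.n + 1) = 0 ∧ S.r = 1)
    (hN : S.N = ⌊6 * S.n / ε⌋₊ + 1) (hGε : S.G ε) (hGr : S.G S.r)
    (hGdiv : S.G (6 * S.n / ε)) :
    S.wp mainCmd (fun m' t' => (∀ j < S.n, S.Bounds j (score S.a S.r S.n m'.O)) ∧
      t' ≤ 500 * (S.n * (S.n * S.D))) (start S.n) 0 := by
  refine wp_seq (wp_setupCmd hε hX0 hXr hN hGε hGr hGdiv 0) ?_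
  rintro m1 t1 ⟨a1, a2, a3, a4⟩
  refine wp_mono (wp_while (fun k m' => S.Env m' ∧ m'.W 7 = k ∧ S.Best m' ∧
    ∀ j < k, S.Bounds j (m'.R 8)) S.n (400 * (S.n * S.D))
    ⟨a1, a2, a3, fun j hj => absurd hj (Nat.not_lt_zero _)⟩
    (fun k hk m2 h2 => ?_) (fun m2 h2 => ?_)) ?_
  · obtain ⟨b1, b2, b3, b4⟩ := h2
    refine ⟨by rw [b1.W0, b2]; exact hk, fun t2 => wp_mono (wp_roundCmd b1 hk b2 b3 t2) ?_⟩
    rintro m3 t3 ⟨c1, c2, c3, c4, c5, c6⟩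
    refine ⟨⟨c1, c2, c3, fun j hj => ?_⟩, c6⟩
    rcases Nat.lt_succ_iff_lt_or_eq.1 hj with h | rfl
    · exact (b4 j h).mono c4
    · exact c5
  · rw [h2.1.W0, h2.2.1]
    omega
  · rintro m2 t2 ⟨⟨b1, b2, b3, b4⟩, b5⟩
    refine ⟨fun j hj => by rw [← b3]; exact b4 j hj, ?_⟩
    have hn := S.n_pos
    have hD := S.D_pos
    have h1 : S.n * 1 ≤ S.n * (S.n * S.D) :=
      Nat.mul_le_mul_left _ (Nat.succ_le_of_lt (Nat.mul_pos hn hD))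
    have h2 : S.n * (400 * (S.n * S.D) + 2) = 400 * (S.n * (S.n * S.D)) + 2 * S.n := by ring
    omega

end Setting

/-! ### Bit lengths -/

/-- A nonnegative rational number whose numerator and denominator are at most `2 ^ K`. -/
def Height (K : ℕ) (v : ℝ) : Prop :=
  ∃ p q : ℕ, 0 < q ∧ p ≤ 2 ^ K ∧ q ≤ 2 ^ K ∧ v = p / q

namespace Height

lemma mono {K K' : ℕ} {v : ℝ} (h : Height K v) (hK : K ≤ K') : Height K' v := by
  obtain ⟨p, q, h0, h1, h2, rfl⟩ := h
  have := Nat.pow_le_pow_right two_pos hK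
  exact ⟨p, q, h0, h1.trans this, h2.trans this, rfl⟩

lemma natCast {K k : ℕ} (h : k ≤ 2 ^ K) : Height K k :=
  ⟨k, 1, one_pos, h, Nat.one_le_two_pow, by simp⟩

lemma mul {K K' : ℕ} {u v : ℝ} (hu : Height K u) (hv : Height K' v) :
    Height (K + K') (u * v) := by
  obtain ⟨p, q, h0, h1, h2, rfl⟩ := hu
  obtain ⟨p', q', h0', h1', h2', rfl⟩ := hv
  refine ⟨p * p', q * q', Nat.mul_pos h0 h0', ?_, ?_, ?_⟩
  · rw [pow_add]; exact Nat.mul_le_mul h1 h1'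
  · rw [pow_add]; exact Nat.mul_le_mul h2 h2'
  · push_cast; rw [div_mul_div_comm]

lemma div {K K' : ℕ} {u v : ℝ} (hu : Height K u) (hv : Height K' v) :
    Height (K + K') (u / v) := by
  obtain ⟨p, q, h0, h1, h2, rfl⟩ := hv
  -- For `v = 0` the quotient is `0` by convention.
  rcases Nat.eq_zero_or_pos p with rfl | hp
  · simpa using natCast (k := 0) (Nat.zero_le (2 ^ (K + K')))
  · have := hu.mul (v := (q : ℝ) / p) ⟨q, p, hp, h2, h1, rfl⟩
    rwa [div_eq_mul_inv u, inv_div]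

/-- Reduction to lowest terms does not enlarge numerator or denominator. -/
lemma exists_rat {K : ℕ} {v : ℝ} (h : Height K v) :
    ∃ q : ℚ, v = (q : ℝ) ∧ bits q ≤ 2 * (K + 1) := by
  obtain ⟨p, q, h0, h1, h2, rfl⟩ := h
  have hlt : 2 ^ K < 2 ^ (K + 1) := Nat.pow_lt_pow_right one_lt_two (Nat.lt_succ_self K)
  refine ⟨Rat.divInt p q, ?_, ?_⟩
  · rw [Rat.divInt_eq_div]; push_cast; rfl
  have hnum : (Rat.divInt p q).num.natAbs ≤ p := by
    have hd := Rat.num_dvd p (b := (q : ℤ)) (by exact_mod_cast h0.ne')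
    rcases Nat.eq_zero_or_pos p with rfl | hp
    · simp
    · exact Nat.le_of_dvd hp (by simpa using Int.natAbs_dvd_natAbs.2 hd)
  have hden : (Rat.divInt p q).den ≤ q :=
    Nat.le_of_dvd h0 (by exact_mod_cast Rat.den_dvd (p : ℤ) (q : ℤ))
  have s1 : (Rat.divInt p q).num.natAbs.size ≤ K + 1 := Nat.size_le.2 (by omega)
  have s2 : (Rat.divInt p q).den.size ≤ K + 1 := Nat.size_le.2 (by omega)
  rw [bits]
  omega

lemma of_rat {e : ℚ} (he : 0 ≤ e) : Height (bits e) e := by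
  refine ⟨e.num.natAbs, e.den, e.den_pos, ?_, ?_, ?_⟩
  · exact (Nat.lt_size_self _).le.trans
      (Nat.pow_le_pow_right two_pos (Nat.le_add_right _ _))
  · exact (Nat.lt_size_self _).le.trans
      (Nat.pow_le_pow_right two_pos (Nat.le_add_left _ _))
  · rw [← Int.cast_natCast (R := ℝ), Int.natAbs_of_nonneg (Rat.num_nonneg.2 he)]
    exact Rat.cast_def e

end Height

lemma one_le_bits (e : ℚ) : 1 ≤ bits e :=
  (Nat.size_pos.2 e.den_pos).trans_le (Nat.le_add_left _ _)

/-- Expanding ∏ (a i + 1) shows that it is at least 1 + ∑ a i. Hence sums of input numbers have bit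
length linear in that of the input. -/
lemma sum_succ_le_two_pow {n : ℕ} (a : Fin n → ℕ) :
    ∑ i, a i + 1 ≤ 2 ^ ∑ i, (a i).size := by
  rw [← Finset.prod_pow_eq_pow_sum]
  calc ∑ i, a i + 1 ≤ ∏ i, (a i + 1) := by
        induction n with
        | zero => simp
        | succ n ih =>
          rw [Fin.sum_univ_succ, Fin.prod_univ_succ]
          have := ih (fun i => a i.succ)
          have := Nat.mul_le_mul_left (a 0) (Nat.le_trans (Nat.le_add_left 1 _) this)
          rw [Nat.succ_mul]
          omega
    _ ≤ ∏ i, 2 ^ (a i).size := Finset.prod_le_prod' fun i _ => Nat.lt_size_self _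

/-- A rational list whose beginning consists of natural numbers. -/
lemma sum_bits_of_map_eq {n : ℕ} {a : Fin n → ℕ} {xs : List ℚ} {ys : List ℝ}
    (h : (List.ofFn fun i => (a i : ℝ)) ++ ys = xs.map fun q : ℚ => (q : ℝ)) :
    ∃ zs : List ℚ, ys = zs.map (fun q : ℚ => (q : ℝ)) ∧
      (xs.map bits).sum = ∑ i, (a i).size + n + (zs.map bits).sum := by
  obtain ⟨l₁, zs, rfl, h1, h2⟩ := List.map_eq_append_iff.1 h.symm
  have h3 : l₁ = List.ofFn fun i => (a i : ℚ) := by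
    have hinj : Function.Injective (List.map fun q : ℚ => (q : ℝ)) :=
      List.map_injective_iff.2 Rat.cast_injective
    apply hinj
    rw [h1, List.map_ofFn]
    congr 1
  refine ⟨zs, h2.symm, ?_⟩
  rw [List.map_append, List.sum_append, h3, List.map_ofFn, List.sum_ofFn]
  congr 1
  simp [bits, Finset.sum_add_distrib, Nat.size_one]

/-! ### The algorithm on the machine -/

/-- The program. -/
def program : List Instr := mainCmd.compile 0 ++ [.halt]

/-- The setting of the algorithm for the given input. -/
noncomputable def mkSetting (n : ℕ) (a : ℕ → ℕ) (r ε : ℝ) (X : ℕ → ℝ) (hn : 0 < n)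
    (ha : ∀ i < n, 0 < a i) (hr : 1 ≤ r) (hX : ∀ i < n, X (i + 1) = a i) : Setting :=
  let N := ⌊6 * n / ε⌋₊ + 1
  let B := 100 + 10 * n + (n + 4) * (4 * n * N + 1)
  let s := ∑ i ∈ Finset.range n, a i
  -- The quantifier over `K` makes `G` vacuous for irrational ε or r. The longest expression, a i *
  -- (r * (N / a j)), only needs height `4 * K`.
  let G : ℝ → Prop := fun v => ∀ K, Height K ε → Height K r → s ≤ 2 ^ K → B ≤ 2 ^ K →
    Height (8 * K) v
  have hN : N ≤ B := by
    have := Nat.le_mul_of_pos_left N hn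
    dsimp only [B]
    nlinarith
  have ha' : ∀ i < n, a i ≤ s := fun i hi =>
    Finset.single_le_sum (f := a) (fun _ _ => Nat.zero_le _) (Finset.mem_range.2 hi)
  { n := n, N := N, a := a, r := r, X := X, B := B, G := G
    n_pos := hn, a_pos := ha, one_le_r := hr, X_succ := hX, le_B := le_rfl
    G_nat := fun _ hk K _ _ _ hB => (Height.natCast (hk.trans hB)).mono (by omega)
    G_sum := fun _ h K _ _ hs _ => (Height.natCast (h.trans hs)).mono (by omega)
    G_mul_sum := fun _ h K _ hr hs _ => (hr.mul (.natCast (h.trans hs))).mono (by omega)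
    G_div_sum := fun _ h _ h' K _ hr hs _ =>
      ((hr.mul (.natCast (h.trans hs))).div (.natCast (h'.trans hs))).mono (by omega)
    G_sum_div := fun _ h _ h' K _ hr hs _ =>
      (Height.div (.natCast (h'.trans hs)) (hr.mul (.natCast (h.trans hs)))).mono (by omega)
    G_scale := fun j hj K _ _ hs hB =>
      (Height.div (.natCast (hN.trans hB)) (.natCast ((ha' j hj).trans hs))).mono (by omega)
    G_mul_scale := fun j hj K _ hr hs hB => (hr.mul
      (Height.div (.natCast (hN.trans hB)) (.natCast ((ha' j hj).trans hs)))).mono (by omega)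
    G_scaled := fun i hi j hj K _ _ hs hB => (Height.mul (.natCast ((ha' i hi).trans hs))
      (Height.div (.natCast (hN.trans hB)) (.natCast ((ha' j hj).trans hs)))).mono (by omega)
    G_mul_scaled := fun i hi j hj K _ hr hs hB => (Height.mul (.natCast ((ha' i hi).trans hs))
      (hr.mul (Height.div (.natCast (hN.trans hB))
        (.natCast ((ha' j hj).trans hs))))).mono (by omega) }

theorem run_program {n : ℕ} (hn : 0 < n) {a : ℕ → ℕ} (ha : ∀ i < n, 0 < a i) {r : ℝ} (hr : 1 ≤ r)
    {ε : ℝ} (hε : 0 < ε) (hε' : ε < 1) {X : ℕ → ℝ} (hX0 : X 0 = ε)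
    (hX : ∀ i < n, X (i + 1) = a i) (hXr : X (n + 1) = r ∨ X (n + 1) = 0 ∧ r = 1) {N B : ℕ}
    (hN : N = ⌊6 * n / ε⌋₊ + 1) (hB : B = 100 + 10 * n + (n + 4) * (4 * n * N + 1)) :
    ∃ (t : ℕ) (c : Config), t ≤ 500 * (n * (n * (4 * n * N + 1))) ∧
      run program X (initial n) t = some c ∧ program[c.pc]? = some Instr.halt ∧
      (∀ m, score a r n m ≤ (1 + ε) * score a r n c.O) ∧
      ∀ s ≤ t, ∀ d, run program X (initial n) s = some d → (∀ k, d.W k ≤ B) ∧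
        ∀ k K, Height K ε → Height K r → ∑ i ∈ Finset.range n, a i ≤ 2 ^ K → B ≤ 2 ^ K →
          Height (8 * K) (d.R k) := by
  subst hN
  set S := mkSetting n a r ε X hn ha hr hX with hS
  have h6n : 6 * n ≤ S.B := by
    rw [hS]
    simp only [mkSetting]
    omega
  have hw := Setting.wp_mainCmd (S := S) hε hX0 hXr rfl
    (fun K h _ _ _ => h.mono (by omega)) (fun K _ h _ _ => h.mono (by omega))
    (fun K h _ _ h' => by
      have := (Height.natCast (h6n.trans h')).div h
      push_cast at this
      exact this.mono (by omega))
  have hsafe : (Setting.start n).Safe S.B S.G := by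
    refine ⟨fun k => ?_, fun k K _ _ _ _ => ?_⟩
    · simp only [Setting.start]
      split_ifs <;> omega
    · have := Height.natCast (K := 8 * K) (k := 0) (Nat.zero_le _)
      simpa [Setting.start] using this
  obtain ⟨u, m', h1, h2, h3, h4⟩ := Cmd.reach (p := program) (b := 0)
    ⟨[], [.halt], by simp [program], rfl⟩ hsafe hw
  have hD : S.D = 4 * n * (⌊6 * n / ε⌋₊ + 1) + 1 := by
    rw [Setting.D, Setting.U, hS]
    simp only [mkSetting]
    ring
  rw [zero_add, hD] at h4
  refine ⟨u, m'.cfg (0 + mainCmd.size), h4, h1.1, ?_, fun m => ?_, fun s hs d hd => ?_⟩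
  · simp [Mem.cfg, program, Cmd.length_compile]
  · have hN6 : 6 * (n : ℝ) ≤ ε * (⌊6 * n / ε⌋₊ + 1 : ℕ) := by
      have := (Nat.lt_floor_add_one (6 * (n : ℝ) / ε)).le
      rw [div_le_iff₀ hε] at this
      push_cast
      linarith
    exact score_le_of_candidates hn ha hr hε hε' hN6 (fun j hj => (h3 j hj).left)
      (fun j hj => (h3 j hj).right) (fun j hj => (h3 j hj).dp) m
  · have := h1.2 s hs d hd
    refine ⟨fun k => (this.1 k).trans (le_of_eq ?_), fun k K k1 k2 k3 k4 =>
      this.2 k K k1 k2 k3 (le_trans (le_of_eq ?_) k4)⟩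
    · rw [hB]; rfl
    · rw [hB]

/-! ### The approximation scheme -/

lemma sum_eq_markSum {n : ℕ} (a : Fin n → ℕ) {T : Finset (Fin n)} {m : ℕ → ℕ} {v : ℕ}
    (h : ∀ i : Fin n, i ∈ T ↔ m i = v) :
    ∑ i ∈ T, (a i : ℝ) =
      ((markSum (fun k => if h : k < n then a ⟨k, h⟩ else 0) m v n : ℕ) : ℝ) := by
  rw [cast_markSum, markSum, Finset.sum_range, ← Finset.sum_filter]
  exact Finset.sum_congr (by ext i; simp [h]) fun i _ => by simp

lemma exists_marks {n : ℕ} {T₁ T₂ : Finset (Fin n)} (h : Disjoint T₁ T₂) :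
    ∃ m : ℕ → ℕ, (∀ i : Fin n, i ∈ T₁ ↔ m i = 1) ∧ ∀ i : Fin n, i ∈ T₂ ↔ m i = 2 := by
  refine ⟨fun k => if h : k < n then (if (⟨k, h⟩ : Fin n) ∈ T₁ then 1
    else if (⟨k, h⟩ : Fin n) ∈ T₂ then 2 else 0) else 0, fun i => ?_, fun i => ?_⟩
  · simp only [i.2, dif_pos]
    split_ifs <;> simp_all
  · have : i ∈ T₁ → i ∉ T₂ := fun h1 h2 => Finset.disjoint_left.1 h h1 h2
    simp only [i.2, dif_pos]
    split_ifs <;> simp_all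

/-- The list `ys` is what follows the a i in the input: `[r]` for Factor-r SSR, nothing for SSR.
Both problems are thus treated at once. -/
theorem exists_approximation {n : ℕ} (hn : 2 ≤ n) (a : Fin n → ℕ) (ha : ∀ i, 0 < a i) {r : ℝ}
    (hr : 1 ≤ r) {ys : List ℝ} (hys : ys = [r] ∨ ys = [] ∧ r = 1) {ε : ℝ} (hε : 0 < ε)
    (hε' : ε < 1) :
    ∃ (t : ℕ) (c : Config),
      (t : ℝ) ≤ (20000 : ℕ) * ((n : ℝ) ^ 4 / ε) ∧
      run program (inputArray ε ((List.ofFn fun i => (a i : ℝ)) ++ ys)) (initial n) t = some c ∧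
      program[c.pc]? = some Instr.halt ∧
      (NonemptyDisjoint (marked n c 1) (marked n c 2) ∧ ∀ T₁ T₂, NonemptyDisjoint T₁ T₂ →
        maxMinRatio (r * ∑ i ∈ marked n c 1, (a i : ℝ)) (∑ i ∈ marked n c 2, (a i : ℝ)) ≤
          (1 + ε) * maxMinRatio (r * ∑ i ∈ T₁, (a i : ℝ)) (∑ i ∈ T₂, (a i : ℝ))) ∧
      ∀ s ≤ t, ∀ d : Config,
        run program (inputArray ε ((List.ofFn fun i => (a i : ℝ)) ++ ys)) (initial n) s = some d →
          (∀ k, (d.W k : ℝ) ≤ (20000 : ℕ) * ((n : ℝ) / ε) ^ 20000) ∧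
          ∀ (e : ℚ) (xs : List ℚ), ε = (e : ℝ) →
            (List.ofFn fun i => (a i : ℝ)) ++ ys = xs.map (fun q => (q : ℝ)) →
            ∀ k, ∃ q : ℚ, d.R k = (q : ℝ) ∧ bits q ≤ 20000 * (bits e + (xs.map bits).sum) := by
  set a' : ℕ → ℕ := fun k => if h : k < n then a ⟨k, h⟩ else 0 with ha'
  set X := inputArray ε ((List.ofFn fun i => (a i : ℝ)) ++ ys) with hX
  have hpos : ∀ i < n, 0 < a' i := fun i hi => by simp only [ha', hi, dif_pos]; exact ha _
  have hXs : ∀ i < n, X (i + 1) = a' i := fun i hi => by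
    simp [hX, inputArray, List.getElem?_append, ha', hi]
  have hXr : X (n + 1) = r ∨ X (n + 1) = 0 ∧ r = 1 := by
    rcases hys with rfl | ⟨rfl, h⟩
    · left; simp [hX, inputArray]
    · right; simp [hX, inputArray, h]
  obtain ⟨N, hN⟩ : ∃ N, N = ⌊6 * (n : ℝ) / ε⌋₊ + 1 := ⟨_, rfl⟩
  obtain ⟨B, hB⟩ : ∃ B, B = 100 + 10 * n + (n + 4) * (4 * n * N + 1) := ⟨_, rfl⟩
  obtain ⟨t, c, h1, h2, h3, h4, h5⟩ := run_program (by omega) hpos hr hε hε' (X := X) rfl hXs hXr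
    hN hB
  have hn2 : (2 : ℝ) ≤ n := by exact_mod_cast hn
  set z : ℝ := n / ε with hz
  have hnz : (n : ℝ) ≤ z := by rw [hz, le_div_iff₀ hε]; nlinarith
  have hz2 : 2 ≤ z := hn2.trans hnz
  have hNz : (N : ℝ) ≤ 7 * z := by
    have := Nat.floor_le (show 0 ≤ 6 * (n : ℝ) / ε by positivity)
    rw [mul_div_assoc] at this hN
    rw [hN]
    push_cast
    linarith
  have hNn : (4 * n * N + 1 : ℝ) ≤ 29 * (n * z) := by
    nlinarith [mul_le_mul_of_nonneg_left hNz (by linarith : (0 : ℝ) ≤ n)]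
  have hBz : (B : ℝ) ≤ 103 * z ^ 3 := by
    rw [hB]
    push_cast
    have e1 : (n : ℝ) * z ≤ z * z := by nlinarith
    have e2 : ((n : ℝ) + 4) * (4 * n * N + 1) ≤ (3 * z) * (29 * (z * z)) := by
      refine mul_le_mul (by linarith) (by linarith) (by positivity) (by linarith)
    have e3 : 4 ≤ z ^ 2 := by nlinarith
    have e4 : 4 * z ≤ z ^ 3 := by nlinarith
    nlinarith
  have hr0 : 0 < r := by linarith
  have hratio : ∀ {T₁ T₂ : Finset (Fin n)} {m : ℕ → ℕ}, (∀ i : Fin n, i ∈ T₁ ↔ m i = 1) →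
      (∀ i : Fin n, i ∈ T₂ ↔ m i = 2) →
      invRatio (r * ∑ i ∈ T₁, (a i : ℝ)) (∑ i ∈ T₂, (a i : ℝ)) = score a' r n m :=
    fun {T₁ T₂ m} k1 k2 => by rw [sum_eq_markSum a k1, sum_eq_markSum a k2]; rfl
  have hsum : ∀ {T : Finset (Fin n)}, T.Nonempty → 0 < ∑ i ∈ T, (a i : ℝ) := fun hT =>
    Finset.sum_pos (fun i _ => by exact_mod_cast ha i) hT
  have hout := hratio (T₁ := marked n c 1) (T₂ := marked n c 2) (m := c.O)
    (fun i => by simp [marked]) (fun i => by simp [marked])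
  have hle : ∀ T₁ T₂ : Finset (Fin n), NonemptyDisjoint T₁ T₂ →
      0 < invRatio (r * ∑ i ∈ T₁, (a i : ℝ)) (∑ i ∈ T₂, (a i : ℝ)) ∧
      invRatio (r * ∑ i ∈ T₁, (a i : ℝ)) (∑ i ∈ T₂, (a i : ℝ)) ≤
        (1 + ε) * score a' r n c.O := by
    intro T₁ T₂ hT
    refine ⟨invRatio_pos (mul_pos hr0 (hsum hT.1)) (hsum hT.2.1), ?_⟩
    obtain ⟨m, k1, k2⟩ := exists_marks hT.2.2
    rw [hratio k1 k2]
    exact h4 m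
  -- Two different singletons exist as `2 ≤ n` and have positive score. So the output has positive
  -- score too, which forces both its sides to be nonempty.
  have hscore : 0 < score a' r n c.O := by
    have := hle {(⟨0, by omega⟩ : Fin n)} {(⟨1, by omega⟩ : Fin n)} ⟨Finset.singleton_nonempty _,
      Finset.singleton_nonempty _, by simp⟩
    exact pos_of_mul_pos_right (this.1.trans_le this.2) (by linarith)
  refine ⟨t, c, ?_, h2, h3, ⟨⟨?_, ?_, ?_⟩, fun T₁ T₂ hT => ?_⟩, fun s hs d hd => ⟨fun k => ?_, ?_⟩⟩
  · have : (t : ℝ) ≤ 500 * (n * (n * (4 * n * N + 1))) := by exact_mod_cast h1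
    refine this.trans ?_
    have e : 500 * ((n : ℝ) * (n * (4 * n * N + 1))) ≤ 500 * (n * (n * (29 * (n * z)))) := by
      gcongr
    refine e.trans (le_of_le_of_eq (b := 14500 * ((n : ℝ) ^ 3 * z)) (by nlinarith) rfl |>.trans ?_)
    have e2 : (n : ℝ) ^ 4 / ε = n ^ 3 * z := by rw [hz]; ring
    rw [e2]
    push_cast
    have : 0 ≤ (n : ℝ) ^ 3 * z := by positivity
    linarith
  · by_contra hemp
    rw [Finset.not_nonempty_iff_eq_empty] at hemp
    rw [hemp] at hout
    rw [← hout] at hscore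
    have := (pos_of_invRatio_pos (by simp)
      (Finset.sum_nonneg fun i _ => Nat.cast_nonneg _) hscore).1
    simp at this
  · by_contra hemp
    rw [Finset.not_nonempty_iff_eq_empty] at hemp
    rw [hemp] at hout
    rw [← hout] at hscore
    have := (pos_of_invRatio_pos (mul_nonneg hr0.le
      (Finset.sum_nonneg fun i _ => Nat.cast_nonneg _)) (by simp) hscore).2
    simp at this
  · rw [Finset.disjoint_left]
    intro i hi hi'
    simp only [marked, Finset.mem_filter] at hi hi'
    omega
  · obtain ⟨k1, k2⟩ := hle T₁ T₂ hT
    rw [maxMinRatio_eq_inv, maxMinRatio_eq_inv, hout, ← div_eq_mul_inv, inv_eq_one_div,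
      div_le_div_iff₀ hscore k1]
    linarith
  · have hk : (d.W k : ℝ) ≤ B := by exact_mod_cast (h5 s hs d hd).1 k
    refine hk.trans (hBz.trans ?_)
    have : z ^ 3 ≤ z ^ 20000 := pow_le_pow_right₀ (by linarith) (by norm_num)
    push_cast
    have : 0 ≤ z ^ 20000 := by positivity
    linarith
  · intro e xs he hxs k
    obtain ⟨zs, hzs, hbits⟩ := sum_bits_of_map_eq (xs := xs) (hxs.trans (by
      simp only [List.map_id']
      exact (List.map_eq_flatMap ..).symm))
    set L := bits e + (xs.map bits).sum with hL
    have he0 : 0 < e := by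
      rw [he] at hε
      exact_mod_cast hε
    have he1 := one_le_bits e
    have hHe : Height (bits e) ε := by rw [he]; exact Height.of_rat he0.le
    have hHr : Height L r := by
      rcases hys with rfl | ⟨rfl, rfl⟩
      · cases zs with
        | nil => simp at hzs
        | cons q zs =>
          simp only [List.map_cons, List.cons.injEq] at hzs
          have hq : 0 ≤ q := by
            rw [hzs.1] at hr0
            exact_mod_cast hr0.le
          rw [hzs.1]
          refine (Height.of_rat hq).mono ?_
          rw [hL, hbits, List.map_cons, List.sum_cons]
          omega
      · simpa using Height.natCast (K := L) (k := 1) Nat.one_le_two_pow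
    have hsum2 : ∑ i ∈ Finset.range n, a' i ≤ 2 ^ L := by
      have e1 : ∑ i ∈ Finset.range n, a' i = ∑ i, a i := by
        rw [Finset.sum_range]
        exact Finset.sum_congr rfl fun i _ => by simp [ha']
      rw [e1]
      exact (Nat.le_succ _).trans ((sum_succ_le_two_pow a).trans
        (Nat.pow_le_pow_right two_pos (by omega)))
    -- Here B ≤ 103 z³ with z = n/ε ≤ 2^(2L) and 103 ≤ 2^(7L).
    have hBL : B ≤ 2 ^ (13 * L) := by
      -- Every integer of the input contributes at least the one bit of its denominator, so n ≤ L.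
      have hnL : (n : ℝ) ≤ 2 ^ L := by
        exact_mod_cast (show n ≤ L by omega).trans Nat.lt_two_pow_self.le
      have hεL : 1 / ε ≤ 2 ^ L := by
        obtain ⟨p, q, k0, k1, k2, k3⟩ := hHe
        rw [k3, one_div_div]
        have hp : p ≠ 0 := by
          rintro rfl
          simp at k3
          linarith
        have hp1 : (1 : ℝ) ≤ p := by exact_mod_cast Nat.one_le_iff_ne_zero.2 hp
        have hq1 : (q : ℝ) ≤ 2 ^ L := by
          exact_mod_cast k2.trans (Nat.pow_le_pow_right two_pos (by omega))
        exact (div_le_self (Nat.cast_nonneg _) hp1).trans hq1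
      have hzL : z ≤ 2 ^ (2 * L) := by
        rw [hz, div_eq_mul_one_div, two_mul, pow_add]
        exact mul_le_mul hnL hεL (by positivity) (by positivity)
      have h7 : (103 : ℝ) ≤ 2 ^ (7 * L) := by
        calc (103 : ℝ) ≤ 2 ^ (7 * 1) := by norm_num
          _ ≤ 2 ^ (7 * L) := pow_le_pow_right₀ (by norm_num) (by omega)
      have : (B : ℝ) ≤ 2 ^ (13 * L) := by
        calc (B : ℝ) ≤ 103 * z ^ 3 := hBz
          _ ≤ 2 ^ (7 * L) * (2 ^ (2 * L)) ^ 3 := by gcongr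
          _ = 2 ^ (13 * L) := by rw [← pow_mul, ← pow_add]; congr 1; ring
      exact_mod_cast this
    obtain ⟨q, hq, hqb⟩ := ((h5 s hs d hd).2 k (13 * L) (hHe.mono (by omega)) (hHr.mono (by omega))
      (hsum2.trans (Nat.pow_le_pow_right two_pos (by omega))) hBL).exists_rat
    exact ⟨q, hq, by omega⟩

theorem SSR_admitsFPTAS : SSR.AdmitsFPTAS (fun n ε => (n : ℝ) ^ 4 / ε) := by
  refine ⟨program, 20000, fun I ε hn hε hε' => ?_⟩
  have := exists_approximation hn I.a I.pos le_rfl (Or.inr ⟨rfl, rfl⟩) hε hε'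
  simp only [one_mul, List.append_nil] at this
  exact this

theorem FactorSSR_admitsFPTAS : FactorSSR.AdmitsFPTAS (fun n ε => (n : ℝ) ^ 4 / ε) :=
  ⟨program, 20000, fun I _ hn hε hε' =>
    exists_approximation hn I.a I.pos I.one_le_r (Or.inl rfl) hε hε'⟩

/-! ### Reductions to the 2-Set problem -/

lemma nonemptyDisjoint_comm {n : ℕ} {S₁ S₂ : Finset (Fin n)} :
    NonemptyDisjoint S₁ S₂ ↔ NonemptyDisjoint S₂ S₁ := by
  rw [NonemptyDisjoint, NonemptyDisjoint, disjoint_comm, and_left_comm]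

lemma FactorInstance.cost_eq (I : FactorInstance) (S₁ S₂ : Finset (Fin I.n)) :
    FactorSSR.cost I S₁ S₂ = TwoSetSSR.cost I.toTwoSet S₂ S₁ := by
  simp only [FactorInstance.toTwoSet, maxMinRatio]
  rw [← Finset.mul_sum, max_comm, min_comm]

end SubsetSumRatio

theorem mainTheorem6 :
    SubsetSumRatio.SSR.AdmitsFPTAS (fun n ε => (n : ℝ) ^ 4 / ε) ∧
    SubsetSumRatio.FactorSSR.AdmitsFPTAS (fun n ε => (n : ℝ) ^ 4 / ε) ∧
    (∀ (I : SubsetSumRatio.SSRInstance) (S₁ S₂ : Finset (Fin I.n)),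
      (SubsetSumRatio.SSR.Feasible I S₁ S₂ ↔
        SubsetSumRatio.TwoSetSSR.Feasible I.toTwoSet S₁ S₂) ∧
      SubsetSumRatio.SSR.cost I S₁ S₂ = SubsetSumRatio.TwoSetSSR.cost I.toTwoSet S₁ S₂ ∧
      ∀ α : ℝ, SubsetSumRatio.SSR.IsApprox α I S₁ S₂ ↔
        SubsetSumRatio.TwoSetSSR.IsApprox α I.toTwoSet S₁ S₂) ∧
    (∀ (I : SubsetSumRatio.FactorInstance) (S₁ S₂ : Finset (Fin I.n)),
      (SubsetSumRatio.FactorSSR.Feasible I S₁ S₂ ↔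
        SubsetSumRatio.TwoSetSSR.Feasible I.toTwoSet S₂ S₁) ∧
      SubsetSumRatio.FactorSSR.cost I S₁ S₂ =
        SubsetSumRatio.TwoSetSSR.cost I.toTwoSet S₂ S₁ ∧
      ∀ α : ℝ, SubsetSumRatio.FactorSSR.IsApprox α I S₁ S₂ ↔
        SubsetSumRatio.TwoSetSSR.IsApprox α I.toTwoSet S₂ S₁) := by
  refine ⟨SubsetSumRatio.SSR_admitsFPTAS, SubsetSumRatio.FactorSSR_admitsFPTAS,
    fun I S₁ S₂ => ⟨Iff.rfl, rfl, fun α => Iff.rfl⟩, fun I S₁ S₂ =>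
      ⟨SubsetSumRatio.nonemptyDisjoint_comm, I.cost_eq S₁ S₂, fun α =>
        and_congr SubsetSumRatio.nonemptyDisjoint_comm
          ⟨fun h T₁ T₂ hT => ?_, fun h T₁ T₂ hT => ?_⟩⟩⟩
  -- The competing pair has to be exchanged along with the solution.
  · rw [← I.cost_eq, ← I.cost_eq]
    exact h T₂ T₁ (SubsetSumRatio.nonemptyDisjoint_comm.1 hT)
  · rw [I.cost_eq, I.cost_eq]
    exact h T₂ T₁ (SubsetSumRatio.nonemptyDisjoint_comm.1 hT)
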